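/- Consider a single-server retrial queue without waiting room: type-$i$ customers ($i=1,2$) arrive in independent Poisson streams of rates $\lambda_i>0$, service is exponential with rate $\mu>0$, a type-$i$ customer who finds the server busy joins orbit $i$ (of infinite capacity), and from each nonempty orbit $i$ retrials occur at the constant rate $\mu_i>0$. Put $\lambda=\lambda_1+\lambda_2$ and normalize time so that $\lambda+\mu+\mu_1+\mu_2=1$. Let $(Q_1(t),Q_2(t),I(t))$ be the Markov chain of the orbit sizes and the server state ($0$ idle, $1$ busy). Assume the stability condition $\lambda(\lambda_i+\mu_i)<\mu\mu_i$, $i=1,2$, and let $\pi_{m,n}(k)$ be its stationary distribution. Put $\alpha=\lambda+\mu_1+\mu_2$, $\hat\lambda_i=\alpha\lambda_i$, $\hat\mu_i=\mu\mu_i$, and assume (without loss of generality) $\hat\lambda_1<\hat\mu_1$. *Notation.* Let $$a_1(x)=\lambda_2x,\quad b_1(x)=\tfrac{\hat\mu_1}{\lambda+\mu_1}-\bigl(1-\mu_1-\mu_2-\tfrac{\lambda\mu}{\lambda+\mu_1}\bigr)x+\lambda_1x^2,\quad c(x)=\tfrac{\hat\mu_2}{\alpha}x,\quad h_1(x,y)=a_1(x)y+b_1(x),$$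 $$h_2(x,y)=\lambda_2y^2+\bigl(\mu_1+\mu_2+\tfrac{\lambda\mu}{\lambda+\mu_2}-1+\lambda_1x\bigr)y+\tfrac{\hat\mu_2}{\lambda+\mu_2},\quad h_0(x,y)=\lambda_2y+\lambda_1x-(1-\mu_1-\mu_2-\mu),$$ $\hat b(x)=\hat\lambda_1x^2-(\hat\lambda_1+\hat\lambda_2+\hat\mu_1+\hat\mu_2)x+\hat\mu_1$ and $\Delta(x)=\hat b(x)^2-4\hat\lambda_2\hat\mu_2x^2=b_+(x)b_-(x)$ with $b_\pm(x)=\hat b(x)\pm2x\sqrt{\hat\lambda_2\hat\mu_2}$. Let $x_2<x_3$ be the zeros of $b_+$ and $x_1<x_4$ those of $b_-$. Let $Y_0(x),Y_1(x)$, $|Y_0|\le|Y_1|$, be the roots $y$ of $\hat\lambda_2xy^2+\hat b(x)y+\hat\mu_2x=0$. Let $x_-<0<x_+$ be the zeros of $g(x)=\lambda\lambda_1(\lambda+\mu_1)x^2+\lambda\mu_1(\lambda+\mu_1-\mu)x-\mu\mu_1^2$, and $$Y(x_+)=1-\frac{[\lambda_1(\lambda+\mu_1)x_+-\mu\mu_1](x_+-1)}{\lambda_2(\lambda+\mu_1)x_+}.$$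 Let $\pi_2^{(1)}(y)=\sum_{n\ge1}\pi_{0,n}(1)y^{n-1}$, let $N(x,y)=h_2(x,y)\pi_2^{(1)}(y)+h_0(x,y)\pi_{0,0}(1)$, and let $x_{dom}$ be the dominant singularity (the radius of convergence) of $\pi_1^{(1)}(x)=\sum_{m\ge1}\pi_{m,0}(1)x^{m-1}$. Put $$q(x)=-\frac{1}{2\hat\lambda_2x}\sqrt{\frac{\Delta(x)}{1-x/x_3}}\ \ (\text{continuously extended to }x=x_3),\qquad p_1(x)=-\frac{\hat b(x)a_1(x)}{2\hat\lambda_2x}+b_1(x),$$ $$C_{1,0}=\frac{(\lambda+\mu_1)\sqrt{\Delta(x_+)}\,N(x_+,Y_0(x_+))}{\hat\mu_2\lambda\lambda_1x_+(x_+-1)(x_+-x_-)},\qquad C_{2,0}=\frac{2}{\lambda_1}\,\frac{N(x_{dom},Y_0(x_{dom}))}{\sqrt{x_{dom}(x_{dom}-x_1)(x_{dom}-x_2)(x_4-x_{dom})}},$$ $$C_{3,0}=-\frac{q(x_3)}{2x_3}\,\frac{d}{dy}\left[-\frac{N(x_3,y)}{h_1(x_3,y)}\right]_{y=Y_0(x_3)},$$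 and $A_i(x)=-\frac{b_1(x)}{c(x)}C_{i,0}$ ($i=1,2,3$), $B_3(x_3)=-\frac{p_1(x_3)}{c(x_3)}C_{3,0}$. *Conditions.* Let $J=\bigl(\hat\mu_1/\hat\lambda_1,\ \min(x_3,\tfrac{\mu\mu_1}{\lambda_1(\lambda+\mu_1)})\bigr)$. Condition 1: $\hat\mu_2>\hat\lambda_2$, $x_+\in J$ and $Y(x_+)<\sqrt{\hat\mu_2/\hat\lambda_2}$. Condition 2: $\hat\mu_2>\hat\lambda_2$ and $x_+=x_3\in\bigl(\hat\mu_1/\hat\lambda_1,\tfrac{\mu\mu_1}{\lambda_1(\lambda+\mu_1)}\bigr)$. Condition 3: either $\hat\mu_2\le\hat\lambda_2$; or $\hat\mu_2>\hat\lambda_2$ and $x_+\in(1,\hat\mu_1/\hat\lambda_1]$; or $\hat\mu_2>\hat\lambda_2$, $x_+\in J$ and $Y(x_+)\ge\sqrt{\hat\mu_2/\hat\lambda_2}$. **Theorem.** Write $u_m\sim v_m$ for $u_m/v_m\to1$ as $m\to\infty$. For every fixed $n\ge1$, as $m\to\infty$: * Type 1. Under Condition 1, $x_{dom}=x_+$ and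 $$\pi_{m,n}(1)\sim A_1(x_+)\Bigl(\frac1{Y_1(x_+)}\Bigr)^{n-1}\Bigl(\frac1{x_+}\Bigr)^{m-1}.$$ * Type 2. Under Condition 2, $x_{dom}=x_3$ and $$\pi_{m,n}(1)\sim\frac{A_2(x_{dom})}{\sqrt\pi}\Bigl(\frac1{Y_1(x_{dom})}\Bigr)^{n-1}m^{-1/2}\Bigl(\frac1{x_{dom}}\Bigr)^{m-1}.$$ * Type 3. Under Condition 3, $x_{dom}=x_3$ and $$\pi_{m,n}(1)\sim\frac{A_3(x_3)+(n-1)B_3(x_3)}{\sqrt\pi}\Bigl(\frac1{Y_1(x_3)}\Bigr)^{n-1}m^{-3/2}\Bigl(\frac1{x_3}\Bigr)^{m-2}.$$ In each case the power series $\pi_2^{(1)}(y)$ converges in a disc of radius larger than $Y_0(x_{dom})$, so that the constants are well defined. -/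

import Mathlib

open Filter Topology

noncomputable section

/-- The five rates of the retrial queue: the arrival rates `lam1`, `lam2` of the two streams, the
service rate `mu`, and the retrial rates `mu1`, `mu2` of the two orbits. -/
structure RetrialRates where
  lam1 : ℝ
  lam2 : ℝ
  mu : ℝ
  mu1 : ℝ
  mu2 : ℝ

namespace RetrialRates

/-- A state `(m, n, k)`: `m` customers in orbit 1, `n` in orbit 2, `k` customers in service
(`k = 0` idle, `k = 1` busy). -/
abbrev State : Type := ℕ × ℕ × Fin 2

variable (p : RetrialRates)

/-- Total arrival rate. -/
def lam : ℝ := p.lam1 + p.lam2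

/-- All rates are positive. -/
def Positive : Prop :=
  0 < p.lam1 ∧ 0 < p.lam2 ∧ 0 < p.mu ∧ 0 < p.mu1 ∧ 0 < p.mu2

/-- The normalization of time under which the uniformization parameter is one. -/
def Normalized : Prop := p.lam + p.mu + p.mu1 + p.mu2 = 1

/-- The stability condition of the queue. -/
def Stable : Prop :=
  p.lam * (p.lam1 + p.mu1) < p.mu * p.mu1 ∧ p.lam * (p.lam2 + p.mu2) < p.mu * p.mu2

/-! ### The continuous time Markov chain -/

/-- The rate of the jump from the first state to the second one.
Idle server: an arrival starts service; the head of a nonempty orbit retries and starts service.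
Busy server: a service completion; an arrival joins the orbit of its type. -/
def jumpRate : State → State → ℝ
  | (m, n, k), (m', n', k') =>
    if k = 0 ∧ k' = 1 then
      if m' = m ∧ n' = n then p.lam
      else if m = m' + 1 ∧ n' = n then p.mu1
      else if m' = m ∧ n = n' + 1 then p.mu2
      else 0
    else if k = 1 ∧ k' = 0 then
      if m' = m ∧ n' = n then p.mu else 0
    else if k = 1 ∧ k' = 1 then
      if m' = m + 1 ∧ n' = n then p.lam1
      else if m' = m ∧ n' = n + 1 then p.lam2
      else 0
    else 0

/-- `π` is a stationary probability vector of the chain: a probability distribution on the states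
that satisfies the global balance equations (all sums over states there have finite support). -/
def IsStationary (π : State → ℝ) : Prop :=
  (∀ s, 0 ≤ π s) ∧ HasSum π 1 ∧
    ∀ s, π s * ∑' t, p.jumpRate s t = ∑' t, π t * p.jumpRate t s

/-! ### The random walk censored to the busy states, and its kernel -/

/-- `α = λ + μ₁ + μ₂`. -/
def alpha : ℝ := p.lam + p.mu1 + p.mu2

/-- `λ̂₁ = α λ₁`. -/
def hatLam1 : ℝ := p.alpha * p.lam1

/-- `λ̂₂ = α λ₂`. -/
def hatLam2 : ℝ := p.alpha * p.lam2

/-- `μ̂₁ = μ μ₁`. -/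
def hatMu1 : ℝ := p.mu * p.mu1

/-- `μ̂₂ = μ μ₂`. -/
def hatMu2 : ℝ := p.mu * p.mu2

/-- `a₁(x) = λ₂ x`. -/
def a1 (x : ℝ) : ℝ := p.lam2 * x

/-- `b₁(x) = p⁽¹⁾₋₁,₀ - (1 - p⁽¹⁾₀,₀) x + p⁽¹⁾₁,₀ x²`. -/
def b1 (x : ℝ) : ℝ :=
  p.hatMu1 / (p.lam + p.mu1)
    - (1 - (p.mu1 + p.mu2 + p.lam * p.mu / (p.lam + p.mu1))) * x + p.lam1 * x ^ 2

/-- `c(x) = p₀,₋₁ x`. -/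
def c (x : ℝ) : ℝ := p.hatMu2 / p.alpha * x

/-- `h₁(x, y) = a₁(x) y + b₁(x)`. -/
def h1 (x y : ℝ) : ℝ := p.a1 x * y + p.b1 x

/-- `h₂(x, y) = a₂(x) y² + b₂(x) y + c₂(x)`. -/
def h2 (x y : ℝ) : ℝ :=
  p.lam2 * y ^ 2
    + ((p.mu1 + p.mu2 + p.lam * p.mu / (p.lam + p.mu2)) - 1 + p.lam1 * x) * y
    + p.hatMu2 / (p.lam + p.mu2)

/-- `h₀(x, y) = a₀(x) y + b₀(x)`. -/
def h0 (x y : ℝ) : ℝ :=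
  p.lam2 * y + (p.lam1 * x - (1 - (p.mu1 + p.mu2 + p.mu)))

/-- `b̂(x)`, the coefficient of `y` in the kernel `λ̂₂ x y² + b̂(x) y + μ̂₂ x`. -/
def hatB (x : ℝ) : ℝ :=
  p.hatLam1 * x ^ 2 - (p.hatLam1 + p.hatLam2 + p.hatMu1 + p.hatMu2) * x + p.hatMu1

/-- `Δ(x) = b₊(x) b₋(x)`, the discriminant of the kernel in `y`. -/
def Delta (x : ℝ) : ℝ :=
  (p.hatB x + 2 * x * √(p.hatLam2 * p.hatMu2)) * (p.hatB x - 2 * x * √(p.hatLam2 * p.hatMu2))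

/-- `Y₋(x)`; used only for real `x` with `Δ(x) ≥ 0`. -/
def YMinus (x : ℝ) : ℝ := (-p.hatB x - √(p.Delta x)) / (2 * p.hatLam2 * x)

/-- `Y₊(x)`; used only for real `x` with `Δ(x) ≥ 0`. -/
def YPlus (x : ℝ) : ℝ := (-p.hatB x + √(p.Delta x)) / (2 * p.hatLam2 * x)

/-- The branch `Y₀(x)` of smaller modulus. -/
def Y0 (x : ℝ) : ℝ := if |p.YMinus x| ≤ |p.YPlus x| then p.YMinus x else p.YPlus x

/-- The branch `Y₁(x)` of larger modulus. -/
def Y1 (x : ℝ) : ℝ := if |p.YMinus x| ≤ |p.YPlus x| then p.YPlus x else p.YMinus x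

/-- `λ̂₁ + μ̂₁ + (√λ̂₂ - √μ̂₂)²`; minus the linear coefficient of `b₊`. -/
def sPlus : ℝ := p.hatLam1 + p.hatMu1 + (√p.hatLam2 - √p.hatMu2) ^ 2

/-- `λ̂₁ + μ̂₁ + (√λ̂₂ + √μ̂₂)²`; minus the linear coefficient of `b₋`. -/
def sMinus : ℝ := p.hatLam1 + p.hatMu1 + (√p.hatLam2 + √p.hatMu2) ^ 2

/-- The smaller zero of `b₋`. -/
def x1 : ℝ := (p.sMinus - √(p.sMinus ^ 2 - 4 * p.hatLam1 * p.hatMu1)) / (2 * p.hatLam1)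

/-- The smaller zero of `b₊`. -/
def x2 : ℝ := (p.sPlus - √(p.sPlus ^ 2 - 4 * p.hatLam1 * p.hatMu1)) / (2 * p.hatLam1)

/-- The larger zero of `b₊`. -/
def x3 : ℝ := (p.sPlus + √(p.sPlus ^ 2 - 4 * p.hatLam1 * p.hatMu1)) / (2 * p.hatLam1)

/-- The larger zero of `b₋`. -/
def x4 : ℝ := (p.sMinus + √(p.sMinus ^ 2 - 4 * p.hatLam1 * p.hatMu1)) / (2 * p.hatLam1)

/-- The discriminant of the quadratic polynomial
`g(x) = λ λ₁ (λ + μ₁) x² + λ μ₁ (λ + μ₁ - μ) x - μ μ₁²`. -/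
def discG : ℝ :=
  (p.lam * p.mu1 * (p.lam + p.mu1 - p.mu)) ^ 2
    + 4 * p.lam * p.lam1 * (p.lam + p.mu1) * p.mu * p.mu1 ^ 2

/-- The positive zero of `g`. -/
def xPlus : ℝ :=
  (-(p.lam * p.mu1 * (p.lam + p.mu1 - p.mu)) + √p.discG) / (2 * p.lam * p.lam1 * (p.lam + p.mu1))

/-- The negative zero of `g`. -/
def xMinus : ℝ :=
  (-(p.lam * p.mu1 * (p.lam + p.mu1 - p.mu)) - √p.discG) / (2 * p.lam * p.lam1 * (p.lam + p.mu1))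

/-- `Y(x₊)`, the solution `y` of `h₁(x₊, y) = 0`. -/
def YAtXPlus : ℝ :=
  1 - (p.lam1 * (p.lam + p.mu1) * p.xPlus - p.mu * p.mu1) * (p.xPlus - 1)
    / (p.lam2 * (p.lam + p.mu1) * p.xPlus)

/-! ### The three parameter regions -/

/-- The interval `(μ̂₁/λ̂₁, min(x₃, μ μ₁ / (λ₁ (λ + μ₁))))`. -/
def middleInterval : Set ℝ :=
  Set.Ioo (p.hatMu1 / p.hatLam1) (min p.x3 (p.mu * p.mu1 / (p.lam1 * (p.lam + p.mu1))))

def Condition1 : Prop :=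
  p.hatLam2 < p.hatMu2 ∧ p.xPlus ∈ p.middleInterval ∧ p.YAtXPlus < √(p.hatMu2 / p.hatLam2)

def Condition2 : Prop :=
  p.hatLam2 < p.hatMu2 ∧ p.xPlus = p.x3 ∧
    p.x3 ∈ Set.Ioo (p.hatMu1 / p.hatLam1) (p.mu * p.mu1 / (p.lam1 * (p.lam + p.mu1)))

def Condition3 : Prop :=
  p.hatMu2 ≤ p.hatLam2 ∨
  (p.hatLam2 < p.hatMu2 ∧ p.xPlus ∈ Set.Ioc 1 (p.hatMu1 / p.hatLam1)) ∨
  (p.hatLam2 < p.hatMu2 ∧ p.xPlus ∈ p.middleInterval ∧ √(p.hatMu2 / p.hatLam2) ≤ p.YAtXPlus)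

/-! ### Generating functions and constants -/

/-- `π₂⁽¹⁾(y) = ∑_{n ≥ 1} π_{0,n}(1) y^{n-1}`. -/
def piTwo (π : State → ℝ) (y : ℝ) : ℝ := ∑' n : ℕ, π (0, n + 1, 1) * y ^ n

/-- The dominant singularity `x_dom` of `π₁⁽¹⁾(x) = ∑_{m ≥ 1} π_{m,0}(1) x^{m-1}`. As the
coefficients are nonnegative, it is the radius of convergence of this power series. -/
def xDom (π : State → ℝ) : ℝ :=
  sSup {r : ℝ | 0 ≤ r ∧ Summable fun m : ℕ => π (m + 1, 0, 1) * r ^ m}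

/-- `h₂(x, y) π₂⁽¹⁾(y) + h₀(x, y) π_{0,0}(1)`. -/
def boundaryTerm (π : State → ℝ) (x y : ℝ) : ℝ :=
  p.h2 x y * piTwo π y + p.h0 x y * π (0, 0, 1)

/-- The coefficient `q` in `Y₀(x) = -b̂(x) / (2 λ̂₂ x) + q(x) √(1 - x/x₃)`, that is
`q(x) = -√(Δ(x) / (1 - x/x₃)) / (2 λ̂₂ x)`, with the factor `1 - x/x₃` of `Δ` cancelled, so that
it makes sense at `x₃`; see `qCoeff_eq`. -/
def qCoeff (x : ℝ) : ℝ :=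
  -(1 / (2 * p.hatLam2 * x)) *
    √(p.hatLam1 ^ 2 * p.x3 * (x - p.x1) * (x - p.x2) * (p.x4 - x))

/-- `C_{1,0}`. -/
def C1 (π : State → ℝ) : ℝ :=
  (p.lam + p.mu1) * √(p.Delta p.xPlus) * p.boundaryTerm π p.xPlus (p.Y0 p.xPlus)
    / (p.hatMu2 * p.lam * p.lam1 * p.xPlus * (p.xPlus - 1) * (p.xPlus - p.xMinus))

/-- `C_{2,0}`. -/
def C2 (π : State → ℝ) : ℝ :=
  2 / p.lam1 * (p.boundaryTerm π (xDom π) (p.Y0 (xDom π))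
    / √(xDom π * (xDom π - p.x1) * (xDom π - p.x2) * (p.x4 - xDom π)))

/-- `C_{3,0} = -(q(x₃) / (2 x₃)) ∂T/∂y (x₃, Y₀(x₃))`, where
`T(x, y) = -(h₂(x, y) π₂⁽¹⁾(y) + h₀(x, y) π_{0,0}(1)) / h₁(x, y)`. -/
def C3 (π : State → ℝ) : ℝ :=
  -(p.qCoeff p.x3 / (2 * p.x3)) *
    deriv (fun y : ℝ => -(p.boundaryTerm π p.x3 y) / p.h1 p.x3 y) (p.Y0 p.x3)

/-- `A₁(x₊)`. -/
def A1 (π : State → ℝ) : ℝ := -(p.b1 p.xPlus / p.c p.xPlus) * p.C1 π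

/-- `A₂(x_dom)`. -/
def A2 (π : State → ℝ) : ℝ := -(p.b1 (xDom π) / p.c (xDom π)) * p.C2 π

/-- `A₃(x₃)`. -/
def A3 (π : State → ℝ) : ℝ := -(p.b1 p.x3 / p.c p.x3) * p.C3 π

/-- `p₁(x) = -b̂(x) a₁(x) / (2 λ̂₂ x) + b₁(x)`. -/
def p1 (x : ℝ) : ℝ := -(p.hatB x * p.a1 x / (2 * p.hatLam2 * x)) + p.b1 x

/-- `B₃(x₃)`. -/
def B3 (π : State → ℝ) : ℝ := -(p.p1 p.x3 / p.c p.x3) * p.C3 π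

/-- The power series `π₂⁽¹⁾` converges on a disc of radius larger than `y`. -/
def ConvergesBeyond (π : State → ℝ) (y : ℝ) : Prop :=
  ∃ R : ℝ, |y| < R ∧ Summable fun n : ℕ => π (0, n + 1, 1) * R ^ n

/-- `u ∼ v`: the quotient tends to one. -/
def AsympEq (u v : ℕ → ℝ) : Prop := Tendsto (fun m => u m / v m) atTop (𝓝 1)

theorem Delta_eq (hp : p.Positive) (x : ℝ) :
    p.Delta x = p.hatLam1 ^ 2 * ((x - p.x1) * (x - p.x2) * (x - p.x3) * (x - p.x4)) := by
  obtain ⟨h1, h2, h3, h4, h5⟩ := hp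
  have ha : 0 < p.alpha := by unfold alpha lam; linarith
  have hL1 : 0 < p.hatLam1 := mul_pos ha h1
  have hL2 : 0 < p.hatLam2 := mul_pos ha h2
  have hM1 : 0 < p.hatMu1 := mul_pos h3 h4
  have hM2 : 0 < p.hatMu2 := mul_pos h3 h5
  have key : ∀ s, p.hatLam1 + p.hatMu1 ≤ s →
      p.hatLam1 * x ^ 2 - s * x + p.hatMu1 = p.hatLam1 *
        ((x - (s - √(s ^ 2 - 4 * p.hatLam1 * p.hatMu1)) / (2 * p.hatLam1)) *
        (x - (s + √(s ^ 2 - 4 * p.hatLam1 * p.hatMu1)) / (2 * p.hatLam1))) := by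
    intro s hs
    have hd : 0 ≤ s ^ 2 - 4 * p.hatLam1 * p.hatMu1 := by
      nlinarith [sq_nonneg (p.hatLam1 - p.hatMu1)]
    have hr := Real.sq_sqrt hd
    generalize √(s ^ 2 - 4 * p.hatLam1 * p.hatMu1) = r at hr
    field_simp
    linear_combination hr
  have e : √(p.hatLam2 * p.hatMu2) = √p.hatLam2 * √p.hatMu2 := Real.sqrt_mul hL2.le _
  have e1 := Real.sq_sqrt hL2.le
  have e2 := Real.sq_sqrt hM2.le
  have kp := key p.sPlus (by unfold sPlus; nlinarith [sq_nonneg (√p.hatLam2 - √p.hatMu2)])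
  have km := key p.sMinus (by unfold sMinus; nlinarith [sq_nonneg (√p.hatLam2 + √p.hatMu2)])
  have bp : p.hatB x + 2 * x * √(p.hatLam2 * p.hatMu2)
      = p.hatLam1 * ((x - p.x2) * (x - p.x3)) := by
    unfold x2 x3
    rw [← kp, e]; unfold hatB sPlus
    linear_combination x * e1 + x * e2
  have bm : p.hatB x - 2 * x * √(p.hatLam2 * p.hatMu2)
      = p.hatLam1 * ((x - p.x1) * (x - p.x4)) := by
    unfold x1 x4
    rw [← km, e]; unfold hatB sMinus
    linear_combination x * e1 + x * e2
  unfold Delta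
  rw [bp, bm]; ring

theorem qCoeff_eq (hp : p.Positive) {x : ℝ} (hx : x ≠ p.x3) :
    p.qCoeff x = -(1 / (2 * p.hatLam2 * x)) * √(p.Delta x / (1 - x / p.x3)) := by
  have h3 : p.x3 ≠ 0 := by
    obtain ⟨h1, h2, h3, h4, h5⟩ := hp
    have ha : 0 < p.alpha := by unfold alpha lam; linarith
    have hL1 : 0 < p.hatLam1 := mul_pos ha h1
    have hM1 : 0 < p.hatMu1 := mul_pos h3 h4
    have : 0 < p.x3 := by unfold x3 sPlus; positivity
    exact this.ne'
  have h4 : p.x3 - x ≠ 0 := sub_ne_zero.mpr hx.symm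
  have : p.Delta x / (1 - x / p.x3)
      = p.hatLam1 ^ 2 * p.x3 * (x - p.x1) * (x - p.x2) * (p.x4 - x) := by
    rw [p.Delta_eq hp]
    have : 1 - x / p.x3 = (p.x3 - x) / p.x3 := by field_simp
    rw [this]
    field_simp
    ring
  rw [this]; rfl

end RetrialRates

end

/-! Eliminating the idle states turns the queue into a nearest-neighbour walk in the quarter plane
(`walk`) with invariant measure `u m n = π (m, n, 1)`. Testing invariance against X^m Y^n gives the
functional equation K·Pin + K1·P1 + N = 0, where N collects the vertical axis and the origin
(`functional_eq`). On the branch Y₀(X) of smaller modulus of the curve K = 0 it reads P1(X) = -N(X,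
Y₀(X)) / K1(X, Y₀(X)). This is known directly for 1 < |X| < p/l1 only, but its right side is built
from functions analytic in X and S = √(1 - X/x₃) and continues P1 up to its dominant singularity.
That singularity is a simple pole at x₊ if K1 vanishes on Y₀ before x₃ (Type 1), of type 1/S if the
zero sits exactly at x₃ (Type 2), and of type S if there is no zero (Type 3).

Three facts make the continuation work. The series in N has radius larger than ys = √(q/l2), which
bounds |Y₀|; this comes from the Lyapunov function x^m y^n (`summable_moment`, `exists_radius`).
Since the jump rates are nonnegative, |Y₀(X)| ≤ y₀(|X|) and Re K1 is largest on the positive axis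
(`norm_Yb_le_y0`, `re_K1_le`), so only positive real zeros of K1 matter. On the real axis,
eliminating y leaves, besides the trivial factor x - 1, a quadratic with zeros x₋ < 0 and x₊ > 1;
the zero x₊ belongs to Y₀ exactly when Y(x₊) ≤ ys (`K1_y0_neg`, `K1_y0_neg'`).

An asymptotic equivalence needs a nonzero limit. At a zero of K1 the sign of N is explicit
(`N_pos`). In Type 3 the constant is a derivative in y at the double root: a superharmonic weight
shows that the mass of row k is at least of order ys^(-k), hence Pin(x₃, y) grows at least like
1/(ys - y), which reduces the double zero of K to a simple one (`rowA_lower`, `boundary_le`,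
`ratio_deriv_pos`).

The transfer from singularity to coefficients uses no domain beyond the disc of convergence: after
subtraction of the leading term the derivative is O(1/|1 - z|), and integration by parts on the
circle of radius m/(m+1) yields a remainder O(m^(-3/4)) (`norm_coeff_le_of_norm_deriv_le`). The
balance equations finally propagate the asymptotics of row 0 to row n through a two-term recurrence
whose characteristic roots are 1/Y₀ and 1/Y₁ (`tendsto_rows`); it gives a pure geometric factor at a
zero of K1 and an additional factor linear in n at the double root. -/

noncomputable section

/-! ### Coefficient estimates from Cauchy's formula on an annulus -/

/-- The coefficient integral of a Laurent expansion does not depend on the circle. -/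
theorem circleIntegral_zpow_mul_eq {f : ℂ → ℂ} {r0 : ℝ}
    (hr0 : 0 ≤ r0) (hf : DifferentiableOn ℂ f {z | r0 < ‖z‖ ∧ ‖z‖ < 1}) (k : ℤ) {r R : ℝ}
    (hr : r0 < r) (hrR : r ≤ R) (hR : R < 1) :
    (∮ z in C(0, R), z ^ k * f z) = ∮ z in C(0, r), z ^ k * f z := by
  have hopen : IsOpen {z : ℂ | r0 < ‖z‖ ∧ ‖z‖ < 1} :=
    (isOpen_lt continuous_const continuous_norm).inter
      (isOpen_lt continuous_norm continuous_const)
  have hd : ∀ z : ℂ, r0 < ‖z‖ → ‖z‖ < 1 → DifferentiableAt ℂ (fun z => z ^ k * f z) z := by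
    intro z h1 h2
    have hz : z ≠ 0 := by rintro rfl; simp at h1; linarith
    exact (differentiableAt_zpow.2 (Or.inl hz)).mul
      ((hf z ⟨h1, h2⟩).differentiableAt (hopen.mem_nhds ⟨h1, h2⟩))
  refine Complex.circleIntegral_eq_of_differentiable_on_annulus_off_countable
    (by linarith) hrR Set.countable_empty ?_ ?_
  · rintro z ⟨h1, h2⟩
    simp only [Metric.mem_closedBall, Metric.mem_ball, dist_zero_right, not_lt] at h1 h2
    exact (hd z (by linarith) (by linarith)).continuousAt.continuousWithinAt
  · rintro z ⟨⟨h1, h2⟩, -⟩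
    simp only [Metric.mem_closedBall, Metric.mem_ball, dist_zero_right, not_le] at h1 h2
    exact hd z (by linarith) (by linarith)

/-- The coefficients of a power series, on the boundary of a disc of absolute convergence. -/
theorem circleIntegral_zpow_mul_tsum {a : ℕ → ℂ} {ρ : ℝ} (hρ : 0 < ρ)
    (ha : Summable fun m => ‖a m‖ * ρ ^ m) {f : ℂ → ℂ}
    (hf : ∀ z : ℂ, ‖z‖ = ρ → f z = ∑' m, a m * z ^ m) (m : ℕ) :
    (∮ z in C(0, ρ), z ^ (-(m : ℤ) - 1) * f z) = 2 * Real.pi * Complex.I * a m := by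
  have key : HasSum (fun n => ∮ z in C(0, ρ), z ^ (-(m : ℤ) - 1) * (a n * z ^ n))
      (∮ z in C(0, ρ), z ^ (-(m : ℤ) - 1) * f z) := by
    unfold circleIntegral
    refine intervalIntegral.hasSum_integral_of_dominated_convergence
      (fun n _ => ρ * (ρ ^ (-(m : ℤ) - 1) * (‖a n‖ * ρ ^ n))) ?_ ?_ ?_ ?_ ?_
    · intro n
      refine Continuous.aestronglyMeasurable ?_
      have hne : ∀ θ, circleMap 0 ρ θ ≠ 0 := fun θ => circleMap_ne_center hρ.ne'
      have h1 : Continuous (deriv (circleMap 0 ρ)) := by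
        have : deriv (circleMap 0 ρ) = fun θ => circleMap 0 ρ θ * Complex.I := by
          ext θ; simp
        rw [this]; exact (continuous_circleMap 0 ρ).mul continuous_const
      exact h1.smul (((continuous_circleMap 0 ρ).zpow₀ _ fun θ => Or.inl (hne θ)).mul
        (continuous_const.mul ((continuous_circleMap 0 ρ).pow n)))
    · intro n
      refine Eventually.of_forall fun θ _ => ?_
      simp [abs_of_pos hρ]
    · exact Eventually.of_forall fun θ _ => (ha.mul_left _).mul_left _
    · exact intervalIntegrable_const
    · refine Eventually.of_forall fun θ _ => ?_
      have hn : ‖circleMap 0 ρ θ‖ = ρ := by simp [abs_of_pos hρ]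
      beta_reduce
      rw [hf _ hn]
      have hs : Summable fun n => a n * circleMap 0 ρ θ ^ n := by
        refine Summable.of_norm ?_
        simpa [norm_mul, norm_pow, hn, abs_of_pos hρ] using ha
      exact (hs.hasSum.mul_left _).const_smul _
  have h0 : ∀ n, (∮ z in C(0, ρ), z ^ (-(m : ℤ) - 1) * (a n * z ^ n))
      = if n = m then 2 * Real.pi * Complex.I * a m else 0 := by
    intro n
    have e : (∮ z in C(0, ρ), z ^ (-(m : ℤ) - 1) * (a n * z ^ n))
        = ∮ z in C(0, ρ), a n * (z - 0) ^ ((n : ℤ) - m - 1) := by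
      refine circleIntegral.integral_congr hρ.le fun z hz => ?_
      have hz0 : z ≠ 0 := by
        rintro rfl; simp at hz; linarith
      simp only [sub_zero]
      rw [show ((n : ℤ) - m - 1) = (-(m : ℤ) - 1) + n by ring, zpow_add₀ hz0, zpow_natCast]
      ring
    rw [e, circleIntegral.integral_const_mul]
    split_ifs with h
    · subst h
      have := circleIntegral.integral_sub_center_inv (0 : ℂ) hρ.ne'
      simp only [sub_self, zero_sub, zpow_neg_one]
      rw [this]; ring
    · rw [circleIntegral.integral_sub_zpow_of_ne (by omega), mul_zero]
  have := key.unique (by simpa only [h0] using hasSum_ite_eq m (2 * Real.pi * Complex.I * a m))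
  exact this

/-- Cauchy's formula for the coefficients of a power series whose sum continues to a function on
an annulus. -/
theorem circleIntegral_zpow_mul_continuation {a : ℕ → ℂ} {ρ r0 : ℝ} (hr0 : 0 ≤ r0) (hρ0 : r0 < ρ)
    (hρ1 : ρ < 1) (ha : Summable fun m => ‖a m‖ * ρ ^ m) {f : ℂ → ℂ}
    (hd : DifferentiableOn ℂ f {z | r0 < ‖z‖ ∧ ‖z‖ < 1})
    (hf : ∀ z : ℂ, ‖z‖ = ρ → f z = ∑' m, a m * z ^ m) (m : ℕ) {r : ℝ} (hr : r0 < r) (hr1 : r < 1) :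
    (∮ z in C(0, r), z ^ (-(m : ℤ) - 1) * f z) = 2 * Real.pi * Complex.I * a m := by
  rw [← circleIntegral_zpow_mul_tsum (by linarith) ha hf m]
  rcases le_total r ρ with h | h
  · exact (circleIntegral_zpow_mul_eq hr0 hd _ hr h hρ1).symm
  · exact circleIntegral_zpow_mul_eq hr0 hd _ hρ0 h hr1

/-- Integration by parts in the coefficient integral. -/
theorem circleIntegral_zpow_mul_deriv {f : ℂ → ℂ} {r0 : ℝ} (hr0 : 0 ≤ r0)
    (hf : DifferentiableOn ℂ f {z | r0 < ‖z‖ ∧ ‖z‖ < 1}) (m : ℕ) {r : ℝ}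
    (hr : r0 < r) (hr1 : r < 1) :
    (∮ z in C(0, r), z ^ (-(m : ℤ)) * deriv f z)
      = m * ∮ z in C(0, r), z ^ (-(m : ℤ) - 1) * f z := by
  have hopen : IsOpen {z : ℂ | r0 < ‖z‖ ∧ ‖z‖ < 1} :=
    (isOpen_lt continuous_const continuous_norm).inter
      (isOpen_lt continuous_norm continuous_const)
  have hsub : Metric.sphere (0 : ℂ) r ⊆ {z : ℂ | r0 < ‖z‖ ∧ ‖z‖ < 1} := by
    intro z hz; simp at hz; simp [hz, hr, hr1]
  have hne : ∀ z ∈ Metric.sphere (0 : ℂ) r, z ≠ 0 := by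
    rintro z hz rfl; simp at hz; linarith
  have h0 := circleIntegral.integral_eq_zero_of_hasDerivWithinAt (c := (0 : ℂ)) (R := r)
    (f := fun z => z ^ (-(m : ℤ)) * f z)
    (f' := fun z => z ^ (-(m : ℤ)) * deriv f z - m * (z ^ (-(m : ℤ) - 1) * f z))
    (by linarith) (by
      intro z hz
      have h1 := (hasDerivAt_zpow (-(m : ℤ)) z (Or.inl (hne z hz))).mul
        ((hf z (hsub hz)).differentiableAt (hopen.mem_nhds (hsub hz))).hasDerivAt
      refine h1.hasDerivWithinAt.congr_deriv ?_
      push_cast; ring)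
  have hc1 : ContinuousOn (fun z : ℂ => z ^ (-(m : ℤ)) * deriv f z) (Metric.sphere 0 r) :=
    (ContinuousOn.zpow₀ continuousOn_id _ fun z hz => Or.inl (hne z hz)).mul
      ((hf.deriv hopen).continuousOn.mono hsub)
  have hc2 : ContinuousOn (fun z : ℂ => (m : ℂ) * (z ^ (-(m : ℤ) - 1) * f z))
      (Metric.sphere 0 r) :=
    continuousOn_const.mul ((ContinuousOn.zpow₀ continuousOn_id _
      fun z hz => Or.inl (hne z hz)).mul (hf.continuousOn.mono hsub))
  rw [circleIntegral.integral_sub (hc1.circleIntegrable (by linarith))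
    (hc2.circleIntegrable (by linarith)), circleIntegral.integral_const_mul, sub_eq_zero] at h0
  exact h0

/-- |1 - r e^(iθ)|² = (1 - r)² + 4r sin²(θ/2), and 4r ≥ 1. The bound is uniform in r, hence serves
as a majorant while r tends to 1. -/
theorem sin_half_le_norm_one_sub_circleMap {r θ : ℝ} (hr : 1 / 4 ≤ r)
    (h0 : 0 ≤ θ) (h1 : θ ≤ 2 * Real.pi) : Real.sin (θ / 2) ≤ ‖1 - circleMap 0 r θ‖ := by
  have hs : 0 ≤ Real.sin (θ / 2) := Real.sin_nonneg_of_nonneg_of_le_pi (by linarith) (by linarith)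
  refine abs_le_of_sq_le_sq' ?_ (norm_nonneg _) |>.2
  have e : ‖1 - circleMap 0 r θ‖ ^ 2 = (1 - r) ^ 2 + 4 * r * Real.sin (θ / 2) ^ 2 := by
    rw [← Complex.normSq_eq_norm_sq, Complex.normSq_apply]
    have hc : Real.cos θ = 1 - 2 * Real.sin (θ / 2) ^ 2 := by
      have := Real.cos_two_mul (θ / 2)
      rw [show 2 * (θ / 2) = θ by ring] at this
      have h2 := Real.sin_sq_add_cos_sq (θ / 2)
      linarith
    have h3 := Real.sin_sq_add_cos_sq θ
    have hre : (circleMap 0 r θ).re = r * Real.cos θ := by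
      simp [circleMap, Complex.exp_re]
    have him : (circleMap 0 r θ).im = r * Real.sin θ := by
      simp [circleMap, Complex.exp_im]
    simp only [Complex.sub_re, Complex.one_re, Complex.sub_im, Complex.one_im, hre, him]
    nlinarith
  rw [e]
  nlinarith [sq_nonneg (1 - r), sq_nonneg (Real.sin (θ / 2))]

/-- Jordan's inequality on each half of the circle. The majorant has one singular term per endpoint
because θ = 0 and θ = 2π both correspond to z = 1. -/
theorem rpow_sin_half_le {θ : ℝ} (h0 : 0 < θ) (h1 : θ < 2 * Real.pi) :
    Real.sin (θ / 2) ^ (-(3 / 4) : ℝ) ≤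
      (θ / Real.pi) ^ (-(3 / 4) : ℝ) + ((2 * Real.pi - θ) / Real.pi) ^ (-(3 / 4) : ℝ) := by
  have hπ := Real.pi_pos
  have p1 : 0 < θ / Real.pi := by positivity
  have p2 : 0 < (2 * Real.pi - θ) / Real.pi := div_pos (by linarith) hπ
  rcases le_total θ Real.pi with h | h
  · have := Real.mul_le_sin (x := θ / 2) (by linarith) (by linarith)
    have e : 2 / Real.pi * (θ / 2) = θ / Real.pi := by field_simp
    rw [e] at this
    have := Real.rpow_le_rpow_of_nonpos p1 this (z := (-(3 / 4) : ℝ)) (by norm_num)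
    have := Real.rpow_nonneg p2.le (-(3 / 4) : ℝ)
    linarith
  · have := Real.mul_le_sin (x := Real.pi - θ / 2) (by linarith) (by linarith)
    have e : 2 / Real.pi * (Real.pi - θ / 2) = (2 * Real.pi - θ) / Real.pi := by field_simp
    rw [e, Real.sin_pi_sub] at this
    have := Real.rpow_le_rpow_of_nonpos p2 this (z := (-(3 / 4) : ℝ)) (by norm_num)
    have := Real.rpow_nonneg p1.le (-(3 / 4) : ℝ)
    linarith

theorem intervalIntegrable_angle_bound :
    IntervalIntegrable (fun θ : ℝ => (θ / Real.pi) ^ (-(3 / 4) : ℝ)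
      + ((2 * Real.pi - θ) / Real.pi) ^ (-(3 / 4) : ℝ)) MeasureTheory.volume 0 (2 * Real.pi) := by
  have h := intervalIntegral.intervalIntegrable_rpow' (a := 0) (b := 2) (r := (-(3 / 4) : ℝ))
    (by norm_num)
  have h1 : IntervalIntegrable (fun θ : ℝ => (θ / Real.pi) ^ (-(3 / 4) : ℝ))
      MeasureTheory.volume 0 (2 * Real.pi) := by
    have := h.comp_mul_left (c := Real.pi⁻¹) 
    convert this using 2
    · field_simp
    · simp
    · field_simp
  refine h1.add ?_
  have := (h1.comp_sub_left (2 * Real.pi)).symm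
  simpa using this

/-- If the derivative of the continued sum is `O(1 / |1 - z|)` inside the unit disc, then
the coefficients are `O(m^{-3/4})`. -/
theorem norm_coeff_le_of_norm_deriv_le {a : ℕ → ℂ} {ρ r0 C : ℝ} (hr0 : 0 ≤ r0) (hρ0 : r0 < ρ)
    (hρ1 : ρ < 1) (ha : Summable fun m => ‖a m‖ * ρ ^ m) {f : ℂ → ℂ}
    (hd : DifferentiableOn ℂ f {z | r0 < ‖z‖ ∧ ‖z‖ < 1})
    (hf : ∀ z : ℂ, ‖z‖ = ρ → f z = ∑' m, a m * z ^ m)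
    (hC : ∀ z : ℂ, ρ ≤ ‖z‖ → ‖z‖ < 1 → ‖deriv f z‖ ≤ C / ‖1 - z‖) :
    ∃ D : ℝ, ∀ᶠ m : ℕ in atTop, ‖a m‖ ≤ D * (m : ℝ) ^ (-(3 / 4) : ℝ) := by
  set J : ℝ → ℝ := fun θ : ℝ => (θ / Real.pi) ^ (-(3 / 4) : ℝ)
      + ((2 * Real.pi - θ) / Real.pi) ^ (-(3 / 4) : ℝ) with hJ
  have hC0 : 0 ≤ C := by
    have h1 := hC ρ (by simp [abs_of_pos (hr0.trans_lt hρ0)])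
      (by simpa [abs_of_pos (hr0.trans_lt hρ0)] using hρ1)
    have h2 : 0 < ‖(1 : ℂ) - ρ‖ := by
      rw [norm_pos_iff, sub_ne_zero]
      intro h; exact hρ1.ne' (by exact_mod_cast h)
    have h3 := (norm_nonneg _).trans h1
    by_contra hn
    have := div_neg_of_neg_of_pos (not_le.1 hn) h2
    linarith
  refine ⟨(2 * Real.pi)⁻¹ * (Real.exp 1 * C * 2 ^ (1 / 4 : ℝ) * ∫ θ in (0)..(2 * Real.pi), J θ), ?_⟩
  have hlim : Tendsto (fun m : ℕ => (m : ℝ) / (m + 1)) atTop (𝓝 1) :=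
    tendsto_natCast_div_add_atTop 1
  have hρ4 : max ρ (1 / 4) < 1 := max_lt hρ1 (by norm_num)
  filter_upwards [hlim.eventually (lt_mem_nhds hρ4), eventually_ge_atTop 1] with m hm hm1
  have hm0 : (0 : ℝ) < m := by exact_mod_cast hm1
  have hm1' : (1 : ℝ) ≤ m := by exact_mod_cast hm1
  -- This radius balances the two factors: r^(-m) stays below e, while the distance 1 - r to the
  -- singularity is still of order 1/m.
  set r : ℝ := (m : ℝ) / (m + 1) with hrdef
  have hrρ : ρ < r := (le_max_left _ _).trans_lt hm
  have hr4 : 1 / 4 < r := (le_max_right _ _).trans_lt hm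
  have hr1 : r < 1 := by rw [hrdef, div_lt_one (by linarith)]; linarith
  have h1r : 1 - r = 1 / (m + 1) := by rw [hrdef]; field_simp; ring
  have hrpos : 0 < r := by linarith
  have e1 := circleIntegral_zpow_mul_continuation hr0 hρ0 hρ1 ha hd hf m (hρ0.trans hrρ) hr1
  have e2 := circleIntegral_zpow_mul_deriv hr0 hd m (hρ0.trans hrρ) hr1
  rw [e1] at e2
  have hrm : r ^ (-(m : ℤ)) ≤ Real.exp 1 := by
    have h : r⁻¹ = 1 / m + 1 := by rw [hrdef]; field_simp; ring
    rw [zpow_neg, zpow_natCast, ← inv_pow, h]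
    calc (1 / (m : ℝ) + 1) ^ m ≤ (Real.exp (1 / m)) ^ m := by
          gcongr; exact Real.add_one_le_exp _
      _ = Real.exp 1 := by rw [← Real.exp_nat_mul]; congr 1; field_simp
  have hb : ‖∮ z in C(0, r), z ^ (-(m : ℤ)) * deriv f z‖
      ≤ ∫ θ in (0)..(2 * Real.pi), Real.exp 1 * C * 2 ^ (1 / 4 : ℝ) * (m : ℝ) ^ (1 / 4 : ℝ) * J θ := by
    unfold circleIntegral
    refine intervalIntegral.norm_integral_le_of_norm_le (by positivity) ?_
      (intervalIntegrable_angle_bound.const_mul _)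
    have hne : ∀ᵐ θ : ℝ, θ ≠ 2 * Real.pi := by
      simp [MeasureTheory.ae_iff, MeasureTheory.measure_singleton]
    filter_upwards [hne] with θ hθ2 hθ
    have hθ0 : 0 < θ := hθ.1
    have hθ1 : θ < 2 * Real.pi := lt_of_le_of_ne hθ.2 hθ2
    have hn : ‖circleMap 0 r θ‖ = r := by simp [abs_of_pos hrpos]
    have hs : 0 < Real.sin (θ / 2) := Real.sin_pos_of_pos_of_lt_pi (by linarith) (by linarith)
    have hl1 := sin_half_le_norm_one_sub_circleMap hr4.le hθ0.le hθ1.le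
    have hl2 : 1 / (m + 1) ≤ ‖1 - circleMap 0 r θ‖ := by
      rw [← h1r]
      have := norm_sub_norm_le (1 : ℂ) (circleMap 0 r θ)
      rwa [hn, norm_one] at this
    have hpos : 0 < ‖1 - circleMap 0 r θ‖ := hs.trans_le hl1
    have hinv : 1 / ‖1 - circleMap 0 r θ‖ ≤ 2 ^ (1 / 4 : ℝ) * (m : ℝ) ^ (1 / 4 : ℝ) * J θ := by
      -- A factor 1/|1 - z| is not uniformly integrable in θ. The power 1/4 is paid by |1 - z| ≥
      -- 1/(m+1), and the remaining power 3/4 is integrable. After division by m, from the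
      -- integration by parts, this leaves m^(-3/4), which is still o(m^(-1/2)).
      have h5 : 1 / ‖1 - circleMap 0 r θ‖ = ‖1 - circleMap 0 r θ‖ ^ (-(1 / 4) : ℝ)
          * ‖1 - circleMap 0 r θ‖ ^ (-(3 / 4) : ℝ) := by
        rw [← Real.rpow_add hpos, one_div, ← Real.rpow_neg_one]; norm_num
      rw [h5]
      refine mul_le_mul ?_ ?_ (by positivity) (by positivity)
      · calc ‖1 - circleMap 0 r θ‖ ^ (-(1 / 4) : ℝ) ≤ (1 / ((m : ℝ) + 1)) ^ (-(1 / 4) : ℝ) :=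
              Real.rpow_le_rpow_of_nonpos (by positivity) hl2 (by norm_num)
          _ = ((m : ℝ) + 1) ^ (1 / 4 : ℝ) := by
              rw [one_div, Real.inv_rpow (by positivity), ← Real.rpow_neg (by positivity)]; norm_num
          _ ≤ (2 * m) ^ (1 / 4 : ℝ) := by
              exact Real.rpow_le_rpow (by positivity) (by linarith) (by norm_num)
          _ = _ := Real.mul_rpow (by norm_num) hm0.le
      · exact (Real.rpow_le_rpow_of_nonpos hs hl1 (by norm_num)).trans (rpow_sin_half_le hθ0 hθ1)
    rw [norm_smul, norm_mul, norm_zpow, deriv_circleMap, norm_mul, Complex.norm_I, hn, mul_one]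
    have h6 := hC (circleMap 0 r θ) (by rw [hn]; exact hrρ.le) (by rw [hn]; exact hr1)
    calc r * (r ^ (-(m : ℤ)) * ‖deriv f (circleMap 0 r θ)‖)
        ≤ 1 * (Real.exp 1 * (C / ‖1 - circleMap 0 r θ‖)) := by gcongr
      _ = Real.exp 1 * C * (1 / ‖1 - circleMap 0 r θ‖) := by ring
      _ ≤ Real.exp 1 * C * (2 ^ (1 / 4 : ℝ) * (m : ℝ) ^ (1 / 4 : ℝ) * J θ) := by gcongr
      _ = _ := by ring
  rw [e2, intervalIntegral.integral_const_mul] at hb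
  have hL : ‖(m : ℂ) * (2 * Real.pi * Complex.I * a m)‖ = m * (2 * Real.pi * ‖a m‖) := by
    simp [abs_of_pos Real.pi_pos]
  rw [hL] at hb
  have hmm : (m : ℝ) ^ (1 / 4 : ℝ) = m * (m : ℝ) ^ (-(3 / 4) : ℝ) := by
    nth_rewrite 2 [← Real.rpow_one (m : ℝ)]
    rw [← Real.rpow_add hm0]; norm_num
  rw [hmm] at hb
  have hπ := Real.pi_pos
  have : 2 * Real.pi * ‖a m‖ ≤ Real.exp 1 * C * 2 ^ (1 / 4 : ℝ) * (m : ℝ) ^ (-(3 / 4) : ℝ)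
      * ∫ θ in (0)..(2 * Real.pi), J θ := by
    refine le_of_mul_le_mul_left ?_ hm0
    linarith
  rw [← le_div_iff₀' (by positivity)] at this
  refine this.trans (le_of_eq ?_)
  field_simp

/-! ### The principal square root -/

/-- The principal branch of the complex square root. -/
def csqrt (w : ℂ) : ℂ := w ^ (2⁻¹ : ℂ)

theorem csqrt_sq (w : ℂ) : csqrt w ^ 2 = w := Complex.cpow_ofNat_inv_pow w 2

theorem csqrt_re_nonneg (w : ℂ) : 0 ≤ (csqrt w).re := by
  unfold csqrt; rw [Complex.cpow_inv_two_re]; positivity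

theorem csqrt_zero : csqrt 0 = 0 := by simp [csqrt]

theorem csqrt_ne_zero {w : ℂ} (hw : w ≠ 0) : csqrt w ≠ 0 := by
  intro h; have := csqrt_sq w; rw [h] at this; exact hw (by rw [← this]; ring)

theorem norm_csqrt_sq (w : ℂ) : ‖csqrt w‖ ^ 2 = ‖w‖ := by rw [← norm_pow, csqrt_sq]

theorem continuousAt_csqrt {w : ℂ} (hw : 0 ≤ w.re) : ContinuousAt csqrt w :=
  Complex.continuousAt_cpow_const_of_re_pos (Or.inl hw) (by norm_num)

theorem analyticAt_csqrt {w : ℂ} (hw : w ∈ Complex.slitPlane) : AnalyticAt ℂ csqrt w :=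
  AnalyticAt.cpow analyticAt_id analyticAt_const hw

theorem hasDerivAt_csqrt {w : ℂ} (hw : w ∈ Complex.slitPlane) :
    HasDerivAt csqrt (1 / (2 * csqrt w)) w := by
  have h0 := Complex.slitPlane_ne_zero hw
  have h1 := (hasDerivAt_id w).cpow_const (c := (2⁻¹ : ℂ)) hw
  refine h1.congr_deriv ?_
  have e : w ^ ((2⁻¹ : ℂ) - 1) = (csqrt w)⁻¹ := by
    unfold csqrt; rw [← Complex.cpow_neg]; norm_num
  simp only [id, e]
  have := csqrt_ne_zero h0
  field_simp

theorem csqrt_ofReal {x : ℝ} (hx : 0 ≤ x) : csqrt (x : ℂ) = (√x : ℝ) := by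
  unfold csqrt
  rw [Real.sqrt_eq_rpow, Complex.ofReal_cpow hx]; norm_num

theorem one_sub_re_pos {z : ℂ} (hz : ‖z‖ ≤ 1) (h1 : z ≠ 1) : 0 < (1 - z).re := by
  have h := Complex.re_le_norm z
  rcases lt_or_eq_of_le (h.trans hz) with h2 | h2
  · simp; linarith
  · exfalso
    have h3 : z.re = ‖z‖ := le_antisymm h (by linarith)
    have h4 := Complex.sq_norm_sub_sq_re z
    rw [← h3, sub_self] at h4
    exact h1 (Complex.ext h2 (by simpa using h4.symm))

theorem one_sub_mem_slitPlane {z : ℂ} (hz : ‖z‖ ≤ 1) (h1 : z ≠ 1) :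
    1 - z ∈ Complex.slitPlane := Or.inl (one_sub_re_pos hz h1)

theorem continuousOn_csqrt_one_sub : ContinuousOn (fun z : ℂ => csqrt (1 - z))
    (Metric.closedBall 0 1) := by
  intro z hz
  have : 0 ≤ (1 - z).re := by
    have h := Complex.re_le_norm z
    simp at hz ⊢; linarith
  exact ((continuousAt_csqrt this).comp (f := fun z : ℂ => 1 - z)
    (by fun_prop)).continuousWithinAt

theorem hasDerivAt_csqrt_one_sub {z : ℂ} (hz : ‖z‖ ≤ 1) (h1 : z ≠ 1) :
    HasDerivAt (fun z : ℂ => csqrt (1 - z)) (-(1 / (2 * csqrt (1 - z)))) z := by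
  have := (hasDerivAt_csqrt (one_sub_mem_slitPlane hz h1)).comp z
    ((hasDerivAt_const z (1 : ℂ)).sub (hasDerivAt_id z))
  simpa [Function.comp_def] using this

/-! ### The coefficients of `1 / √(1 - z)` -/

/-- The coefficients of the power series of `(1 - z)^(-1/2)`. -/
def invSqrtCoeff (m : ℕ) : ℝ := ∏ i ∈ Finset.range m, ((2 * i + 1) / (2 * i + 2) : ℝ)

theorem invSqrtCoeff_pos (m : ℕ) : 0 < invSqrtCoeff m :=
  Finset.prod_pos fun i _ => by positivity

theorem invSqrtCoeff_le_one (m : ℕ) : invSqrtCoeff m ≤ 1 :=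
  Finset.prod_le_one (fun i _ => by positivity) fun i _ => by
    rw [div_le_one (by positivity)]; linarith

theorem invSqrtCoeff_succ (m : ℕ) :
    invSqrtCoeff (m + 1) = invSqrtCoeff m * ((2 * m + 1) / (2 * m + 2)) :=
  Finset.prod_range_succ _ _

/-- The partial Wallis product appears on squaring; this is where the constant 1/√π of the
asymptotics originates. -/
theorem invSqrtCoeff_sq (m : ℕ) : invSqrtCoeff m ^ 2 * (2 * m + 1) = (Real.Wallis.W m)⁻¹ := by
  induction m with
  | zero => simp [invSqrtCoeff, Real.Wallis.W]
  | succ k ih =>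
    have hW := (Real.Wallis.W_pos k).ne'
    rw [invSqrtCoeff_succ, Real.Wallis.W_succ, mul_inv, ← ih]
    push_cast
    field_simp
    ring

theorem tendsto_invSqrtCoeff :
    Tendsto (fun m : ℕ => √(m : ℝ) * invSqrtCoeff m) atTop (𝓝 (1 / √Real.pi)) := by
  have h1 : Tendsto (fun m : ℕ => invSqrtCoeff m ^ 2 * (2 * m + 1)) atTop (𝓝 (Real.pi / 2)⁻¹) := by
    simp_rw [invSqrtCoeff_sq]
    exact Real.Wallis.tendsto_W_nhds_pi_div_two.inv₀ (by positivity)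
  have h2 := Stirling.tendsto_self_div_two_mul_self_add_one
  have h3 := (h1.mul h2).sqrt
  have e : √((Real.pi / 2)⁻¹ * (1 / 2)) = 1 / √Real.pi := by
    rw [← Real.sqrt_one, ← Real.sqrt_div (by norm_num), Real.sqrt_one]; congr 1; field_simp
  rw [e] at h3
  refine h3.congr fun m => ?_
  have : invSqrtCoeff m ^ 2 * (2 * m + 1) * ((m : ℝ) / (2 * m + 1)) = m * invSqrtCoeff m ^ 2 := by
    field_simp
  rw [this, Real.sqrt_mul (by positivity), Real.sqrt_sq (invSqrtCoeff_pos m).le]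

/-- Both sides are the rising factorial of 1/2 divided by m!; this connects the explicit product
with the binomial series of (1 - z)^(-1/2). -/
theorem choose_half_eq (m : ℕ) :
    Ring.choose ((2⁻¹ : ℂ) + m - 1) m = (invSqrtCoeff m : ℂ) := by
  rw [← Ring.multichoose_eq]
  have h := Ring.factorial_nsmul_multichoose_eq_ascPochhammer (2⁻¹ : ℂ) m
  rw [nsmul_eq_mul] at h
  have hf : ((m.factorial : ℕ) : ℂ) ≠ 0 := by exact_mod_cast m.factorial_ne_zero
  refine mul_left_cancel₀ hf (h.trans ?_)
  clear h hf
  rw [Polynomial.ascPochhammer_smeval_eq_eval]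
  induction m with
  | zero => simp [invSqrtCoeff]
  | succ k ih =>
    rw [ascPochhammer_succ_right, Polynomial.eval_mul, ih, invSqrtCoeff_succ, Nat.factorial_succ]
    have : (k : ℂ) + 1 ≠ 0 := by exact_mod_cast k.succ_ne_zero
    simp only [Polynomial.eval_add, Polynomial.eval_X, Polynomial.eval_natCast]
    push_cast
    field_simp
    ring

theorem hasSum_invSqrtCoeff {z : ℂ} (hz : ‖z‖ < 1) :
    HasSum (fun m => (invSqrtCoeff m : ℂ) * z ^ m) (1 / csqrt (1 - z)) := by
  have h := (Complex.one_div_one_sub_cpow_hasFPowerSeriesOnBall_zero (2⁻¹ : ℂ)).hasSum (y := z)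
    (by rw [← ENNReal.ofReal_one, Metric.eball_ofReal]; simpa using hz)
  simp only [zero_add, FormalMultilinearSeries.ofScalars_apply_eq, choose_half_eq, smul_eq_mul] at h
  exact h

/-! ### Transfer theorems for algebraic singularities -/

theorem isCompact_closed_annulus (ρ : ℝ) : IsCompact {z : ℂ | ρ ≤ ‖z‖ ∧ ‖z‖ ≤ 1} := by
  have : {z : ℂ | ρ ≤ ‖z‖ ∧ ‖z‖ ≤ 1} = Metric.closedBall 0 1 ∩ {z | ρ ≤ ‖z‖} := by
    ext z; simp [and_comm]
  rw [this]
  exact (isCompact_closedBall _ _).inter_right (isClosed_le continuous_const continuous_norm)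

theorem norm_csqrt_one_sub_le_two {z : ℂ} (hz : ‖z‖ ≤ 1) : ‖csqrt (1 - z)‖ ≤ 2 := by
  have h := norm_csqrt_sq (1 - z)
  have h2 : ‖1 - z‖ ≤ 2 := by
    have := norm_sub_le (1 : ℂ) z
    rw [norm_one] at this; linarith
  nlinarith [norm_nonneg (csqrt (1 - z))]

/-- `Φ(z, √(1 - z))` differs from its value at `1` by `O(√|1 - z|)`. -/
theorem exists_norm_sub_le_csqrt {Φ : ℂ × ℂ → ℂ} {ρ : ℝ}
    (hΦ : ∀ z : ℂ, ρ ≤ ‖z‖ → ‖z‖ ≤ 1 → AnalyticAt ℂ Φ (z, csqrt (1 - z))) :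
    ∃ C : ℝ, ∀ z ∈ {z : ℂ | ρ ≤ ‖z‖ ∧ ‖z‖ ≤ 1},
      ‖Φ (z, csqrt (1 - z)) - Φ (1, 0)‖ ≤ C * ‖csqrt (1 - z)‖ := by
  have hcont : ContinuousOn (fun z : ℂ => csqrt (1 - z)) {z : ℂ | ρ ≤ ‖z‖ ∧ ‖z‖ ≤ 1} :=
    continuousOn_csqrt_one_sub.mono fun z hz => by simpa using hz.2
  -- Local bounds are glued by compactness. Near z = 1 differentiability of Φ bounds the difference
  -- by |z - 1| + |S|, and |z - 1| = |S|² ≤ 2|S|; elsewhere S is bounded away from zero.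
  refine (isCompact_closed_annulus ρ).induction_on
    (p := fun S => ∃ C : ℝ, ∀ z ∈ S, ‖Φ (z, csqrt (1 - z)) - Φ (1, 0)‖ ≤ C * ‖csqrt (1 - z)‖)
    ⟨0, by simp⟩ ?_ ?_ ?_
  · rintro s t hst ⟨C, hC⟩
    exact ⟨C, fun z hz => hC z (hst hz)⟩
  · rintro s t ⟨C, hC⟩ ⟨D, hD⟩
    refine ⟨max C D, ?_⟩
    rintro z (hz | hz)
    · exact (hC z hz).trans (by gcongr; exact le_max_left _ _)
    · exact (hD z hz).trans (by gcongr; exact le_max_right _ _)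
  · intro z0 hz0
    have hpair : ContinuousWithinAt (fun z : ℂ => (z, csqrt (1 - z)))
        {z : ℂ | ρ ≤ ‖z‖ ∧ ‖z‖ ≤ 1} z0 := continuousWithinAt_id.prodMk (hcont z0 hz0)
    have hA := hΦ z0 hz0.1 hz0.2
    by_cases h1 : z0 = 1
    · subst h1
      rw [sub_self, csqrt_zero] at hA
      have hO := hA.differentiableAt.hasFDerivAt.isBigO_sub
      obtain ⟨c, hc⟩ := hO.bound
      have ht : Tendsto (fun z : ℂ => (z, csqrt (1 - z)))
          (𝓝[{z : ℂ | ρ ≤ ‖z‖ ∧ ‖z‖ ≤ 1}] 1) (𝓝 (1, 0)) := by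
        have := hpair.tendsto
        simpa [csqrt_zero] using this
      refine ⟨_, inter_mem (ht.eventually hc) self_mem_nhdsWithin, |c| * 2, ?_⟩
      rintro z ⟨hz, hz2⟩
      refine (show ‖Φ (z, csqrt (1 - z)) - Φ (1, 0)‖ ≤ c * ‖(z, csqrt (1 - z)) - (1, 0)‖
        from hz).trans ?_
      have h3 : ‖((z, csqrt (1 - z)) : ℂ × ℂ) - (1, 0)‖ ≤ 2 * ‖csqrt (1 - z)‖ := by
        rw [Prod.mk_sub_mk, Prod.norm_mk]
        refine max_le ?_ ?_
        · rw [norm_sub_rev, ← norm_csqrt_sq, sq]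
          gcongr; exact norm_csqrt_one_sub_le_two hz2.2
        · rw [sub_zero]; linarith [norm_nonneg (csqrt (1 - z))]
      calc c * ‖((z, csqrt (1 - z)) : ℂ × ℂ) - (1, 0)‖
          ≤ |c| * ‖((z, csqrt (1 - z)) : ℂ × ℂ) - (1, 0)‖ := by gcongr; exact le_abs_self c
        _ ≤ |c| * (2 * ‖csqrt (1 - z)‖) := by gcongr
        _ = _ := by ring
    · have hs : csqrt (1 - z0) ≠ 0 := csqrt_ne_zero (sub_ne_zero.2 (Ne.symm h1))
      have hq : ContinuousWithinAt
          (fun z => ‖Φ (z, csqrt (1 - z)) - Φ (1, 0)‖ / ‖csqrt (1 - z)‖)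
          {z : ℂ | ρ ≤ ‖z‖ ∧ ‖z‖ ≤ 1} z0 := by
        refine ContinuousWithinAt.div ?_ (hcont z0 hz0).norm (norm_ne_zero_iff.2 hs)
        exact ((hA.continuousAt.comp_continuousWithinAt
          (f := fun z : ℂ => (z, csqrt (1 - z))) hpair).sub
          continuousWithinAt_const).norm
      have hev := hq.eventually (gt_mem_nhds (lt_add_one
        (‖Φ (z0, csqrt (1 - z0)) - Φ (1, 0)‖ / ‖csqrt (1 - z0)‖)))
      have hne := (hcont z0 hz0).norm.eventually (lt_mem_nhds (norm_pos_iff.2 hs))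
      refine ⟨_, hev.and hne, ‖Φ (z0, csqrt (1 - z0)) - Φ (1, 0)‖ / ‖csqrt (1 - z0)‖ + 1, ?_⟩
      rintro z ⟨hz, hz2⟩
      exact (div_le_iff₀ hz2).1 (le_of_lt hz)

/-- The chain rule for `Φ(z, √(1 - z))`. -/
theorem hasDerivAt_comp_csqrt {Φ : ℂ × ℂ → ℂ} {z : ℂ} (hz : ‖z‖ ≤ 1) (h1 : z ≠ 1)
    (hΦ : AnalyticAt ℂ Φ (z, csqrt (1 - z))) :
    HasDerivAt (fun z => Φ (z, csqrt (1 - z)))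
      (fderiv ℂ Φ (z, csqrt (1 - z)) (1, -(1 / (2 * csqrt (1 - z))))) z :=
  hΦ.differentiableAt.hasFDerivAt.comp_hasDerivAt z
    ((hasDerivAt_id z).prodMk (hasDerivAt_csqrt_one_sub hz h1))

/-- The differential of Φ is bounded on the compact annulus, so the only blow-up comes from the
derivative -1/(2S) of the square root. -/
theorem exists_norm_fderiv_le {Φ : ℂ × ℂ → ℂ} {ρ : ℝ}
    (hΦ : ∀ z : ℂ, ρ ≤ ‖z‖ → ‖z‖ ≤ 1 → AnalyticAt ℂ Φ (z, csqrt (1 - z))) :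
    ∃ C : ℝ, 0 ≤ C ∧ ∀ z ∈ {z : ℂ | ρ ≤ ‖z‖ ∧ ‖z‖ ≤ 1}, z ≠ 1 →
      ‖fderiv ℂ Φ (z, csqrt (1 - z)) (1, -(1 / (2 * csqrt (1 - z))))‖ ≤
        C / ‖csqrt (1 - z)‖ := by
  have hcont : ContinuousOn (fun z : ℂ => csqrt (1 - z)) {z : ℂ | ρ ≤ ‖z‖ ∧ ‖z‖ ≤ 1} :=
    continuousOn_csqrt_one_sub.mono fun z hz => by simpa using hz.2
  have hF : ContinuousOn (fun z : ℂ => fderiv ℂ Φ (z, csqrt (1 - z)))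
      {z : ℂ | ρ ≤ ‖z‖ ∧ ‖z‖ ≤ 1} := fun z hz =>
    (hΦ z hz.1 hz.2).fderiv.continuousAt.comp_continuousWithinAt
      (f := fun z : ℂ => (z, csqrt (1 - z))) (continuousWithinAt_id.prodMk (hcont z hz))
  obtain ⟨B, hB⟩ := (isCompact_closed_annulus ρ).exists_bound_of_continuousOn hF
  refine ⟨2 * |B|, by positivity, fun z hz h1 => ?_⟩
  have hs : 0 < ‖csqrt (1 - z)‖ := norm_pos_iff.2 (csqrt_ne_zero (sub_ne_zero.2 (Ne.symm h1)))
  have h2 := norm_csqrt_one_sub_le_two hz.2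
  refine (ContinuousLinearMap.le_opNorm _ _).trans ?_
  have h3 : ‖((1, -(1 / (2 * csqrt (1 - z)))) : ℂ × ℂ)‖ ≤ 2 / ‖csqrt (1 - z)‖ := by
    rw [Prod.norm_mk]
    refine max_le ?_ ?_
    · rw [norm_one, le_div_iff₀ hs]; linarith
    · rw [norm_neg, norm_div, norm_mul, norm_one, Complex.norm_ofNat, div_le_div_iff₀
        (by positivity) hs]
      linarith
  calc _ ≤ |B| * (2 / ‖csqrt (1 - z)‖) := by
        gcongr; exact (hB z hz).trans (le_abs_self B)
    _ = _ := by ring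

theorem tendsto_sqrt_mul_of_norm_le {a : ℕ → ℂ} {D : ℝ}
    (h : ∀ᶠ m : ℕ in atTop, ‖a m‖ ≤ D * (m : ℝ) ^ (-(3 / 4) : ℝ)) :
    Tendsto (fun m : ℕ => (√(m : ℝ) : ℂ) * a m) atTop (𝓝 0) := by
  rw [tendsto_zero_iff_norm_tendsto_zero]
  have h0 : Tendsto (fun m : ℕ => D * (m : ℝ) ^ (-(1 / 4) : ℝ)) atTop (𝓝 0) := by
    have := (tendsto_rpow_neg_atTop (y := (1 / 4 : ℝ)) (by norm_num)).comp
      tendsto_natCast_atTop_atTop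
    simpa using this.const_mul D
  refine squeeze_zero' (Eventually.of_forall fun _ => norm_nonneg _) ?_ h0
  filter_upwards [h, eventually_gt_atTop 0] with m hm hm0
  have hm0' : (0 : ℝ) < m := by exact_mod_cast hm0
  rw [norm_mul, Complex.norm_real, Real.norm_of_nonneg (Real.sqrt_nonneg _), Real.sqrt_eq_rpow]
  calc (m : ℝ) ^ (1 / 2 : ℝ) * ‖a m‖ ≤ (m : ℝ) ^ (1 / 2 : ℝ) * (D * (m : ℝ) ^ (-(3 / 4) : ℝ)) := by
        gcongr
    _ = D * ((m : ℝ) ^ (1 / 2 : ℝ) * (m : ℝ) ^ (-(3 / 4) : ℝ)) := by ring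
    _ = _ := by rw [← Real.rpow_add hm0']; norm_num

/-- Coefficients of a function with a singularity of the type `1 / √(1 - z)`. -/
theorem tendsto_coeff_of_invSqrt_singularity {a : ℕ → ℂ} {ρ r0 : ℝ} (hr0 : 0 ≤ r0) (hρ0 : r0 < ρ)
    (hρ1 : ρ < 1) (ha : Summable fun m => ‖a m‖ * ρ ^ m) {Φ : ℂ × ℂ → ℂ}
    (hΦ : ∀ z : ℂ, r0 < ‖z‖ → ‖z‖ ≤ 1 → AnalyticAt ℂ Φ (z, csqrt (1 - z)))
    (hf : ∀ z : ℂ, ‖z‖ = ρ → Φ (z, csqrt (1 - z)) / csqrt (1 - z) = ∑' m, a m * z ^ m) :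
    Tendsto (fun m : ℕ => (√(m : ℝ) : ℂ) * a m) atTop (𝓝 (Φ (1, 0) / (√Real.pi : ℝ))) := by
  have hρ : 0 < ρ := by linarith
  have hne1 : ∀ {z : ℂ}, ‖z‖ < 1 → z ≠ 1 := by rintro z hz rfl; simp at hz
  set A := Φ (1, 0) with hAdef
  -- R is the function minus its leading term A/S. Both terms in the numerator of R' are bounded, by
  -- C1 and C2/2, and the denominator is S² = 1 - z; so R' = O(1/|1 - z|).
  set R : ℂ → ℂ := fun z => (Φ (z, csqrt (1 - z)) - A) / csqrt (1 - z) with hR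
  have hΦ' : ∀ z : ℂ, ρ ≤ ‖z‖ → ‖z‖ ≤ 1 → AnalyticAt ℂ Φ (z, csqrt (1 - z)) :=
    fun z h1 h2 => hΦ z (by linarith) h2
  obtain ⟨C2, hC2⟩ := exists_norm_sub_le_csqrt hΦ'
  obtain ⟨C1, hC10, hC1⟩ := exists_norm_fderiv_le hΦ'
  have hderiv : ∀ z : ℂ, r0 < ‖z‖ → ‖z‖ < 1 → HasDerivAt R
      ((fderiv ℂ Φ (z, csqrt (1 - z)) (1, -(1 / (2 * csqrt (1 - z)))) * csqrt (1 - z)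
        - (Φ (z, csqrt (1 - z)) - A) * -(1 / (2 * csqrt (1 - z)))) / csqrt (1 - z) ^ 2) z := by
    intro z h1 h2
    have hs : csqrt (1 - z) ≠ 0 := csqrt_ne_zero (sub_ne_zero.2 (hne1 h2).symm)
    exact ((hasDerivAt_comp_csqrt h2.le (hne1 h2) (hΦ z h1 h2.le)).sub_const A).div
      (hasDerivAt_csqrt_one_sub h2.le (hne1 h2)) hs
  have hg : Summable fun m => ‖(invSqrtCoeff m : ℂ)‖ * ρ ^ m := by
    refine Summable.of_nonneg_of_le (fun m => by positivity) (fun m => ?_)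
      (summable_geometric_of_lt_one hρ.le hρ1)
    rw [Complex.norm_real, Real.norm_of_nonneg (invSqrtCoeff_pos m).le]
    exact mul_le_of_le_one_left (by positivity) (invSqrtCoeff_le_one m)
  have hb : Summable fun m => ‖a m - A * invSqrtCoeff m‖ * ρ ^ m := by
    refine Summable.of_nonneg_of_le (fun m => by positivity) (fun m => ?_)
      (ha.add (hg.mul_left ‖A‖))
    have := norm_sub_le (a m) (A * invSqrtCoeff m)
    rw [norm_mul] at this
    calc _ ≤ (‖a m‖ + ‖A‖ * ‖(invSqrtCoeff m : ℂ)‖) * ρ ^ m := by gcongr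
      _ = _ := by ring
  obtain ⟨D, hD⟩ := norm_coeff_le_of_norm_deriv_le (a := fun m => a m - A * invSqrtCoeff m)
    (f := R) (C := C1 + C2 / 2) hr0 hρ0 hρ1 hb
    (fun z hz => (hderiv z hz.1 hz.2).differentiableAt.differentiableWithinAt)
    (by
      intro z hz
      have hz1 : ‖z‖ < 1 := by linarith
      have hsum : Summable fun m => a m * z ^ m := by
        refine Summable.of_norm ?_
        simpa [norm_mul, norm_pow, hz] using ha
      have e := hasSum_invSqrtCoeff hz1
      have : R z = Φ (z, csqrt (1 - z)) / csqrt (1 - z) - A * (1 / csqrt (1 - z)) := by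
        rw [hR]; ring
      rw [this, hf z hz, ← (hsum.hasSum.sub (e.mul_left A)).tsum_eq]
      congr 1; ext m; ring)
    (by
      intro z hz1 hz2
      have hs : csqrt (1 - z) ≠ 0 := csqrt_ne_zero (sub_ne_zero.2 (hne1 hz2).symm)
      have hs' : 0 < ‖csqrt (1 - z)‖ := norm_pos_iff.2 hs
      rw [(hderiv z (by linarith) hz2).deriv, ← norm_csqrt_sq (1 - z), norm_div, norm_pow]
      gcongr
      refine (norm_sub_le _ _).trans ?_
      rw [norm_mul, norm_mul, norm_neg, norm_div, norm_mul, norm_one, Complex.norm_ofNat]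
      have h3 := hC1 z ⟨hz1, hz2.le⟩ (hne1 hz2)
      have h4 := hC2 z ⟨hz1, hz2.le⟩
      refine add_le_add ?_ ?_
      · exact (mul_le_mul_of_nonneg_right h3 hs'.le).trans_eq (by field_simp)
      · exact (mul_le_mul_of_nonneg_right h4 (by positivity)).trans_eq (by field_simp))
  have hlim := tendsto_sqrt_mul_of_norm_le hD
  have hG : Tendsto (fun m : ℕ => A * ((√(m : ℝ) * invSqrtCoeff m : ℝ) : ℂ)) atTop
      (𝓝 (A * ((1 / √Real.pi : ℝ) : ℂ))) :=
    ((Complex.continuous_ofReal.tendsto _).comp tendsto_invSqrtCoeff).const_mul A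
  have := hlim.add hG
  rw [zero_add] at this
  convert this using 2
  · push_cast; ring
  · push_cast; ring

/-- Coefficients of a function with a singularity of the type `√(1 - z)`. -/
theorem tendsto_coeff_of_sqrt_singularity {a : ℕ → ℂ} {ρ r0 : ℝ} (hr0 : 0 ≤ r0) (hρ0 : r0 < ρ)
    (hρ1 : ρ < 1) {ρ' : ℝ} (hρ' : ρ < ρ') (ha : Summable fun m => ‖a m‖ * ρ' ^ m) {Φ : ℂ × ℂ → ℂ}
    (hΦ : ∀ z : ℂ, r0 < ‖z‖ → ‖z‖ ≤ 1 → AnalyticAt ℂ Φ (z, csqrt (1 - z)))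
    (hf : ∀ z : ℂ, r0 < ‖z‖ → ‖z‖ < ρ' → ‖z‖ < 1 → Φ (z, csqrt (1 - z)) = ∑' m, a m * z ^ m) :
    Tendsto (fun m : ℕ => ((m : ℝ) ^ (3 / 2 : ℝ) : ℝ) * a m) atTop
      (𝓝 (-(fderiv ℂ Φ (1, 0) (0, 1)) / (2 * (√Real.pi : ℝ)))) := by
  have hne1 : ∀ {z : ℂ}, ‖z‖ < 1 → z ≠ 1 := by rintro z hz rfl; simp at hz
  have hρ'0 : 0 < ρ' := by linarith
  -- Reduction to the inverse square root: d/dz Φ(z, S) = Φ_z - Φ_S/(2S) = Φ'(z, S)/S, and the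
  -- derivative has coefficients (m+1) a_(m+1). The larger radius ρ' allows termwise differentiation
  -- on |z| = ρ.
  set Φ' : ℂ × ℂ → ℂ := fun v => v.2 * fderiv ℂ Φ v (1, 0) - fderiv ℂ Φ v (0, 1) / 2 with hΦ'
  have hder : ∀ z : ℂ, ‖z‖ < ρ' → HasSum (fun m : ℕ => ((m + 1 : ℕ) * a (m + 1)) * z ^ m)
      (deriv (fun w => ∑' m, a m * w ^ m) z) := by
    intro z hz
    have h := Complex.hasSum_deriv_of_summable_norm (F := fun m w => a m * w ^ m)
      (U := Metric.ball 0 ρ') ha (fun m => by fun_prop) Metric.isOpen_ball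
      (fun m w hw => by
        rw [norm_mul, norm_pow]
        have : ‖w‖ < ρ' := by simpa using hw
        gcongr)
      (by simpa using hz)
    rw [← hasSum_nat_add_iff' 1] at h
    simp only [Finset.range_one, Finset.sum_singleton, pow_zero, mul_one, deriv_const, sub_zero] at h
    refine h.congr_fun fun m => ?_
    simp
    ring
  have hρ0' : 0 < ρ := by linarith
  have hlim := tendsto_coeff_of_invSqrt_singularity (a := fun m : ℕ => ((m + 1 : ℕ) : ℂ) * a (m + 1))
    (Φ := Φ') hr0 hρ0 hρ1
    (by
      have := (hder ρ (by simpa [abs_of_pos hρ0'] using hρ')).summable.norm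
      simpa [abs_of_pos hρ0'] using this)
    (by
      intro z h1 h2
      have h := (hΦ z h1 h2).fderiv
      have h10 := ((ContinuousLinearMap.apply ℂ ℂ ((1, 0) : ℂ × ℂ)).analyticAt _).comp h
      have h01 := ((ContinuousLinearMap.apply ℂ ℂ ((0, 1) : ℂ × ℂ)).analyticAt _).comp h
      exact (analyticAt_snd.mul h10).sub (h01.div analyticAt_const two_ne_zero))
    (by
      intro z hz
      have hz1 : ‖z‖ < 1 := by linarith
      have hs : csqrt (1 - z) ≠ 0 := csqrt_ne_zero (sub_ne_zero.2 (hne1 hz1).symm)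
      rw [(hder z (by linarith)).tsum_eq]
      have heq : (fun z => Φ (z, csqrt (1 - z))) =ᶠ[𝓝 z] fun w => ∑' m, a m * w ^ m := by
        have hop : IsOpen {w : ℂ | r0 < ‖w‖ ∧ ‖w‖ < ρ' ∧ ‖w‖ < 1} :=
          (isOpen_lt continuous_const continuous_norm).inter
            ((isOpen_lt continuous_norm continuous_const).inter
              (isOpen_lt continuous_norm continuous_const))
        filter_upwards [hop.mem_nhds ⟨by linarith, by linarith, hz1⟩] with w hw
        exact hf w hw.1 hw.2.1 hw.2.2
      rw [← heq.deriv_eq, (hasDerivAt_comp_csqrt hz1.le (hne1 hz1)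
        (hΦ z (by linarith) hz1.le)).deriv]
      have : ((1, -(1 / (2 * csqrt (1 - z)))) : ℂ × ℂ)
          = (1, 0) + (-(1 / (2 * csqrt (1 - z)))) • ((0, 1) : ℂ × ℂ) := by
        simp
      rw [this, map_add, map_smul, hΦ', smul_eq_mul]
      field_simp
      ring)
  rw [← tendsto_add_atTop_iff_nat 1]
  have hratio : Tendsto (fun m : ℕ => ((√(((m + 1 : ℕ) : ℝ) / m) : ℝ) : ℂ)) atTop (𝓝 1) := by
    have h1 : Tendsto (fun m : ℕ => (((m + 1 : ℕ) : ℝ) / m)) atTop (𝓝 1) := by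
      have := (tendsto_natCast_div_add_atTop (1 : ℝ)).inv₀ one_ne_zero
      simpa using this
    have := (Complex.continuous_ofReal.tendsto _).comp h1.sqrt
    simpa only [Real.sqrt_one, Complex.ofReal_one, Function.comp_def] using this
  have h2 := hlim.mul hratio
  have e : Φ' (1, 0) / (√Real.pi : ℝ) * 1
      = -(fderiv ℂ Φ (1, 0) (0, 1)) / (2 * (√Real.pi : ℝ)) := by
    simp only [hΦ']
    have : ((√Real.pi : ℝ) : ℂ) ≠ 0 := by
      exact_mod_cast (Real.sqrt_pos.2 Real.pi_pos).ne'
    field_simp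
    ring
  rw [e] at h2
  refine h2.congr' ?_
  filter_upwards [eventually_gt_atTop 0] with m hm
  have hm' : (0 : ℝ) < m := by exact_mod_cast hm
  have h3 : (((m + 1 : ℕ) : ℝ)) ^ (3 / 2 : ℝ)
      = √(m : ℝ) * ((m + 1 : ℕ) : ℝ) * √(((m + 1 : ℕ) : ℝ) / m) := by
    rw [show (3 / 2 : ℝ) = 1 + 1 / 2 by norm_num, Real.rpow_add (by positivity), Real.rpow_one,
      ← Real.sqrt_eq_rpow, Real.sqrt_div (by positivity)]
    have := (Real.sqrt_pos.2 hm').ne'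
    field_simp
  rw [h3]
  push_cast
  ring

/-- Coefficients of a function with a simple pole at `1`. -/
theorem tendsto_coeff_of_simple_pole {a : ℕ → ℂ} {ρ r0 : ℝ} (hr0 : 0 ≤ r0) (hρ0 : r0 < ρ)
    (hρ1 : ρ < 1) (ha : Summable fun m => ‖a m‖ * ρ ^ m) {Ψ : ℂ → ℂ}
    (hΨ : ∀ z : ℂ, r0 < ‖z‖ → ‖z‖ ≤ 1 → AnalyticAt ℂ Ψ z)
    (hf : ∀ z : ℂ, ‖z‖ = ρ → Ψ z / (1 - z) = ∑' m, a m * z ^ m) :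
    Tendsto a atTop (𝓝 (Ψ 1)) := by
  have hρ : 0 < ρ := by linarith
  have hne1 : ∀ {z : ℂ}, ‖z‖ < 1 → z ≠ 1 := by rintro z hz rfl; simp at hz
  have han : ∀ z : ℂ, r0 < ‖z‖ → ‖z‖ ≤ 1 → AnalyticAt ℂ (dslope Ψ 1) z := by
    intro z h1 h2
    by_cases hz : z = 1
    · subst hz
      obtain ⟨p, hp⟩ := hΨ 1 h1 h2
      exact hp.has_fpower_series_dslope_fslope.analyticAt
    · have : (fun w => (w - 1)⁻¹ * (Ψ w - Ψ 1)) =ᶠ[𝓝 z] dslope Ψ 1 := by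
        filter_upwards [isOpen_ne.mem_nhds hz] with w hw
        rw [dslope_of_ne _ hw, slope_def_field]; ring
      refine AnalyticAt.congr ?_ this
      exact ((analyticAt_id.sub analyticAt_const).inv (sub_ne_zero.2 hz)).mul
        ((hΨ z h1 h2).sub analyticAt_const)
  have hF : ContinuousOn (deriv (dslope Ψ 1)) {z : ℂ | ρ ≤ ‖z‖ ∧ ‖z‖ ≤ 1} := fun z hz =>
    (han z (hρ0.trans_le hz.1) hz.2).deriv.continuousAt.continuousWithinAt
  obtain ⟨B, hB⟩ := (isCompact_closed_annulus ρ).exists_bound_of_continuousOn hF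
  have hg : Summable fun m => ρ ^ m := summable_geometric_of_lt_one hρ.le hρ1
  have hb : Summable fun m => ‖a m - Ψ 1‖ * ρ ^ m := by
    refine Summable.of_nonneg_of_le (fun m => by positivity) (fun m => ?_)
      (ha.add (hg.mul_left ‖Ψ 1‖))
    have := norm_sub_le (a m) (Ψ 1)
    calc _ ≤ (‖a m‖ + ‖Ψ 1‖) * ρ ^ m := by gcongr
      _ = _ := by ring
  -- The remainder (Ψ(z) - Ψ(1))/(1 - z) is analytic on the closed annulus. Its derivative is even
  -- bounded; since |1 - z| ≤ 2 this fits the O(1/|1 - z|) hypothesis.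
  obtain ⟨D, hD⟩ := norm_coeff_le_of_norm_deriv_le (a := fun m => a m - Ψ 1)
    (f := fun z => -dslope Ψ 1 z) (C := 2 * |B|) hr0 hρ0 hρ1 hb
    (fun z hz => (han z hz.1 hz.2.le).neg.differentiableAt.differentiableWithinAt)
    (by
      intro z hz
      have hz1 : ‖z‖ < 1 := by linarith
      have hsum : Summable fun m => a m * z ^ m := by
        refine Summable.of_norm ?_
        simpa [norm_mul, norm_pow, hz] using ha
      have e := hasSum_geometric_of_norm_lt_one hz1
      have hz0 : 1 - z ≠ 0 := sub_ne_zero.2 (hne1 hz1).symm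
      have : -dslope Ψ 1 z = Ψ z / (1 - z) - Ψ 1 * (1 - z)⁻¹ := by
        rw [dslope_of_ne _ (hne1 hz1), slope_def_field, ← neg_sub 1 z]
        field_simp
      rw [this, hf z hz, ← (hsum.hasSum.sub (e.mul_left (Ψ 1))).tsum_eq]
      congr 1; ext m; ring)
    (by
      intro z hz1 hz2
      have hpos : 0 < ‖1 - z‖ := norm_pos_iff.2 (sub_ne_zero.2 (hne1 hz2).symm)
      have h2 : ‖1 - z‖ ≤ 2 := by
        have := norm_sub_le (1 : ℂ) z
        rw [norm_one] at this; linarith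
      rw [deriv.fun_neg, norm_neg, le_div_iff₀ hpos]
      have := hB z ⟨hz1, hz2.le⟩
      nlinarith [le_abs_self B, abs_nonneg B, norm_nonneg (deriv (dslope Ψ 1) z)])
  have h0 : Tendsto (fun m : ℕ => D * (m : ℝ) ^ (-(3 / 4) : ℝ)) atTop (𝓝 0) := by
    have := (tendsto_rpow_neg_atTop (y := (3 / 4 : ℝ)) (by norm_num)).comp
      tendsto_natCast_atTop_atTop
    simpa using this.const_mul D
  have := squeeze_zero_norm' hD h0
  simpa using this.add_const (Ψ 1)

/-! ### Analyticity of power series and index shifts of double sums -/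

theorem analyticOnNhd_tsum_pow {a : ℕ → ℝ} (ha : ∀ n, 0 ≤ a n) {y : ℝ}
    (h : Summable fun n => a n * y ^ n) :
    AnalyticOnNhd ℂ (fun z : ℂ => ∑' n, (a n : ℂ) * z ^ n) (Metric.ball 0 y) := by
  refine DifferentiableOn.analyticOnNhd ?_ Metric.isOpen_ball
  refine Complex.differentiableOn_tsum_of_summable_norm h (fun n => by fun_prop)
    Metric.isOpen_ball fun n z hz => ?_
  rw [norm_mul, norm_pow, Complex.norm_real, Real.norm_of_nonneg (ha n)]
  have : ‖z‖ < y := by simpa using hz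
  have := ha n
  gcongr

theorem hasSum_shift_fst_iff {E : Type*} [NormedAddCommGroup E] {f : ℕ × ℕ → E} (h0 : ∀ n, f (0, n) = 0) {a : E} :
    HasSum (fun s : ℕ × ℕ => f (s.1 + 1, s.2)) a ↔ HasSum f a := by
  refine Function.Injective.hasSum_iff (g := fun s : ℕ × ℕ => (s.1 + 1, s.2)) ?_ ?_
  · rintro ⟨a, b⟩ ⟨c, d⟩ h; simpa using h
  · rintro ⟨m, n⟩ hx
    rcases m with _ | m
    · exact h0 n
    · exact absurd ⟨(m, n), rfl⟩ hx

theorem hasSum_shift_snd_iff {E : Type*} [NormedAddCommGroup E] {f : ℕ × ℕ → E} (h0 : ∀ m, f (m, 0) = 0) {a : E} :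
    HasSum (fun s : ℕ × ℕ => f (s.1, s.2 + 1)) a ↔ HasSum f a := by
  refine Function.Injective.hasSum_iff (g := fun s : ℕ × ℕ => (s.1, s.2 + 1)) ?_ ?_
  · rintro ⟨a, b⟩ ⟨c, d⟩ h; simpa using h
  · rintro ⟨m, n⟩ hx
    rcases n with _ | n
    · exact h0 m
    · exact absurd ⟨(m, n), rfl⟩ hx

/-! ### Nearest neighbour walks in the quarter plane -/

/-- A nonnegative summable invariant measure `u` of a continuous time walk in the quarter plane with
rates `l1` (right), `l2` (up), `p` or `M1` (left, inside or on the horizontal axis) and `q` or `M2`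
(down, inside or on the vertical axis). -/
structure QuarterWalk where
  l1 : ℝ
  l2 : ℝ
  p : ℝ
  q : ℝ
  M1 : ℝ
  M2 : ℝ
  l1_pos : 0 < l1
  l2_pos : 0 < l2
  p_pos : 0 < p
  q_pos : 0 < q
  p_lt : p < M1
  q_lt : q < M2
  u : ℕ → ℕ → ℝ
  u_nonneg : ∀ m n, 0 ≤ u m n
  u_summable : Summable fun s : ℕ × ℕ => u s.1 s.2
  u_ne : ∃ m n, u m n ≠ 0
  balance : ∀ m n,
    (l1 + l2 + (if m = 0 then 0 else if n = 0 then M1 else p)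
      + (if n = 0 then 0 else if m = 0 then M2 else q)) * u m n
    = (if n = 0 then M1 else p) * u (m + 1) n + (if m = 0 then M2 else q) * u m (n + 1)
      + (if m = 0 then 0 else l1 * u (m - 1) n) + (if n = 0 then 0 else l2 * u m (n - 1))

namespace QuarterWalk

variable (w : QuarterWalk)

/-- The rate of the jump to the left. -/
def left (m n : ℕ) : ℝ := if m = 0 then 0 else if n = 0 then w.M1 else w.p

/-- The rate of the jump down. -/
def down (m n : ℕ) : ℝ := if n = 0 then 0 else if m = 0 then w.M2 else w.q

theorem M1_pos : 0 < w.M1 := w.p_pos.trans w.p_lt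

theorem M2_pos : 0 < w.M2 := w.q_pos.trans w.q_lt

theorem left_nonneg (m n : ℕ) : 0 ≤ w.left m n := by
  unfold left; split_ifs <;> linarith [w.M1_pos, w.p_pos]

theorem down_nonneg (m n : ℕ) : 0 ≤ w.down m n := by
  unfold down; split_ifs <;> linarith [w.M2_pos, w.q_pos]

theorem left_le (m n : ℕ) : w.left m n ≤ w.M1 := by
  unfold left; split_ifs <;> linarith [w.M1_pos, w.p_lt]

theorem down_le (m n : ℕ) : w.down m n ≤ w.M2 := by
  unfold down; split_ifs <;> linarith [w.M2_pos, w.q_lt]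

/-- The kernel: the multiplier of `X^m Y^n` under the generator inside the quadrant. -/
def K {𝕜 : Type*} [Field 𝕜] [Algebra ℝ 𝕜] (X Y : 𝕜) : 𝕜 :=
  w.l1 • (X - 1) + w.l2 • (Y - 1) + w.p • (X⁻¹ - 1) + w.q • (Y⁻¹ - 1)

/-- The multiplier of `X^m Y^n` under the generator on the horizontal axis. -/
def K1 {𝕜 : Type*} [Field 𝕜] [Algebra ℝ 𝕜] (X Y : 𝕜) : 𝕜 :=
  w.l1 • (X - 1) + w.l2 • (Y - 1) + w.M1 • (X⁻¹ - 1)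

/-- The multiplier of `X^m Y^n` under the generator on the vertical axis. -/
def K2 {𝕜 : Type*} [Field 𝕜] [Algebra ℝ 𝕜] (X Y : 𝕜) : 𝕜 :=
  w.l1 • (X - 1) + w.l2 • (Y - 1) + w.M2 • (Y⁻¹ - 1)

/-- The multiplier of `X^m Y^n` under the generator at the origin. -/
def K0 {𝕜 : Type*} [Field 𝕜] [Algebra ℝ 𝕜] (X Y : 𝕜) : 𝕜 :=
  w.l1 • (X - 1) + w.l2 • (Y - 1)

/-! #### The generator -/

section Generator

variable {E : Type*} [NormedAddCommGroup E] [NormedSpace ℝ E]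

/-- The generator of the walk. -/
def gen (V : ℕ → ℕ → E) (m n : ℕ) : E :=
  w.l1 • (V (m + 1) n - V m n) + w.l2 • (V m (n + 1) - V m n)
    + w.left m n • (V (m - 1) n - V m n) + w.down m n • (V m (n - 1) - V m n)

/-- Invariance of `u`, tested against a function dominated by a `u`-summable one. -/
theorem hasSum_gen [CompleteSpace E] {V : ℕ → ℕ → E} {G : ℕ → ℕ → ℝ}
    (hG : Summable fun s : ℕ × ℕ => w.u s.1 s.2 * G s.1 s.2)
    (h1 : ∀ m n, ‖V (m + 1) n‖ ≤ G m n)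
    (h2 : ∀ m n, ‖V m (n + 1)‖ ≤ G m n) (h3 : ∀ m n, ‖V (m - 1) n‖ ≤ G m n)
    (h4 : ∀ m n, ‖V m (n - 1)‖ ≤ G m n) :
    HasSum (fun s : ℕ × ℕ => w.u s.1 s.2 • w.gen V s.1 s.2) 0 := by
  have key : ∀ (c : ℕ → ℕ → ℝ) (C : ℝ) (W : ℕ → ℕ → E), (∀ m n, 0 ≤ c m n) →
      (∀ m n, c m n ≤ C) → (∀ m n, ‖W m n‖ ≤ G m n) →
      Summable fun s : ℕ × ℕ => (c s.1 s.2 * w.u s.1 s.2) • W s.1 s.2 := by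
    intro c C W hc hC hW
    refine Summable.of_norm_bounded (g := fun s : ℕ × ℕ => C * (w.u s.1 s.2 * G s.1 s.2))
      (hG.mul_left C) fun s => ?_
    have hu := w.u_nonneg s.1 s.2
    rw [norm_smul, Real.norm_of_nonneg (mul_nonneg (hc _ _) hu), mul_assoc]
    exact mul_le_mul (hC _ _) (mul_le_mul_of_nonneg_left (hW _ _) hu)
      (mul_nonneg hu (norm_nonneg _)) ((hc s.1 s.2).trans (hC _ _))
  have s1 := key (fun _ _ => w.l1) w.l1 (fun m n => V (m + 1) n) (fun _ _ => w.l1_pos.le)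
    (fun _ _ => le_rfl) h1
  have s2 := key (fun _ _ => w.l2) w.l2 (fun m n => V m (n + 1)) (fun _ _ => w.l2_pos.le)
    (fun _ _ => le_rfl) h2
  have s3 := key w.left w.M1 (fun m n => V (m - 1) n) w.left_nonneg w.left_le h3
  have s4 := key w.down w.M2 (fun m n => V m (n - 1)) w.down_nonneg w.down_le h4
  -- Each jump is reindexed by its target, so that every sum carries V at the current state. The
  -- differences of old and reindexed sums total zero, and the balance equation identifies their
  -- terms with those of the generator sum.
  have t1 : HasSum (fun s : ℕ × ℕ => if s.1 = 0 then 0 else (w.l1 * w.u (s.1 - 1) s.2) • V s.1 s.2)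
      (∑' s : ℕ × ℕ, (w.l1 * w.u s.1 s.2) • V (s.1 + 1) s.2) := by
    rw [← hasSum_shift_fst_iff (by simp)]
    simpa using s1.hasSum
  have t2 : HasSum (fun s : ℕ × ℕ => if s.2 = 0 then 0 else (w.l2 * w.u s.1 (s.2 - 1)) • V s.1 s.2)
      (∑' s : ℕ × ℕ, (w.l2 * w.u s.1 s.2) • V s.1 (s.2 + 1)) := by
    rw [← hasSum_shift_snd_iff (by simp)]
    simpa using s2.hasSum
  have t3 : HasSum (fun s : ℕ × ℕ => (w.left (s.1 + 1) s.2 * w.u (s.1 + 1) s.2) • V s.1 s.2)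
      (∑' s : ℕ × ℕ, (w.left s.1 s.2 * w.u s.1 s.2) • V (s.1 - 1) s.2) := by
    have := (hasSum_shift_fst_iff (by simp [left])).2 s3.hasSum
    simpa using this
  have t4 : HasSum (fun s : ℕ × ℕ => (w.down s.1 (s.2 + 1) * w.u s.1 (s.2 + 1)) • V s.1 s.2)
      (∑' s : ℕ × ℕ, (w.down s.1 s.2 * w.u s.1 s.2) • V s.1 (s.2 - 1)) := by
    have := (hasSum_shift_snd_iff (by simp [down])).2 s4.hasSum
    simpa using this
  have hd := (((s1.hasSum.sub t1).add (s2.hasSum.sub t2)).add (s3.hasSum.sub t3)).add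
    (s4.hasSum.sub t4)
  simp only [sub_self, add_zero] at hd
  refine hd.congr_fun fun s => ?_
  obtain ⟨m, n⟩ := s
  have hb := congrArg (fun r : ℝ => r • V m n) (w.balance m n)
  simp only [add_smul, ite_smul, zero_smul] at hb
  have e3 : w.left (m + 1) n = if n = 0 then w.M1 else w.p := by simp [left]
  have e4 : w.down m (n + 1) = if m = 0 then w.M2 else w.q := by simp [down]
  have e5 : (w.l1 + w.l2 + (if m = 0 then 0 else if n = 0 then w.M1 else w.p)
      + (if n = 0 then 0 else if m = 0 then w.M2 else w.q)) = w.l1 + w.l2 + w.left m n + w.down m n := rfl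
  rw [e5, ← e3, ← e4] at hb
  simp only [gen]
  have hb' : ((w.l1 + w.l2 + w.left m n + w.down m n) * w.u m n) • V m n
      - (w.left (m + 1) n * w.u (m + 1) n) • V m n - (w.down m (n + 1) * w.u m (n + 1)) • V m n
      - (if m = 0 then 0 else (w.l1 * w.u (m - 1) n) • V m n)
      - (if n = 0 then 0 else (w.l2 * w.u m (n - 1)) • V m n) = 0 := by
    rw [hb]; abel
  refine sub_eq_zero.1 (Eq.trans ?_ (neg_eq_zero.2 hb'))
  module

end Generator

/-! #### Moments -/

section Moments

/-- The multiplier of `x^m y^n` under the generator. -/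
def mult (x y : ℝ) (m n : ℕ) : ℝ :=
  if m = 0 then (if n = 0 then w.K0 x y else w.K2 x y)
  else (if n = 0 then w.K1 x y else w.K x y)

/-- Monomials are eigenfunctions in each of the four regions. The truncated subtraction m - 1 at m =
0 is harmless because the rate to the left vanishes there; likewise for n. -/
theorem gen_pow {𝕜 : Type*} [NormedField 𝕜] [NormedAlgebra ℝ 𝕜] {X Y : 𝕜} (hX : X ≠ 0) (hY : Y ≠ 0)
    (m n : ℕ) : w.gen (fun m n => X ^ m * Y ^ n) m n =
      (if m = 0 then (if n = 0 then w.K0 X Y else w.K2 X Y)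
        else (if n = 0 then w.K1 X Y else w.K X Y)) * (X ^ m * Y ^ n) := by
  rcases m with _ | m <;> rcases n with _ | n
  · simp [gen, left, down, K0]
  · simp only [gen, left, down, K2, Algebra.smul_def]
    simp
    field_simp
    ring
  · simp only [gen, left, down, K1, Algebra.smul_def]
    simp
    field_simp
    ring
  · simp only [gen, left, down, K, Algebra.smul_def]
    simp
    field_simp
    ring

/-- Truncation gives a bounded test function, to which invariance applies with no moment assumption.
Below level T, truncating the neighbours only lowers the generator; at or above T the truncated
function is at its maximum, so the generator is nonpositive. -/
theorem gen_min_le {x y : ℝ} (hx : 0 < x) (hy : 0 < y) (T : ℝ) (m n : ℕ) :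
    w.gen (fun m n => min (x ^ m * y ^ n) T) m n ≤
      if x ^ m * y ^ n < T then w.mult x y m n * (x ^ m * y ^ n) else 0 := by
  have l1 := w.l1_pos.le
  have l2 := w.l2_pos.le
  have l3 := w.left_nonneg m n
  have l4 := w.down_nonneg m n
  split_ifs with h
  · have e := w.gen_pow hx.ne' hy.ne' m n
    unfold mult
    rw [← e]
    simp only [gen, smul_eq_mul, min_eq_left h.le]
    gcongr <;> exact min_le_left _ _
  · simp only [gen, smul_eq_mul, min_eq_right (not_lt.1 h)]
    have : ∀ c a : ℝ, 0 ≤ c → c * (min a T - T) ≤ 0 := fun c a hc =>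
      mul_nonpos_of_nonneg_of_nonpos hc (by linarith [min_le_right a T])
    linarith [this _ (x ^ (m + 1) * y ^ n) l1, this _ (x ^ m * y ^ (n + 1)) l2,
      this _ (x ^ (m - 1) * y ^ n) l3, this _ (x ^ m * y ^ (n - 1)) l4]

/-- The multiplier takes only four values. In the minimum defining δ the nonnegative ones are
replaced by the dummy value 1, which keeps δ positive. -/
theorem mult_bounds (x y : ℝ) : ∃ C δ : ℝ, 0 ≤ C ∧ 0 < δ ∧
    ∀ m n, w.mult x y m n ≤ C ∧ (w.mult x y m n < 0 → w.mult x y m n ≤ -δ) := by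
  set f : ℝ → ℝ := fun t => if t < 0 then -t else 1 with hf
  have hfpos : ∀ t, 0 < f t := by
    intro t; simp only [hf]; split_ifs <;> linarith
  have hft : ∀ t, t < 0 → f t = -t := fun t ht => by simp [hf, ht]
  refine ⟨|w.K0 x y| + |w.K1 x y| + |w.K2 x y| + |w.K x y|,
    min (min (f (w.K0 x y)) (f (w.K1 x y))) (min (f (w.K2 x y)) (f (w.K x y))), by positivity,
    lt_min (lt_min (hfpos _) (hfpos _)) (lt_min (hfpos _) (hfpos _)), fun m n => ⟨?_, ?_⟩⟩
  · unfold mult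
    split_ifs
    · linarith [le_abs_self (w.K0 x y), abs_nonneg (w.K1 x y), abs_nonneg (w.K2 x y),
        abs_nonneg (w.K x y)]
    · linarith [abs_nonneg (w.K0 x y), abs_nonneg (w.K1 x y), le_abs_self (w.K2 x y),
        abs_nonneg (w.K x y)]
    · linarith [abs_nonneg (w.K0 x y), le_abs_self (w.K1 x y), abs_nonneg (w.K2 x y),
        abs_nonneg (w.K x y)]
    · linarith [abs_nonneg (w.K0 x y), abs_nonneg (w.K1 x y), abs_nonneg (w.K2 x y),
        le_abs_self (w.K x y)]
  · have a1 := min_le_left (min (f (w.K0 x y)) (f (w.K1 x y))) (min (f (w.K2 x y)) (f (w.K x y)))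
    have a2 := min_le_right (min (f (w.K0 x y)) (f (w.K1 x y))) (min (f (w.K2 x y)) (f (w.K x y)))
    have b1 := min_le_left (f (w.K0 x y)) (f (w.K1 x y))
    have b2 := min_le_right (f (w.K0 x y)) (f (w.K1 x y))
    have b3 := min_le_left (f (w.K2 x y)) (f (w.K x y))
    have b4 := min_le_right (f (w.K2 x y)) (f (w.K x y))
    unfold mult
    split_ifs <;> intro h <;> have := hft _ h <;> linarith

/-- Finiteness of exponential moments from a negative drift. -/
theorem summable_moment {x y : ℝ} (hx : 0 < x) (hy : 0 < y) (hK : w.K x y < 0)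
    (h1 : w.K1 x y < 0 ∨ Summable fun m => w.u (m + 1) 0 * x ^ (m + 1))
    (h2 : w.K2 x y < 0 ∨ Summable fun n => w.u 0 (n + 1) * y ^ (n + 1)) :
    Summable fun s : ℕ × ℕ => w.u s.1 s.2 * (x ^ s.1 * y ^ s.2) := by
  set V : ℕ × ℕ → ℝ := fun s => x ^ s.1 * y ^ s.2 with hV
  have hVpos : ∀ s, 0 < V s := fun s => by simp only [hV]; positivity
  have hu := w.u_nonneg
  have huV : ∀ s : ℕ × ℕ, 0 ≤ w.u s.1 s.2 * V s := fun s => mul_nonneg (hu _ _) (hVpos s).le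
  obtain ⟨C, δ, hC, hδ, hCδ⟩ := w.mult_bounds x y
  -- the part of the state space with nonnegative drift
  have hD : Summable fun s : ℕ × ℕ => if 0 ≤ w.mult x y s.1 s.2 then w.u s.1 s.2 * V s else 0 := by
    have r0 := (hasSum_ite_eq ((0, 0) : ℕ × ℕ)
      (if 0 ≤ w.K0 x y then w.u 0 0 * V (0, 0) else 0)).summable
    have r1 : Summable fun s : ℕ × ℕ =>
        if s.1 ≠ 0 ∧ s.2 = 0 ∧ 0 ≤ w.K1 x y then w.u s.1 s.2 * V s else 0 := by
      rcases h1 with h1 | h1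
      · refine summable_zero.congr fun s => ?_
        simp [not_le.2 h1]
      · rw [← (show Function.Injective (fun m : ℕ => ((m + 1, 0) : ℕ × ℕ)) from
          fun a b h => by simpa using h).summable_iff]
        · by_cases h : 0 ≤ w.K1 x y
          · simpa [Function.comp_def, h, hV] using h1
          · simp [Function.comp_def, h, summable_zero]
        · rintro ⟨m, n⟩ hs
          rw [if_neg]
          rintro ⟨ha, hb, -⟩
          obtain ⟨k, hk⟩ := Nat.exists_eq_succ_of_ne_zero ha
          exact hs ⟨k, by simp at ha hb hk ⊢; omega⟩
    have r2 : Summable fun s : ℕ × ℕ =>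
        if s.1 = 0 ∧ s.2 ≠ 0 ∧ 0 ≤ w.K2 x y then w.u s.1 s.2 * V s else 0 := by
      rcases h2 with h2 | h2
      · refine summable_zero.congr fun s => ?_
        simp [not_le.2 h2]
      · rw [← (show Function.Injective (fun n : ℕ => ((0, n + 1) : ℕ × ℕ)) from
          fun a b h => by simpa using h).summable_iff]
        · by_cases h : 0 ≤ w.K2 x y
          · simpa [Function.comp_def, h, hV] using h2
          · simp [Function.comp_def, h, summable_zero]
        · rintro ⟨m, n⟩ hs
          rw [if_neg]
          rintro ⟨ha, hb, -⟩
          obtain ⟨k, hk⟩ := Nat.exists_eq_succ_of_ne_zero hb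
          exact hs ⟨k, by simp at ha hb hk ⊢; omega⟩
    refine ((r0.add r1).add r2).congr fun s => ?_
    obtain ⟨m, n⟩ := s
    rcases m with _ | m <;> rcases n with _ | n
    · simp [mult]
    · simp [mult]
    · simp [mult]
    · simp [mult, hK]
  have hE : Summable fun s : ℕ × ℕ => if w.mult x y s.1 s.2 < 0 then w.u s.1 s.2 * V s else 0 := by
    -- Invariance gives 0 ≤ C·(mass where the multiplier is nonnegative) - δ·(mass where it is
    -- negative and V < T). The resulting bound does not depend on T, and T is taken above all
    -- values of V on the given finite set.
    refine summable_of_sum_le (c := C * (∑' s : ℕ × ℕ,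
      if 0 ≤ w.mult x y s.1 s.2 then w.u s.1 s.2 * V s else 0) / δ) (fun s => ?_) fun F => ?_
    · dsimp only; split_ifs; exacts [huV s, le_rfl]
    · obtain ⟨T, hT⟩ : ∃ T : ℝ, ∀ s ∈ F, V s < T := by
        obtain ⟨T, hT⟩ := (F.image V).bddAbove
        exact ⟨T + 1, fun s hs => by
          have := hT (Finset.mem_coe.2 (Finset.mem_image_of_mem V hs)); linarith⟩
      set T' := max T 0 with hT'
      have hT'0 : 0 ≤ T' := le_max_right _ _
      have hmin0 : ∀ m n : ℕ, ‖min (x ^ m * y ^ n) T'‖ ≤ T' := fun m n => by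
        rw [Real.norm_of_nonneg (le_min (by positivity) hT'0)]; exact min_le_right _ _
      have hg := w.hasSum_gen (V := fun m n => min (x ^ m * y ^ n) T') (G := fun _ _ => T')
        (w.u_summable.mul_right _) (fun _ _ => hmin0 _ _)
        (fun _ _ => hmin0 _ _) (fun _ _ => hmin0 _ _) (fun _ _ => hmin0 _ _)
      have hET : Summable fun s : ℕ × ℕ =>
          if w.mult x y s.1 s.2 < 0 ∧ V s < T' then w.u s.1 s.2 * V s else 0 := by
        refine Summable.of_nonneg_of_le (fun s => ?_) (fun s => ?_) (w.u_summable.mul_right T')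
        · split_ifs; exacts [huV s, le_rfl]
        · split_ifs with h
          · exact mul_le_mul_of_nonneg_left h.2.le (hu _ _)
          · exact mul_nonneg (hu _ _) hT'0
      have hle := hasSum_le (f := fun s : ℕ × ℕ => w.u s.1 s.2 • w.gen (fun m n => min (x ^ m * y ^ n) T') s.1 s.2) (fun s : ℕ × ℕ => ?_) hg ((hD.hasSum.mul_left C).sub (hET.hasSum.mul_left δ))
      · rw [le_div_iff₀' hδ]
        have : ∑ s ∈ F, (if w.mult x y s.1 s.2 < 0 then w.u s.1 s.2 * V s else 0)
            ≤ ∑' s : ℕ × ℕ, if w.mult x y s.1 s.2 < 0 ∧ V s < T' then w.u s.1 s.2 * V s else 0 := by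
          refine le_trans (le_of_eq ?_) (hET.sum_le_tsum F fun s _ => ?_)
          · refine Finset.sum_congr rfl fun s hs => ?_
            have := (hT s hs).trans_le (le_max_left T 0)
            simp only [hT', this, and_true]
          · split_ifs; exacts [huV s, le_rfl]
        nlinarith
      · have hgm := w.gen_min_le hx hy T' s.1 s.2
        have hc := hCδ s.1 s.2
        have h5 := mul_le_mul_of_nonneg_left hgm (hu s.1 s.2)
        refine (show w.u s.1 s.2 • w.gen (fun m n => min (x ^ m * y ^ n) T') s.1 s.2 ≤ _ from h5).trans ?_
        have hVs : x ^ s.1 * y ^ s.2 = V s := rfl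
        rw [hVs]
        have h6 := huV s
        by_cases hV' : V s < T'
        · rcases lt_or_ge (w.mult x y s.1 s.2) 0 with hm | hm
          · simp only [hV', hm, not_le.2 hm, if_true, if_false, and_self]
            have := hc.2 hm
            nlinarith
          · simp only [hV', hm, not_lt.2 hm, if_true, if_false, false_and]
            have := hc.1
            nlinarith
        · simp only [hV', if_false, and_false]
          split_ifs
          · nlinarith
          · simp
  refine (hD.add hE).congr fun s => ?_
  rcases lt_or_ge (w.mult x y s.1 s.2) 0 with hm | hm
  · simp [hm, not_le.2 hm, hV]
  · simp [hm, not_lt.2 hm, hV]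

end Moments

end QuarterWalk

/-! ### Decomposition of quadrant sums; nonnegative concave sequences -/

theorem tsum_quadrant {E : Type*} [NormedAddCommGroup E] [CompleteSpace E] {f : ℕ × ℕ → E}
    (hf : Summable f) :
    ∑' s, f s = (∑' s : ℕ × ℕ, f (s.1 + 1, s.2 + 1)) + (∑' m : ℕ, f (m + 1, 0))
      + (∑' n : ℕ, f (0, n + 1)) + f (0, 0) := by
  have hrow : ∀ m, Summable fun n => f (m, n) := fun m =>
    hf.comp_injective (i := fun n : ℕ => (m, n)) fun _ _ h => by simpa using h
  have hcol : Summable fun m => f (m + 1, 0) :=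
    hf.comp_injective (i := fun m : ℕ => (m + 1, 0)) fun _ _ h => by simpa using h
  have hin : Summable fun s : ℕ × ℕ => f (s.1 + 1, s.2 + 1) :=
    hf.comp_injective (i := fun s : ℕ × ℕ => (s.1 + 1, s.2 + 1)) fun a b h => by
      ext <;> simp at h <;> omega
  have h1 : Summable fun s : ℕ × ℕ => f (s.1 + 1, s.2) :=
    hf.comp_injective (i := fun s : ℕ × ℕ => (s.1 + 1, s.2)) fun a b h => by
      ext <;> simp at h <;> omega
  rw [hf.tsum_prod, hf.prod.tsum_eq_zero_add, (hrow 0).tsum_eq_zero_add]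
  have h2 : ∀ m, ∑' n, f (m + 1, n) = f (m + 1, 0) + ∑' n, f (m + 1, n + 1) := fun m =>
    (hrow (m + 1)).tsum_eq_zero_add
  simp only [h2]
  rw [hcol.tsum_add hin.prod, hin.tsum_prod]
  abel

/-- One strictly negative increment bounds all later increments from above and would drive the
sequence below zero. -/
theorem monotone_of_concave_of_nonneg {f : ℕ → ℝ} (h0 : ∀ k, 0 ≤ f k)
    (hc : ∀ k, f (k + 2) + f k ≤ 2 * f (k + 1)) : Monotone f := by
  refine monotone_nat_of_le_succ fun k => ?_
  by_contra hlt
  push Not at hlt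
  set d := f (k + 1) - f k with hd
  have hdneg : d < 0 := by linarith
  have hstep : ∀ j, f (k + j + 1) - f (k + j) ≤ d := by
    intro j
    induction j with
    | zero => simp [hd]
    | succ j ih =>
      have := hc (k + j)
      rw [show k + (j + 1) + 1 = k + j + 2 by ring, show k + (j + 1) = k + j + 1 by ring]
      linarith
  have hsum : ∀ j : ℕ, f (k + j) ≤ f k + j * d := by
    intro j
    induction j with
    | zero => simp
    | succ j ih =>
      have := hstep j
      rw [← add_assoc]; push_cast; linarith
  obtain ⟨j, hj⟩ := exists_nat_gt (f k / -d)
  rw [div_lt_iff₀ (by linarith)] at hj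
  have := hsum j
  have := h0 (k + j)
  linarith

namespace QuarterWalk

variable (w : QuarterWalk)

/-- Irreducibility: at a zero of u the balance equation is a vanishing sum of nonnegative terms, so
all neighbours vanish too. Moving to the origin and from there everywhere contradicts `u_ne`. -/
theorem u_pos (m n : ℕ) : 0 < w.u m n := by
  refine lt_of_le_of_ne (w.u_nonneg m n) fun h => ?_
  have step : ∀ m n, w.u m n = 0 → w.u (m + 1) n = 0 ∧ w.u m (n + 1) = 0 ∧
      w.u (m - 1) n = 0 ∧ w.u m (n - 1) = 0 := by
    intro m n h
    have hb := w.balance m n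
    rw [h, mul_zero] at hb
    have c1 : 0 < (if n = 0 then w.M1 else w.p) := by split_ifs; exacts [w.M1_pos, w.p_pos]
    have c2 : 0 < (if m = 0 then w.M2 else w.q) := by split_ifs; exacts [w.M2_pos, w.q_pos]
    have t1 := mul_nonneg c1.le (w.u_nonneg (m + 1) n)
    have t2 := mul_nonneg c2.le (w.u_nonneg m (n + 1))
    have t3 : 0 ≤ (if m = 0 then 0 else w.l1 * w.u (m - 1) n) := by
      split_ifs; exacts [le_rfl, mul_nonneg w.l1_pos.le (w.u_nonneg _ _)]
    have t4 : 0 ≤ (if n = 0 then 0 else w.l2 * w.u m (n - 1)) := by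
      split_ifs; exacts [le_rfl, mul_nonneg w.l2_pos.le (w.u_nonneg _ _)]
    have e1 := (mul_eq_zero.1 (show (if n = 0 then w.M1 else w.p) * w.u (m + 1) n = 0 by
      linarith)).resolve_left c1.ne'
    have e2 := (mul_eq_zero.1 (show (if m = 0 then w.M2 else w.q) * w.u m (n + 1) = 0 by
      linarith)).resolve_left c2.ne'
    have e3 : (if m = 0 then 0 else w.l1 * w.u (m - 1) n) = 0 := by linarith
    have e4 : (if n = 0 then 0 else w.l2 * w.u m (n - 1)) = 0 := by linarith
    refine ⟨e1, e2, ?_, ?_⟩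
    · rcases m with _ | m
      · exact h
      · simpa [w.l1_pos.ne'] using e3
    · rcases n with _ | n
      · exact h
      · simpa [w.l2_pos.ne'] using e4
  have d1 : ∀ m n, w.u m n = 0 → w.u 0 n = 0 := by
    intro m n; induction m with
    | zero => exact id
    | succ m ih => exact fun h => ih (step (m + 1) n h).2.2.1
  have d2 : ∀ n, w.u 0 n = 0 → w.u 0 0 = 0 := by
    intro n; induction n with
    | zero => exact id
    | succ n ih => exact fun h => ih (step 0 (n + 1) h).2.2.2
  have h00 := d2 n (d1 m n h.symm)
  have a1 : ∀ n, w.u 0 n = 0 := by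
    intro n; induction n with
    | zero => exact h00
    | succ n ih => exact (step 0 n ih).2.1
  have a2 : ∀ m n, w.u m n = 0 := by
    intro m n; induction m with
    | zero => exact a1 n
    | succ m ih => exact (step m n ih).1
  obtain ⟨m, n, hmn⟩ := w.u_ne
  exact hmn (a2 m n)

/-! #### The functional equation -/

/-- Generating function of the measure on the horizontal axis without the origin. -/
def P1 {𝕜 : Type*} [NormedField 𝕜] [NormedAlgebra ℝ 𝕜] (X : 𝕜) : 𝕜 :=
  ∑' m, w.u (m + 1) 0 • X ^ (m + 1)

/-- Generating function of the measure on the vertical axis without the origin. -/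
def P2 {𝕜 : Type*} [NormedField 𝕜] [NormedAlgebra ℝ 𝕜] (Y : 𝕜) : 𝕜 :=
  ∑' n, w.u 0 (n + 1) • Y ^ (n + 1)

/-- Generating function of the measure inside the quadrant. -/
def Pin {𝕜 : Type*} [NormedField 𝕜] [NormedAlgebra ℝ 𝕜] (X Y : 𝕜) : 𝕜 :=
  ∑' s : ℕ × ℕ, w.u (s.1 + 1) (s.2 + 1) • (X ^ (s.1 + 1) * Y ^ (s.2 + 1))

/-- The contribution of the vertical axis to the functional equation. -/
def N {𝕜 : Type*} [NormedField 𝕜] [NormedAlgebra ℝ 𝕜] (X Y : 𝕜) : 𝕜 :=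
  w.K2 X Y * w.P2 Y + w.u 0 0 • w.K0 X Y

/-- Invariance is tested against X^m Y^n; the multiplier is constant on the interior, on each axis
and at the origin, so the sum splits into four generating functions. -/
theorem functional_eq {𝕜 : Type*} [NormedField 𝕜] [NormedAlgebra ℝ 𝕜] [CompleteSpace 𝕜]
    {X Y : 𝕜} (hX : X ≠ 0) (hY : Y ≠ 0)
    (hs : Summable fun s : ℕ × ℕ => w.u s.1 s.2 * (‖X‖ ^ s.1 * ‖Y‖ ^ s.2)) :
    w.K X Y * w.Pin X Y + w.K1 X Y * w.P1 X + w.N X Y = 0 := by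
  -- A jump changes ‖X‖^m ‖Y‖^n by one of the factors ‖X‖, ‖X‖⁻¹, ‖Y‖, ‖Y‖⁻¹, and by 1 where the
  -- subtraction is truncated; C dominates them all.
  set C := 1 + ‖X‖ + ‖X‖⁻¹ + ‖Y‖ + ‖Y‖⁻¹ with hC
  have hX' : 0 < ‖X‖ := norm_pos_iff.2 hX
  have hY' : 0 < ‖Y‖ := norm_pos_iff.2 hY
  have i1 : 0 < ‖X‖⁻¹ := inv_pos.2 hX'
  have i2 : 0 < ‖Y‖⁻¹ := inv_pos.2 hY'
  have hV : ∀ m n, 0 < ‖X‖ ^ m * ‖Y‖ ^ n := fun m n => by positivity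
  have aux : ∀ c m n, c ≤ C → c * (‖X‖ ^ m * ‖Y‖ ^ n) ≤ C * (‖X‖ ^ m * ‖Y‖ ^ n) :=
    fun c m n h => mul_le_mul_of_nonneg_right h (hV m n).le
  have h := w.hasSum_gen (V := fun m n => X ^ m * Y ^ n)
    (G := fun m n => C * (‖X‖ ^ m * ‖Y‖ ^ n))
    ((hs.mul_left C).congr fun s => by ring)
    (fun m n => by
      rw [norm_mul, norm_pow, norm_pow, pow_succ, mul_right_comm, mul_comm _ ‖X‖]
      exact aux _ _ _ (by linarith))
    (fun m n => by
      rw [norm_mul, norm_pow, norm_pow, pow_succ, ← mul_assoc, mul_comm _ ‖Y‖]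
      exact aux _ _ _ (by linarith))
    (fun m n => by
      rw [norm_mul, norm_pow, norm_pow]
      rcases m with _ | m
      · have := aux 1 0 n (by linarith); simpa using this
      · have := aux ‖X‖⁻¹ (m + 1) n (by linarith)
        refine le_trans (le_of_eq ?_) this
        simp only [Nat.add_sub_cancel, pow_succ]
        field_simp)
    (fun m n => by
      rw [norm_mul, norm_pow, norm_pow]
      rcases n with _ | n
      · have := aux 1 m 0 (by linarith); simpa using this
      · have := aux ‖Y‖⁻¹ m (n + 1) (by linarith)
        refine le_trans (le_of_eq ?_) this
        simp only [Nat.add_sub_cancel, pow_succ]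
        field_simp)
  have ht := tsum_quadrant h.summable
  rw [h.tsum_eq] at ht
  simp only [w.gen_pow hX hY] at ht
  simp only [Nat.add_eq_zero_iff, one_ne_zero, and_false, if_false, if_true, pow_zero, one_mul,
    mul_one, ← mul_smul_comm _ (_ : 𝕜), tsum_mul_left] at ht
  rw [Pin, P1, N, P2]
  simp only [Algebra.smul_def, mul_left_comm (X ^ _) (algebraMap ℝ 𝕜 _)] at ht ⊢
  linear_combination -ht

/-! #### Convergence of the boundary generating functions -/

/-- The geometric mean `√(q / l2)`. -/
def ys : ℝ := √(w.q / w.l2)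

theorem ys_pos : 0 < w.ys := Real.sqrt_pos.2 (div_pos w.q_pos w.l2_pos)

theorem l2_mul_ys_sq : w.l2 * w.ys ^ 2 = w.q := by
  rw [ys, Real.sq_sqrt (div_pos w.q_pos w.l2_pos).le]
  have := w.l2_pos.ne'
  field_simp

theorem K_eq (x y : ℝ) (hx : x ≠ 0) (hy : y ≠ 0) :
    w.K x y = (x - 1) * (w.l1 - w.p / x) + (y - 1) * (w.l2 - w.q / y) := by
  simp only [K, smul_eq_mul]; field_simp; ring

theorem K1_eq (x y : ℝ) (hx : x ≠ 0) :
    w.K1 x y = (x - 1) * (w.l1 - w.M1 / x) + w.l2 * (y - 1) := by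
  simp only [K1, smul_eq_mul]; field_simp; ring

theorem K2_eq (x y : ℝ) (hy : y ≠ 0) :
    w.K2 x y = w.l1 * (x - 1) + (y - 1) * (w.l2 - w.M2 / y) := by
  simp only [K2, smul_eq_mul]; field_simp; ring

theorem summable_axis1_one : Summable fun m => w.u (m + 1) 0 :=
  w.u_summable.comp_injective (i := fun m : ℕ => (m + 1, 0)) fun _ _ h => by simpa using h

theorem summable_axis2_one : Summable fun n => w.u 0 (n + 1) :=
  w.u_summable.comp_injective (i := fun n : ℕ => (0, n + 1)) fun _ _ h => by simpa using h

theorem summable_axis1 {x y : ℝ}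
    (h : Summable fun s : ℕ × ℕ => w.u s.1 s.2 * (x ^ s.1 * y ^ s.2)) :
    Summable fun m => w.u (m + 1) 0 * x ^ (m + 1) := by
  have := h.comp_injective (i := fun m : ℕ => (m + 1, 0)) fun _ _ h => by simpa using h
  simpa [Function.comp_def] using this

theorem summable_axis2 {x y : ℝ}
    (h : Summable fun s : ℕ × ℕ => w.u s.1 s.2 * (x ^ s.1 * y ^ s.2)) :
    Summable fun n => w.u 0 (n + 1) * y ^ (n + 1) := by
  have := h.comp_injective (i := fun n : ℕ => (0, n + 1)) fun _ _ h => by simpa using h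
  simpa [Function.comp_def] using this

theorem summable_axis1_mono {x x' : ℝ} (hx : 0 ≤ x) (hxx : x ≤ x')
    (h : Summable fun m => w.u (m + 1) 0 * x' ^ (m + 1)) :
    Summable fun m => w.u (m + 1) 0 * x ^ (m + 1) :=
  Summable.of_nonneg_of_le (fun m => mul_nonneg (w.u_nonneg _ _) (by positivity))
    (fun m => mul_le_mul_of_nonneg_left (pow_le_pow_left₀ hx hxx _) (w.u_nonneg _ _)) h

theorem summable_axis2_mono {y y' : ℝ} (hy : 0 ≤ y) (hyy : y ≤ y')
    (h : Summable fun n => w.u 0 (n + 1) * y' ^ (n + 1)) :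
    Summable fun n => w.u 0 (n + 1) * y ^ (n + 1) :=
  Summable.of_nonneg_of_le (fun m => mul_nonneg (w.u_nonneg _ _) (by positivity))
    (fun m => mul_le_mul_of_nonneg_left (pow_le_pow_left₀ hy hyy _) (w.u_nonneg _ _)) h

theorem summable_moment_mono {x y x' y' : ℝ} (hx : 0 ≤ x) (hy : 0 ≤ y) (hxx : x ≤ x') (hyy : y ≤ y')
    (h : Summable fun s : ℕ × ℕ => w.u s.1 s.2 * (x' ^ s.1 * y' ^ s.2)) :
    Summable fun s : ℕ × ℕ => w.u s.1 s.2 * (x ^ s.1 * y ^ s.2) :=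
  Summable.of_nonneg_of_le (fun m => mul_nonneg (w.u_nonneg _ _) (by positivity))
    (fun m => mul_le_mul_of_nonneg_left (mul_le_mul (pow_le_pow_left₀ hx hxx _)
      (pow_le_pow_left₀ hy hyy _) (by positivity) (pow_nonneg (hx.trans hxx) _)) (w.u_nonneg _ _)) h

/-- Horizontal exponential moments. -/
theorem summable_moment_one {x : ℝ} (h1 : 1 < x) (hx : x < w.p / w.l1) :
    Summable fun s : ℕ × ℕ => w.u s.1 s.2 * (x ^ s.1 * 1 ^ s.2) := by
  have hx0 : 0 < x := by linarith
  rw [lt_div_iff₀ w.l1_pos] at hx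
  have e1 : w.l1 < w.p / x := by rw [lt_div_iff₀ hx0]; linarith
  have e2 : w.l1 < w.M1 / x := by rw [lt_div_iff₀ hx0]; linarith [w.p_lt]
  refine w.summable_moment hx0 one_pos ?_ (Or.inl ?_) (Or.inr (by simpa using w.summable_axis2_one))
  · rw [w.K_eq x 1 hx0.ne' one_ne_zero]; nlinarith
  · rw [w.K1_eq x 1 hx0.ne']; nlinarith

/-- The vertical boundary generating function converges beyond `√(q / l2)`. -/
theorem exists_radius (hlp : w.l1 < w.p) :
    ∃ R, w.ys < R ∧ Summable fun n => w.u 0 (n + 1) * R ^ (n + 1) := by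
  have hl2 := w.l2_pos
  have hq := w.q_pos
  have hqM := w.q_lt
  have hys := w.l2_mul_ys_sq
  have hy0 := w.ys_pos
  rcases lt_trichotomy w.q w.l2 with h | h | h
  -- Here ys < 1, and summability of u itself gives the radius 1.
  · refine ⟨1, ?_, by simpa using w.summable_axis2_one⟩
    by_contra hn
    push Not at hn
    have : 1 ≤ w.ys ^ 2 := by nlinarith
    nlinarith
  · have hys1 : w.ys = 1 := by rw [ys, h, div_self hl2.ne', Real.sqrt_one]
    rw [hys1]
    have hl1 := w.l1_pos
    have hp := w.p_pos
    set x1 := (1 + w.p / w.l1) / 2 with hx1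
    have hr : 1 < w.p / w.l1 := by rw [lt_div_iff₀ hl1]; linarith
    have hx11 : 1 < x1 := by rw [hx1]; linarith
    have hx1p : x1 < w.p / w.l1 := by rw [hx1]; linarith
    have hP1 := w.summable_axis1 (w.summable_moment_one hx11 hx1p)
    set y1 := (1 + w.M2 / w.l2) / 2 with hy1
    have hrM : 1 < w.M2 / w.l2 := by rw [lt_div_iff₀ hl2]; linarith
    have hy11 : 1 < y1 := by rw [hy1]; linarith
    have hy1M : y1 < w.M2 / w.l2 := by rw [hy1]; linarith
    set d := w.M2 / y1 - w.l2 with hd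
    have hdpos : 0 < d := by
      rw [hd, sub_pos, lt_div_iff₀ (by linarith)]; rw [lt_div_iff₀ hl2] at hy1M; linarith
    set b := w.p / x1 - w.l1 with hb
    have hbpos : 0 < b := by
      rw [hb, sub_pos, lt_div_iff₀ (by linarith)]; rw [lt_div_iff₀ hl1] at hx1p; linarith
    -- Critical case ys = 1: along x = 1 the kernel is nonnegative, so the test point is (1 + εt, 1
    -- + t). The horizontal drift contributes -εbt at first order, the vertical one only l2·t² at
    -- second order; hence K < 0 for small t. The choice of ε makes l1·ε = d/2 < d, whence K2 < 0.
    -- The sign of K1 is not needed, as P1 is known to converge at x1.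
    set ε := d / (2 * w.l1) with hε
    have hεpos : 0 < ε := by positivity
    obtain ⟨t, ht0, ht1, ht2, ht3⟩ : ∃ t, 0 < t ∧ t < y1 - 1 ∧ ε * t < x1 - 1 ∧ w.l2 * t < ε * b := by
      set m := min (y1 - 1) (min ((x1 - 1) / ε) (ε * b / w.l2)) with hm
      have hmpos : 0 < m := lt_min (by linarith) (lt_min (div_pos (by linarith) hεpos)
        (by positivity))
      have a1 : m ≤ y1 - 1 := min_le_left _ _
      have a2 : m ≤ (x1 - 1) / ε := (min_le_right _ _).trans (min_le_left _ _)
      have a3 : m ≤ ε * b / w.l2 := (min_le_right _ _).trans (min_le_right _ _)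
      rw [le_div_iff₀ hεpos] at a2
      rw [le_div_iff₀ hl2] at a3
      exact ⟨m / 2, by linarith, by linarith, by nlinarith, by nlinarith⟩
    have hεt : 0 < ε * t := mul_pos hεpos ht0
    refine ⟨1 + t, by linarith, w.summable_axis2 (w.summable_moment (x := 1 + ε * t) (by linarith)
      (by linarith) ?_ (Or.inr (w.summable_axis1_mono (by linarith) (by linarith) hP1)) (Or.inl ?_))⟩
    · rw [w.K_eq _ _ (by linarith) (by linarith), h]
      have e1 : b ≤ w.p / (1 + ε * t) - w.l1 := by
        rw [hb]; gcongr; linarith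
      have e2 : (1 + t - 1) * (w.l2 - w.l2 / (1 + t)) ≤ w.l2 * t ^ 2 := by
        have : (1 + t - 1) * (w.l2 - w.l2 / (1 + t)) = w.l2 * t ^ 2 / (1 + t) := by
          field_simp; ring
        rw [this]
        exact div_le_self (by positivity) (by linarith)
      have e3 := mul_le_mul_of_nonneg_left e1 hεt.le
      have e4 := mul_lt_mul_of_pos_right ht3 ht0
      nlinarith
    · rw [w.K2_eq _ _ (by linarith)]
      have e1 : d ≤ w.M2 / (1 + t) - w.l2 := by
        rw [hd]; have := w.M2_pos; gcongr; linarith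
      have e2 : w.l1 * ε = d / 2 := by rw [hε]; field_simp
      have e3 := mul_le_mul_of_nonneg_left e1 ht0.le
      nlinarith
  · have h1 : 1 < w.ys := by
      by_contra hn
      push Not at hn
      have : w.ys ^ 2 ≤ 1 := by nlinarith
      nlinarith
    have hyq : w.ys < w.q / w.l2 := by
      rw [lt_div_iff₀ hl2]; nlinarith
    -- On x = 1 the kernel is negative for 1 < y < q/l2, and here 1 < ys < q/l2, so there is room
    -- beyond ys.
    refine ⟨(w.ys + w.q / w.l2) / 2, by linarith, ?_⟩
    set R := (w.ys + w.q / w.l2) / 2 with hR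
    have hR1 : 1 < R := by rw [hR]; linarith
    have hRq : R < w.q / w.l2 := by rw [hR]; linarith
    rw [lt_div_iff₀ hl2] at hRq
    have e1 : w.l2 < w.q / R := by rw [lt_div_iff₀ (by linarith)]; linarith
    have e2 : w.l2 < w.M2 / R := by rw [lt_div_iff₀ (by linarith)]; linarith
    refine w.summable_axis2 (w.summable_moment (x := 1) one_pos (by linarith) ?_
      (Or.inr (by simpa using w.summable_axis1_one)) (Or.inl ?_))
    · rw [w.K_eq _ _ one_ne_zero (by linarith)]; nlinarith
    · rw [w.K2_eq _ _ (by linarith)]; nlinarith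

end QuarterWalk

namespace QuarterWalk

variable (w : QuarterWalk)

/-! #### The real kernel -/

/-- The sum of the two branch points `xr2` and `xr3`, multiplied by `l1`. -/
def tt : ℝ := w.l1 + w.l2 + w.p + w.q - 2 * w.l2 * w.ys

theorem tt_eq : w.tt = w.l1 + w.p + w.l2 * (1 - w.ys) ^ 2 := by
  rw [tt, ← w.l2_mul_ys_sq]; ring

theorem le_tt : w.l1 + w.p ≤ w.tt := by
  rw [tt_eq]; have := w.l2_pos; nlinarith [sq_nonneg (1 - w.ys)]

theorem disc_nonneg : 0 ≤ w.tt ^ 2 - 4 * w.l1 * w.p := by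
  have := w.le_tt; have := w.l1_pos; have := w.p_pos
  nlinarith [sq_nonneg (w.l1 - w.p)]

/-- The smaller branch point. -/
def xr2 : ℝ := (w.tt - √(w.tt ^ 2 - 4 * w.l1 * w.p)) / (2 * w.l1)

/-- The larger branch point. -/
def xr3 : ℝ := (w.tt + √(w.tt ^ 2 - 4 * w.l1 * w.p)) / (2 * w.l1)

theorem l1_mul_xr_add : w.l1 * (w.xr2 + w.xr3) = w.tt := by
  have := w.l1_pos.ne'
  rw [xr2, xr3]; field_simp; ring

theorem l1_mul_xr_mul : w.l1 * (w.xr2 * w.xr3) = w.p := by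
  have := w.l1_pos.ne'
  have h := Real.sq_sqrt w.disc_nonneg
  rw [xr2, xr3]
  generalize √(w.tt ^ 2 - 4 * w.l1 * w.p) = r at h
  field_simp
  linear_combination -h

theorem xr3_pos : 0 < w.xr3 := by
  have h1 := w.le_tt; have h2 := w.l1_pos; have h3 := w.p_pos
  exact div_pos (by have := Real.sqrt_nonneg (w.tt ^ 2 - 4 * w.l1 * w.p); linarith) (by linarith)

theorem xr2_pos : 0 < w.xr2 := by
  have h1 := w.l1_mul_xr_mul
  have h2 := w.p_pos
  have h3 := mul_pos w.l1_pos w.xr3_pos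
  by_contra hn
  nlinarith

theorem xr2_le_xr3 : w.xr2 ≤ w.xr3 := by
  have h2 := w.l1_pos
  rw [xr2, xr3]
  gcongr
  linarith [Real.sqrt_nonneg (w.tt ^ 2 - 4 * w.l1 * w.p)]

/-- The quadratic l1·x² - tt·x + p is nonpositive at 1 by `le_tt`, so 1 lies between its zeros. -/
theorem xr2_le_one : w.xr2 ≤ 1 := by
  have h1 := w.l1_mul_xr_mul
  have h2 := w.l1_mul_xr_add
  have h3 := w.le_tt
  have h4 := w.l1_pos
  have h5 := w.xr2_le_xr3
  by_contra hn
  push Not at hn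
  have : 0 < (w.xr2 - 1) * (w.xr3 - 1) := mul_pos (by linarith) (by linarith)
  nlinarith

/-- The product of the two branch points is p/l1 and the smaller one is at most 1. Thus the annulus
1 < |X| < p/l1, where the functional equation is available from the start, lies inside |X| < `xr3`.
-/
theorem ratio_le_xr3 : w.p / w.l1 ≤ w.xr3 := by
  have h1 := w.l1_mul_xr_mul
  have h4 := w.l1_pos
  rw [div_le_iff₀ h4]
  nlinarith [w.xr2_le_one, mul_pos h4 w.xr3_pos]

theorem one_lt_xr3 (hlp : w.l1 < w.p) : 1 < w.xr3 :=
  lt_of_lt_of_le (by rw [lt_div_iff₀ w.l1_pos]; linarith) w.ratio_le_xr3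

theorem xr2_lt_xr3 (hlp : w.l1 < w.p) : w.xr2 < w.xr3 :=
  w.xr2_le_one.trans_lt (w.one_lt_xr3 hlp)

theorem l2ys_pos : 0 < 2 * w.l2 * w.ys := mul_pos (mul_pos two_pos w.l2_pos) w.ys_pos

/-- The half sum of the two roots of the kernel, divided by their geometric mean `ys`. -/
def wv (x : ℝ) : ℝ := (w.l1 + w.l2 + w.p + w.q - w.l1 * x - w.p / x) / (2 * w.l2 * w.ys)

/-- Up to the factor l2/y the kernel is y² - 2·ys·wv·y + ys²; the two roots meet at ys when wv = 1.
This factorization identifies `xr2` and `xr3` as the points where they do. -/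
theorem wv_sub_one {x : ℝ} (hx : x ≠ 0) :
    w.wv x - 1 = w.l1 * (x - w.xr2) * (w.xr3 - x) / (2 * w.l2 * w.ys * x) := by
  have h1 := w.l1_mul_xr_mul
  have h2 := w.l1_mul_xr_add
  have h3 := w.l2_pos.ne'
  have h4 := w.ys_pos.ne'
  rw [tt] at h2
  rw [wv]
  field_simp
  linear_combination h1 - x * h2

theorem K_eq_wv (x : ℝ) {y : ℝ} (hy : y ≠ 0) :
    w.K x y = w.l2 / y * (y ^ 2 - 2 * w.ys * w.wv x * y + w.ys ^ 2) := by
  have h3 := w.l2_pos.ne'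
  have h4 := w.ys_pos.ne'
  have h5 := w.l2_mul_ys_sq
  simp only [K, smul_eq_mul, wv]
  rw [← h5]
  field_simp
  ring

theorem one_le_wv {x : ℝ} (h2 : w.xr2 ≤ x) (h3 : x ≤ w.xr3) : 1 ≤ w.wv x := by
  have hx : 0 < x := w.xr2_pos.trans_le h2
  have := w.wv_sub_one hx.ne'
  have : 0 ≤ w.wv x - 1 := by
    rw [this]
    have := w.l1_pos; have := w.l2ys_pos
    exact div_nonneg (mul_nonneg (mul_nonneg (by linarith) (by linarith)) (by linarith))
      (by positivity)
  linarith

theorem one_lt_wv {x : ℝ} (h2 : w.xr2 < x) (h3 : x < w.xr3) : 1 < w.wv x := by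
  have hx : 0 < x := w.xr2_pos.trans h2
  have := w.wv_sub_one hx.ne'
  have : 0 < w.wv x - 1 := by
    rw [this]
    have := w.l1_pos; have := w.l2ys_pos
    exact div_pos (mul_pos (mul_pos (by linarith) (by linarith)) (by linarith)) (by positivity)
  linarith

theorem wv_xr3 : w.wv w.xr3 = 1 := by
  have := w.wv_sub_one w.xr3_pos.ne'
  rw [sub_self, mul_zero, zero_div] at this
  linarith

/-- The smaller root of the kernel. -/
def y0 (x : ℝ) : ℝ := w.ys * (w.wv x - √(w.wv x ^ 2 - 1))

/-- The larger root of the kernel. -/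
def y1 (x : ℝ) : ℝ := w.ys * (w.wv x + √(w.wv x ^ 2 - 1))

theorem y0_add_y1 (x : ℝ) : w.y0 x + w.y1 x = 2 * w.ys * w.wv x := by rw [y0, y1]; ring

theorem y0_mul_y1 {x : ℝ} (h2 : w.xr2 ≤ x) (h3 : x ≤ w.xr3) : w.y0 x * w.y1 x = w.ys ^ 2 := by
  have h := w.one_le_wv h2 h3
  have := Real.sq_sqrt (show 0 ≤ w.wv x ^ 2 - 1 by nlinarith)
  rw [y0, y1]
  linear_combination -w.ys ^ 2 * this

theorem ys_le_y1 {x : ℝ} (h2 : w.xr2 ≤ x) (h3 : x ≤ w.xr3) : w.ys ≤ w.y1 x := by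
  have h := w.one_le_wv h2 h3
  have := Real.sqrt_nonneg (w.wv x ^ 2 - 1)
  rw [y1]
  nlinarith [w.ys_pos]

theorem y1_pos {x : ℝ} (h2 : w.xr2 ≤ x) (h3 : x ≤ w.xr3) : 0 < w.y1 x :=
  w.ys_pos.trans_le (w.ys_le_y1 h2 h3)

theorem y0_pos {x : ℝ} (h2 : w.xr2 ≤ x) (h3 : x ≤ w.xr3) : 0 < w.y0 x := by
  have h := w.y0_mul_y1 h2 h3
  have h1 := w.y1_pos h2 h3
  have := pow_pos w.ys_pos 2
  by_contra hn
  nlinarith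

theorem y0_le_ys {x : ℝ} (h2 : w.xr2 ≤ x) (h3 : x ≤ w.xr3) : w.y0 x ≤ w.ys := by
  have h := w.y0_mul_y1 h2 h3
  have h1 := w.ys_le_y1 h2 h3
  have h0 := w.y0_pos h2 h3
  by_contra hn
  push Not at hn
  nlinarith [w.ys_pos]

theorem y0_lt_ys {x : ℝ} (h2 : w.xr2 < x) (h3 : x < w.xr3) : w.y0 x < w.ys := by
  have h := w.one_lt_wv h2 h3
  have e1 := w.y0_add_y1 x
  have e2 := w.y0_mul_y1 h2.le h3.le
  refine lt_of_le_of_ne (w.y0_le_ys h2.le h3.le) fun he => ?_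
  rw [he] at e1 e2
  have : w.y1 x = w.ys := by
    have := w.ys_pos.ne'
    apply mul_left_cancel₀ this; rw [e2]; ring
  rw [this] at e1
  nlinarith [w.ys_pos]

theorem ys_lt_y1 {x : ℝ} (h2 : w.xr2 < x) (h3 : x < w.xr3) : w.ys < w.y1 x := by
  have h := w.y0_lt_ys h2 h3
  have e2 := w.y0_mul_y1 h2.le h3.le
  have := w.y0_pos h2.le h3.le
  by_contra hn
  push Not at hn
  nlinarith [w.ys_pos]

theorem y0_xr3 : w.y0 w.xr3 = w.ys := by rw [y0, wv_xr3]; simp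

theorem y1_xr3 : w.y1 w.xr3 = w.ys := by rw [y1, wv_xr3]; simp

theorem K_eq_roots {x y : ℝ} (h2 : w.xr2 ≤ x) (h3 : x ≤ w.xr3) (hy : y ≠ 0) :
    w.K x y = w.l2 / y * ((y - w.y0 x) * (y - w.y1 x)) := by
  rw [w.K_eq_wv x hy]
  congr 1
  linear_combination y * w.y0_add_y1 x - w.y0_mul_y1 h2 h3

theorem K_y0 {x : ℝ} (h2 : w.xr2 ≤ x) (h3 : x ≤ w.xr3) : w.K x (w.y0 x) = 0 := by
  rw [w.K_eq_roots h2 h3 (w.y0_pos h2 h3).ne']; simp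

theorem K_ys_neg {x : ℝ} (h2 : w.xr2 < x) (h3 : x < w.xr3) : w.K x w.ys < 0 := by
  rw [w.K_eq_roots h2.le h3.le w.ys_pos.ne']
  have h4 := w.y0_lt_ys h2 h3
  have h5 := w.ys_lt_y1 h2 h3
  exact mul_neg_of_pos_of_neg (div_pos w.l2_pos w.ys_pos)
    (mul_neg_of_pos_of_neg (by linarith) (by linarith))

theorem K_xr3 {y : ℝ} (hy : y ≠ 0) : w.K w.xr3 y = w.l2 / y * (w.ys - y) ^ 2 := by
  rw [w.K_eq_wv _ hy, wv_xr3]; ring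

/-- The kernel is negative strictly between its roots, and y ≤ ys ≤ `y1`; a nonnegative kernel then
leaves only the range below `y0`, the double root included. This converts a triangle inequality into
a bound on the complex branch. -/
theorem le_y0_of_K_nonneg {x y : ℝ} (h2 : w.xr2 ≤ x) (h3 : x ≤ w.xr3) (hy : 0 < y) (hys : y ≤ w.ys)
    (hK : 0 ≤ w.K x y) : y ≤ w.y0 x := by
  rw [w.K_eq_roots h2 h3 hy.ne'] at hK
  have h4 := w.ys_le_y1 h2 h3
  have h5 := nonneg_of_mul_nonneg_right hK (div_pos w.l2_pos hy)
  by_contra hn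
  push Not at hn
  have h6 : w.y1 x = w.ys := by
    by_contra hne
    have := lt_of_le_of_ne h4 (Ne.symm hne)
    nlinarith
  have h7 := w.y0_mul_y1 h2 h3
  rw [h6] at h7
  have h8 : w.y0 x = w.ys := by
    apply mul_right_cancel₀ w.ys_pos.ne'; rw [h7]; ring
  linarith

/-- If the kernel is negative somewhere on the positive half line above `x ≥ 1`, then `x` lies to the
left of the branch point. -/
theorem lt_xr3_of_K_neg {x y : ℝ} (hx : 1 < x) (hy : 0 < y)
    (hK : w.K x y < 0) : x < w.xr3 := by
  by_contra hn
  push Not at hn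
  have hwv : w.wv x ≤ 1 := by
    have := w.wv_sub_one (show x ≠ 0 by linarith)
    have h1 := w.l1_pos; have h2 := w.l2ys_pos
    have : w.wv x - 1 ≤ 0 := by
      rw [this]
      exact div_nonpos_of_nonpos_of_nonneg (mul_nonpos_of_nonneg_of_nonpos
        (mul_nonneg h1.le (by linarith [w.xr2_le_one])) (by linarith)) (by positivity)
    linarith
  rw [w.K_eq_wv x hy.ne'] at hK
  have h1 := div_pos w.l2_pos hy
  have h2 := mul_pos w.ys_pos hy
  have : 0 ≤ y ^ 2 - 2 * w.ys * w.wv x * y + w.ys ^ 2 := by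
    nlinarith [sq_nonneg (y - w.ys)]
  nlinarith

theorem y0_lt_of_K_neg {x y : ℝ} (h2 : w.xr2 ≤ x) (h3 : x ≤ w.xr3) (hy : 0 < y)
    (hK : w.K x y < 0) : w.y0 x < y := by
  rw [w.K_eq_roots h2 h3 hy.ne'] at hK
  have h4 := div_pos w.l2_pos hy
  have h5 := (w.y0_le_ys h2 h3).trans (w.ys_le_y1 h2 h3)
  by_contra hn
  push Not at hn
  have := mul_nonneg_of_nonpos_of_nonpos (show y - w.y0 x ≤ 0 by linarith)
    (show y - w.y1 x ≤ 0 by linarith)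
  nlinarith

theorem continuousAt_y0 {x : ℝ} (hx : x ≠ 0) : ContinuousAt w.y0 x := by
  have : ContinuousAt w.wv x := by
    unfold wv
    fun_prop (disch := assumption)
  unfold y0
  fun_prop

/-! #### The zeros of `K1` on the kernel curve -/

/-- The zero of `y ↦ K1 x y`. -/
def eta (x : ℝ) : ℝ := 1 + (x - 1) * (w.M1 / x - w.l1) / w.l2

theorem K1_eq_eta {x : ℝ} (y : ℝ) (hx : x ≠ 0) : w.K1 x y = w.l2 * (y - w.eta x) := by
  have h3 := w.l2_pos.ne'
  simp only [K1, eta, smul_eq_mul]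
  field_simp
  ring

theorem one_lt_eta {x : ℝ} (hx : 1 < x) (hM : w.l1 * x < w.M1) : 1 < w.eta x := by
  have h3 := w.l2_pos
  have : w.l1 < w.M1 / x := by rw [lt_div_iff₀ (by linarith)]; exact hM
  have : 0 < (x - 1) * (w.M1 / x - w.l1) / w.l2 :=
    div_pos (mul_pos (by linarith) (by linarith)) h3
  rw [eta]; linarith

/-- The resultant of the kernel and `K1`, without the factor `x - 1`. -/
def res (x : ℝ) : ℝ :=
  (w.M1 - w.p) * (w.l2 * x + (x - 1) * (w.M1 - w.l1 * x)) - w.q * x * (w.M1 - w.l1 * x)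

/-- Elimination of y between K and K1. The factor x - 1 is their trivial common zero (1, 1); every
other common zero with x ≠ 0 has its x among the zeros of the quadratic `res`. -/
theorem K_eta {x : ℝ} (hx : x ≠ 0) (he : w.eta x ≠ 0) :
    w.K x (w.eta x) = (x - 1) * w.res x / (x ^ 2 * w.l2 * w.eta x) := by
  have h3 := w.l2_pos.ne'
  have e : w.l2 * x * w.eta x = w.l2 * x + (x - 1) * (w.M1 - w.l1 * x) := by
    rw [eta]; field_simp
  rw [w.K_eq x _ hx he, res, ← e, eq_div_iff (by positivity)]
  have e2 : w.eta x - 1 = (x - 1) * (w.M1 - w.l1 * x) / (w.l2 * x) := by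
    rw [eta]; field_simp; ring
  rw [e2]
  field_simp
  ring

end QuarterWalk

/-! ### Position of the zero of `K1` relative to the branch point -/

namespace QuarterWalk

variable {w : QuarterWalk}

/-- The standing assumptions on the walk: drift to the left in the interior, and the shape of the
resultant of the kernel and `K1`. -/
structure Regular (w : QuarterWalk) (C xp xm : ℝ) : Prop where
  l1_lt : w.l1 < w.p
  C_pos : 0 < C
  xm_neg : xm < 0
  one_lt : 1 < xp
  lt_M1 : w.l1 * xp < w.M1
  res_eq : ∀ x, w.res x = C * ((x - xp) * (x - xm))
  mixed : w.M2 * (w.M1 - w.p) < w.q * w.M1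

namespace Regular

variable {C xp xm : ℝ} (h : w.Regular C xp xm)

theorem one_lt_eta (h : w.Regular C xp xm) {x : ℝ} (h1 : 1 < x) (hx : x ≤ xp) : 1 < w.eta x :=
  w.one_lt_eta h1 ((mul_le_mul_of_nonneg_left hx w.l1_pos.le).trans_lt h.lt_M1)

theorem K_eta_neg (h : w.Regular C xp xm) {x : ℝ} (h1 : 1 < x) (hx : x < xp) :
    w.K x (w.eta x) < 0 := by
  have he := h.one_lt_eta h1 hx.le
  rw [w.K_eta (by linarith) (by linarith), h.res_eq]
  have := w.l2_pos
  refine div_neg_of_neg_of_pos (mul_neg_of_pos_of_neg (by linarith)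
    (mul_neg_of_pos_of_neg h.C_pos (mul_neg_of_neg_of_pos (by linarith) (by linarith [h.xm_neg]))))
    (by positivity)

/-- K is negative at (x, eta x), whereas at and beyond the branch point the kernel is nonnegative
for all y > 0. -/
theorem lt_xr3 (h : w.Regular C xp xm) {x : ℝ} (h1 : 1 < x) (hx : x < xp) : x < w.xr3 :=
  w.lt_xr3_of_K_neg h1 (by linarith [h.one_lt_eta h1 hx.le]) (h.K_eta_neg h1 hx)

theorem le_xr3 (h : w.Regular C xp xm) : xp ≤ w.xr3 :=
  le_of_forall_lt_imp_le_of_dense fun x hx => by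
    rcases le_or_gt x 1 with h1 | h1
    · exact h1.trans (w.one_lt_xr3 h.l1_lt).le
    · exact (h.lt_xr3 h1 hx).le

/-- K(x, eta x) < 0 puts `eta x` strictly between the two roots of the kernel, so `y0 x` < `eta x`.
-/
theorem K1_y0_neg (h : w.Regular C xp xm) {x : ℝ} (h1 : 1 < x) (hx : x < xp) :
    w.K1 x (w.y0 x) < 0 := by
  have := w.y0_lt_of_K_neg (by linarith [w.xr2_le_one]) (h.lt_xr3 h1 hx).le
    (by linarith [h.one_lt_eta h1 hx.le]) (h.K_eta_neg h1 hx)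
  rw [w.K1_eq_eta _ (by linarith)]
  exact mul_neg_of_pos_of_neg w.l2_pos (by linarith)

theorem K_eta_xp (h : w.Regular C xp xm) : w.K xp (w.eta xp) = 0 := by
  have he := h.one_lt_eta h.one_lt le_rfl
  rw [w.K_eta (by linarith [h.one_lt]) (by linarith), h.res_eq]
  simp

theorem xr2_le_xp (h : w.Regular C xp xm) : w.xr2 ≤ xp := w.xr2_le_one.trans h.one_lt.le

theorem eta_xp_eq (h : w.Regular C xp xm) : w.eta xp = w.y0 xp ∨ w.eta xp = w.y1 xp := by
  have he := h.one_lt_eta h.one_lt le_rfl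
  have hK := h.K_eta_xp
  rw [w.K_eq_roots h.xr2_le_xp h.le_xr3 (by linarith)] at hK
  have : w.l2 / w.eta xp ≠ 0 := (div_pos w.l2_pos (by linarith)).ne'
  rcases mul_eq_zero.1 ((mul_eq_zero.1 hK).resolve_left this) with h | h
  · left; linarith
  · right; linarith

theorem eta_eq_y0 (h : w.Regular C xp xm) (hys : w.eta xp ≤ w.ys) : w.eta xp = w.y0 xp := by
  rcases h.eta_xp_eq with e | e
  · exact e
  · have h1 := w.ys_le_y1 h.xr2_le_xp h.le_xr3
    have h2 := w.y0_mul_y1 h.xr2_le_xp h.le_xr3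
    have h3 : w.y1 xp = w.ys := by linarith
    rw [e, h3]
    rw [h3] at h2
    apply mul_right_cancel₀ w.ys_pos.ne'
    rw [h2]; ring

/-- When `eta xp` exceeds ys, the common zero at xp lies on the upper branch. On the lower branch a
sign change at or after xp would, by the intermediate value theorem, produce a zero of `res` beyond
xp, but its only zeros are xp and xm. -/
theorem K1_y0_neg' (h : w.Regular C xp xm) (hys : w.ys < w.eta xp)
    {x : ℝ} (h1 : 1 < x) (hx : x ≤ w.xr3) : w.K1 x (w.y0 x) < 0 := by
  rcases lt_or_ge x xp with hlt | hge
  · exact h.K1_y0_neg h1 hlt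
  have h0 : w.K1 xp (w.y0 xp) < 0 := by
    rw [w.K1_eq_eta _ (by linarith [h.one_lt])]
    exact mul_neg_of_pos_of_neg w.l2_pos (by linarith [w.y0_le_ys h.xr2_le_xp h.le_xr3])
  by_contra hn
  push Not at hn
  have hcont : ContinuousOn (fun x => w.K1 x (w.y0 x)) (Set.Icc xp x) := fun z hz => by
    have hz0 : z ≠ 0 := by linarith [h.one_lt, hz.1]
    have := w.continuousAt_y0 hz0
    simp only [K1]
    exact ContinuousAt.continuousWithinAt (by fun_prop (disch := assumption))
  obtain ⟨z, hz, hz0⟩ := intermediate_value_Icc hge hcont ⟨h0.le, hn⟩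
  simp only at hz0
  have hz1 : 1 < z := h.one_lt.trans_le hz.1
  have hx2 : w.xr2 ≤ z := w.xr2_le_one.trans hz1.le
  have hz3 : z ≤ w.xr3 := hz.2.trans hx
  have hpos := w.y0_pos hx2 hz3
  have he : w.y0 z = w.eta z := by
    rw [w.K1_eq_eta _ (by linarith)] at hz0
    have := (mul_eq_zero.1 hz0).resolve_left w.l2_pos.ne'
    linarith
  have hK := w.K_y0 hx2 hz3
  rw [he] at hpos
  rw [he, w.K_eta (by linarith) hpos.ne', h.res_eq] at hK
  have hzxp : xp < z := lt_of_le_of_ne hz.1 fun e => by rw [← e] at hz0; linarith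
  have := w.l2_pos
  have : 0 < (z - 1) * (C * ((z - xp) * (z - xm))) / (z ^ 2 * w.l2 * w.eta z) :=
    div_pos (mul_pos (by linarith) (mul_pos h.C_pos (mul_pos (by linarith)
      (by linarith [h.xm_neg])))) (by positivity)
  linarith

/-- Positivity of the vertical boundary term where both the kernel and `K1` vanish. -/
theorem N_pos (h : w.Regular C xp xm) : 0 < w.N xp (w.eta xp) := by
  have he := h.one_lt_eta h.one_lt le_rfl
  have hx := h.one_lt
  have hx1 : 0 < 1 - xp⁻¹ := by rw [sub_pos]; exact inv_lt_one_of_one_lt₀ hx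
  have e1 := h.K_eta_xp
  have e2 : w.K1 xp (w.eta xp) = 0 := by rw [w.K1_eq_eta _ (by linarith)]; simp
  have hq := w.q_pos
  simp only [K, K1, smul_eq_mul] at e1 e2
  have k0 : w.K0 xp (w.eta xp) = w.M1 * (1 - xp⁻¹) := by
    simp only [K0, smul_eq_mul]; linarith
  -- K = K1 = 0 eliminates all terms in Y; what remains has the sign of q·M1 - M2·(M1 - p), positive
  -- by the field `mixed`.
  have k2 : w.K2 xp (w.eta xp) * w.q = (1 - xp⁻¹) * (w.q * w.M1 - w.M2 * (w.M1 - w.p)) := by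
    simp only [K2, smul_eq_mul]
    linear_combination w.M2 * e1 + (w.q - w.M2) * e2
  have k2' : 0 < w.K2 xp (w.eta xp) := by
    have : 0 < w.K2 xp (w.eta xp) * w.q := by
      rw [k2]; exact mul_pos hx1 (by linarith [h.mixed])
    exact (pos_iff_pos_of_mul_pos this).2 hq
  have hP : 0 ≤ w.P2 (w.eta xp) := tsum_nonneg fun n =>
    mul_nonneg (w.u_nonneg _ _) (pow_nonneg (by linarith) _)
  rw [N, k0, smul_eq_mul]
  exact add_pos_of_nonneg_of_pos (mul_nonneg k2'.le hP)
    (mul_pos (w.u_pos 0 0) (mul_pos w.M1_pos hx1))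

end Regular
end QuarterWalk

namespace QuarterWalk

variable (w : QuarterWalk)

/-! #### Growth of the rows at the branch point -/

/-- In the balance equation at (m+1, k), the inflow from above, q·u(m+1, k+1), is at most the total
outflow; so each row is dominated by a constant times the row below it. -/
theorem summable_row {x : ℝ} (hx : 0 < x) (hP : Summable fun m => w.u (m + 1) 0 * x ^ (m + 1))
    (k : ℕ) : Summable fun m => w.u (m + 1) k * x ^ (m + 1) := by
  induction k with
  | zero => exact hP
  | succ k ih =>
    refine Summable.of_nonneg_of_le (fun m => mul_nonneg (w.u_nonneg _ _) (by positivity))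
      (fun m => ?_) (ih.mul_left ((w.l1 + w.l2 + w.M1 + w.M2) / w.q))
    have hb := w.balance (m + 1) k
    have h1 := w.left_le (m + 1) k
    have h2 := w.down_le (m + 1) k
    simp only [left, down] at h1 h2
    have h3 : 0 ≤ (if k = 0 then w.M1 else w.p) * w.u (m + 1 + 1) k := by
      refine mul_nonneg ?_ (w.u_nonneg _ _)
      split_ifs; exacts [w.M1_pos.le, w.p_pos.le]
    have h4 : 0 ≤ if k = 0 then 0 else w.l2 * w.u (m + 1) (k - 1) := by
      split_ifs; exacts [le_rfl, mul_nonneg w.l2_pos.le (w.u_nonneg _ _)]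
    simp only [Nat.add_eq_zero_iff, one_ne_zero, and_false, if_false, Nat.add_sub_cancel] at hb h1 h2
    have h5 := mul_nonneg w.l1_pos.le (w.u_nonneg m k)
    have h6 := w.u_nonneg (m + 1) k
    have hq := w.q_pos
    have : w.u (m + 1) (k + 1) ≤ (w.l1 + w.l2 + w.M1 + w.M2) / w.q * w.u (m + 1) k := by
      rw [div_mul_eq_mul_div, le_div_iff₀ hq]
      nlinarith
    calc _ ≤ (w.l1 + w.l2 + w.M1 + w.M2) / w.q * w.u (m + 1) k * x ^ (m + 1) := by gcongr
      _ = _ := by ring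

/-- The function of the horizontal coordinate that vanishes on the vertical axis. -/
def rowV (m : ℕ) : ℝ := w.xr3 ^ m - w.xr2 ^ m

theorem rowV_nonneg (m : ℕ) : 0 ≤ w.rowV m :=
  sub_nonneg.2 (pow_le_pow_left₀ w.xr2_pos.le w.xr2_le_xr3 _)

theorem rowV_le (m : ℕ) : w.rowV m ≤ w.xr3 ^ m := sub_le_self _ (pow_pos w.xr2_pos _).le

/-- Both geometric sequences satisfy it, since `xr2` and `xr3` are the roots of l1·x² - tt·x + p. -/
theorem rowV_rec (m : ℕ) : w.l1 * w.rowV (m + 2) + w.p * w.rowV m = w.tt * w.rowV (m + 1) := by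
  rw [← w.l1_mul_xr_add, ← w.l1_mul_xr_mul, rowV, rowV, rowV]; ring

theorem summable_row_mul (hP : Summable fun m => w.u (m + 1) 0 * w.xr3 ^ (m + 1)) (k j : ℕ) :
    Summable fun m => w.u (m + 1) k * w.rowV (m + j) := by
  have h3 := w.xr3_pos
  refine Summable.of_nonneg_of_le (fun m => mul_nonneg (w.u_nonneg _ _) (w.rowV_nonneg _))
    (fun m => ?_) ((w.summable_row h3 hP k).mul_left (w.xr3 ^ j / w.xr3))
  calc _ ≤ w.u (m + 1) k * w.xr3 ^ (m + j) :=
        mul_le_mul_of_nonneg_left (w.rowV_le _) (w.u_nonneg _ _)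
    _ = _ := by rw [pow_add, pow_succ]; field_simp

/-- Mass of row k in the weight `rowV`; the state m = 0 is omitted at no loss, as the weight
vanishes there. -/
def rowA (k : ℕ) : ℝ := ∑' m, w.u (m + 1) k * w.rowV (m + 1)

theorem rowA_nonneg (k : ℕ) : 0 ≤ w.rowA k :=
  tsum_nonneg fun _ => mul_nonneg (w.u_nonneg _ _) (w.rowV_nonneg _)

/-- Row k+1 of the balance equations is summed against `rowV`. The recurrence of `rowV` absorbs the
horizontal jumps and leaves 2·l2·ys. The shift to the left has no boundary term because `rowV 0 =
0`, and the inflow from the vertical axis is nonnegative and dropped, hence an inequality. -/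
theorem rowA_rec (hP : Summable fun m => w.u (m + 1) 0 * w.xr3 ^ (m + 1)) (k : ℕ) :
    w.q * w.rowA (k + 2) + w.l2 * w.rowA k ≤ 2 * w.l2 * w.ys * w.rowA (k + 1) := by
  have s0 := w.summable_row_mul hP (k + 1) 0
  have s1 := w.summable_row_mul hP (k + 1) 1
  have s2 := w.summable_row_mul hP (k + 1) 2
  have a1 := w.summable_row_mul hP (k + 2) 1
  have a0 := w.summable_row_mul hP k 1
  have e0 : HasSum (fun m => w.u (m + 2) (k + 1) * w.rowV (m + 1))
      (∑' m, w.u (m + 1) (k + 1) * w.rowV (m + 0)) := by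
    have := (hasSum_nat_add_iff' (f := fun m => w.u (m + 1) (k + 1) * w.rowV (m + 0)) 1).2 s0.hasSum
    simpa [rowV] using this
  have e2 : HasSum (fun m => w.u m (k + 1) * w.rowV (m + 1))
      (∑' m, w.u (m + 1) (k + 1) * w.rowV (m + 2) + w.u 0 (k + 1) * w.rowV 1) := by
    have := (hasSum_nat_add_iff (f := fun m => w.u m (k + 1) * w.rowV (m + 1)) 1
      (g := ∑' m, w.u (m + 1) (k + 1) * w.rowV (m + 2))).1 s2.hasSum
    simpa using this
  have hsum := (((e0.mul_left w.p).add (a1.hasSum.mul_left w.q)).add (e2.mul_left w.l1)).add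
    (a0.hasSum.mul_left w.l2)
  have hlhs := s1.hasSum.mul_left (w.l1 + w.l2 + w.p + w.q)
  have heq := hsum.unique (hlhs.congr_fun ?_)
  swap
  · intro m
    have := w.balance (m + 1) (k + 1)
    simp only [Nat.add_eq_zero_iff, one_ne_zero, and_false, if_false, Nat.add_sub_cancel] at this
    linear_combination (-w.rowV (m + 1)) * this
  have hrec : w.l1 * ∑' m, w.u (m + 1) (k + 1) * w.rowV (m + 2)
      + w.p * ∑' m, w.u (m + 1) (k + 1) * w.rowV (m + 0)
      = w.tt * ∑' m, w.u (m + 1) (k + 1) * w.rowV (m + 1) := by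
    refine (((s2.hasSum.mul_left w.l1).add (s0.hasSum.mul_left w.p)).unique
      ((s1.hasSum.mul_left w.tt).congr_fun fun m => ?_))
    linear_combination w.u (m + 1) (k + 1) * w.rowV_rec m
  have hpos : 0 ≤ w.l1 * (w.u 0 (k + 1) * w.rowV 1) :=
    mul_nonneg w.l1_pos.le (mul_nonneg (w.u_nonneg _ _) (w.rowV_nonneg _))
  rw [tt] at hrec
  simp only [rowA]
  linarith

/-- Since q = l2·ys², scaling by ys^k turns `rowA_rec` into concavity. A nonnegative concave
sequence is nondecreasing, so the mass of row 0 is a lower bound. -/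
theorem rowA_lower (hlp : w.l1 < w.p) (hP : Summable fun m => w.u (m + 1) 0 * w.xr3 ^ (m + 1)) :
    ∃ c, 0 < c ∧ ∀ k, c ≤ w.ys ^ k * w.rowA k := by
  have hys := w.ys_pos
  have hl2 := w.l2_pos
  have mono := monotone_of_concave_of_nonneg (f := fun k => w.ys ^ k * w.rowA k)
    (fun k => mul_nonneg (by positivity) (w.rowA_nonneg k)) fun k => by
      have := w.rowA_rec hP k
      rw [← w.l2_mul_ys_sq] at this
      have h2 := mul_le_mul_of_nonneg_left this (pow_pos hys k).le
      have h3 : w.l2 * (w.ys ^ (k + 2) * w.rowA (k + 2) + w.ys ^ k * w.rowA k)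
          ≤ w.l2 * (2 * (w.ys ^ (k + 1) * w.rowA (k + 1))) := by
        calc _ = _ := by ring
          _ ≤ _ := h2
          _ = _ := by ring
      exact le_of_mul_le_mul_left h3 hl2
  refine ⟨w.rowA 0, ?_, fun k => ?_⟩
  · refine (w.summable_row_mul hP 0 1).tsum_pos
      (fun m => mul_nonneg (w.u_nonneg _ _) (w.rowV_nonneg _)) 0 ?_
    have := w.xr2_lt_xr3 hlp
    exact mul_pos (w.u_pos _ _) (by simp only [rowV]; simpa using this)
  · simpa using mono (Nat.zero_le k)

/-! #### The functional equation at the branch point -/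

theorem P1_mono {x x' : ℝ} (hx : 0 ≤ x) (hxx : x ≤ x')
    (h : Summable fun m => w.u (m + 1) 0 * x' ^ (m + 1)) : w.P1 x ≤ w.P1 x' := by
  simp only [P1, smul_eq_mul]
  exact (w.summable_axis1_mono hx hxx h).tsum_le_tsum
    (fun m => mul_le_mul_of_nonneg_left (pow_le_pow_left₀ hx hxx _) (w.u_nonneg _ _)) h

theorem P1_nonneg {x : ℝ} (hx : 0 ≤ x) : 0 ≤ w.P1 x :=
  tsum_nonneg fun _ => mul_nonneg (w.u_nonneg _ _) (by positivity)

/-- On the segment before the branch point, all moments with second exponent at most `ys` exist as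
soon as `P1` converges. -/
theorem summable_moment_ys (hlp : w.l1 < w.p) {x : ℝ} (h2 : w.xr2 < x) (h3 : x < w.xr3)
    (hP : Summable fun m => w.u (m + 1) 0 * x ^ (m + 1)) :
    Summable fun s : ℕ × ℕ => w.u s.1 s.2 * (x ^ s.1 * w.ys ^ s.2) := by
  obtain ⟨R, hR, hs⟩ := w.exists_radius hlp
  exact w.summable_moment (w.xr2_pos.trans h2) w.ys_pos (w.K_ys_neg h2 h3) (Or.inr hP)
    (Or.inr (w.summable_axis2_mono w.ys_pos.le hR.le hs))

theorem functional_eq_real {x y : ℝ} (hx : 0 < x) (hy : 0 < y)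
    (hs : Summable fun s : ℕ × ℕ => w.u s.1 s.2 * (x ^ s.1 * y ^ s.2)) :
    w.K x y * w.Pin x y + w.K1 x y * w.P1 x + w.N x y = 0 :=
  w.functional_eq hx.ne' hy.ne' (by simpa [abs_of_pos hx, abs_of_pos hy] using hs)

theorem curve_eq (hlp : w.l1 < w.p) {x : ℝ} (h2 : w.xr2 < x) (h3 : x < w.xr3)
    (hP : Summable fun m => w.u (m + 1) 0 * x ^ (m + 1)) :
    w.K1 x (w.y0 x) * w.P1 x + w.N x (w.y0 x) = 0 := by
  have hx := w.xr2_pos.trans h2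
  have hy := w.y0_pos h2.le h3.le
  have := w.functional_eq_real hx hy (w.summable_moment_mono hx.le hy.le le_rfl
    (w.y0_le_ys h2.le h3.le) (w.summable_moment_ys hlp h2 h3 hP))
  rw [w.K_y0 h2.le h3.le] at this
  linarith

/-- At the branch point K is positive for y < ys, so the negative-drift criterion is unavailable.
Instead the functional equation at x < `xr3` bounds the finite partial sums of K·Pin, with the
monotone bound on P1 for the axis term; letting x increase to `xr3` and dividing by K > 0 gives
summability in the interior, and the axes are added back. -/
theorem summable_moment_xr3 (hlp : w.l1 < w.p)
    (hP : Summable fun m => w.u (m + 1) 0 * w.xr3 ^ (m + 1)) {y : ℝ} (hy : 0 < y) (hys : y < w.ys) :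
    Summable fun s : ℕ × ℕ => w.u s.1 s.2 * (w.xr3 ^ s.1 * y ^ s.2) := by
  have h3 := w.xr3_pos
  have hlim : ∀ F : Finset (ℕ × ℕ),
      w.K w.xr3 y * ∑ s ∈ F, w.u (s.1 + 1) (s.2 + 1) * (w.xr3 ^ (s.1 + 1) * y ^ (s.2 + 1))
        ≤ |w.K1 w.xr3 y| * w.P1 w.xr3 + |w.N w.xr3 y| := by
    intro F
    have c1 : ContinuousWithinAt (fun x => w.K x y *
        ∑ s ∈ F, w.u (s.1 + 1) (s.2 + 1) * (x ^ (s.1 + 1) * y ^ (s.2 + 1))) (Set.Iio w.xr3)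
        w.xr3 := by
      refine ContinuousAt.continuousWithinAt ?_
      simp only [K]
      fun_prop (disch := exact h3.ne')
    have c2 : ContinuousWithinAt (fun x => |w.K1 x y| * w.P1 w.xr3 + |w.N x y|) (Set.Iio w.xr3)
        w.xr3 := by
      refine ContinuousAt.continuousWithinAt ?_
      simp only [K1, N, K2, K0]
      fun_prop (disch := exact h3.ne')
    refine le_of_tendsto_of_tendsto c1 c2 ?_
    have e1 : ∀ᶠ x in 𝓝[<] w.xr3, w.xr2 < x :=
      eventually_nhdsWithin_of_eventually_nhds (lt_mem_nhds (w.xr2_lt_xr3 hlp))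
    have e2 : ∀ᶠ x in 𝓝[<] w.xr3, 0 < w.K x y := by
      have : ContinuousAt (fun x => w.K x y) w.xr3 := by
        simp only [K]; fun_prop (disch := exact h3.ne')
      refine eventually_nhdsWithin_of_eventually_nhds (this.eventually (lt_mem_nhds ?_))
      simp only [w.K_xr3 hy.ne']
      exact mul_pos (div_pos w.l2_pos hy) (pow_pos (by linarith) 2)
    filter_upwards [e1, e2, self_mem_nhdsWithin] with x hx2 hK hx3
    rw [Set.mem_Iio] at hx3
    have hx := w.xr2_pos.trans hx2
    have hPx := w.summable_axis1_mono hx.le hx3.le hP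
    have hs := w.summable_moment_mono hx.le hy.le le_rfl hys.le
      (w.summable_moment_ys hlp hx2 hx3 hPx)
    have hf := w.functional_eq_real hx hy hs
    have hin : Summable fun s : ℕ × ℕ => w.u (s.1 + 1) (s.2 + 1) * (x ^ (s.1 + 1) * y ^ (s.2 + 1)) :=
      hs.comp_injective (i := fun s : ℕ × ℕ => (s.1 + 1, s.2 + 1)) fun a b h => by
        ext <;> simp at h <;> omega
    have hF : ∑ s ∈ F, w.u (s.1 + 1) (s.2 + 1) * (x ^ (s.1 + 1) * y ^ (s.2 + 1)) ≤ w.Pin x y := by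
      simp only [Pin, smul_eq_mul]
      exact hin.sum_le_tsum F fun s _ => mul_nonneg (w.u_nonneg _ _) (by positivity)
    have h1 := mul_le_mul_of_nonneg_left hF hK.le
    have h4 : -(w.K1 x y * w.P1 x) ≤ |w.K1 x y| * w.P1 w.xr3 := by
      calc -(w.K1 x y * w.P1 x) = -w.K1 x y * w.P1 x := by ring
        _ ≤ |w.K1 x y| * w.P1 x :=
            mul_le_mul_of_nonneg_right (neg_le_abs _) (w.P1_nonneg hx.le)
        _ ≤ _ := mul_le_mul_of_nonneg_left (w.P1_mono hx.le hx3.le hP) (abs_nonneg _)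
    linarith [neg_le_abs (w.N x y)]
  have hK : 0 < w.K w.xr3 y := by
    rw [w.K_xr3 hy.ne']
    exact mul_pos (div_pos w.l2_pos hy) (pow_pos (by linarith) 2)
  have hin : Summable fun s : ℕ × ℕ =>
      w.u (s.1 + 1) (s.2 + 1) * (w.xr3 ^ (s.1 + 1) * y ^ (s.2 + 1)) := by
    refine summable_of_sum_le (c := (|w.K1 w.xr3 y| * w.P1 w.xr3 + |w.N w.xr3 y|) / w.K w.xr3 y)
      (fun s => mul_nonneg (w.u_nonneg _ _) (by positivity)) fun F => ?_
    rw [le_div_iff₀ hK, mul_comm]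
    exact hlim F
  obtain ⟨R, hR, hs⟩ := w.exists_radius hlp
  have hcol := (w.summable_axis2_mono hy.le (hys.le.trans hR.le) hs)
  have h1 : Summable fun s : ℕ × ℕ => w.u (s.1 + 1) s.2 * (w.xr3 ^ (s.1 + 1) * y ^ s.2) := by
    have key := (hasSum_shift_snd_iff (f := fun s : ℕ × ℕ =>
      if s.2 = 0 then 0 else w.u (s.1 + 1) s.2 * (w.xr3 ^ (s.1 + 1) * y ^ s.2))
      (fun m => by simp)).1 (a := _) (by simpa using hin.hasSum)
    have row : Summable fun s : ℕ × ℕ =>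
        if s.2 = 0 then w.u (s.1 + 1) s.2 * (w.xr3 ^ (s.1 + 1) * y ^ s.2) else 0 := by
      refine (Function.Injective.summable_iff (g := fun m : ℕ => (m, 0))
        (fun _ _ h => by simpa using h) ?_).1 (by simpa [Function.comp_def] using hP)
      rintro ⟨m, n⟩ hx
      rcases n with _ | n
      · exact absurd ⟨m, rfl⟩ hx
      · simp
    refine (key.summable.add row).congr fun s => ?_
    split_ifs <;> simp
  have h2 := (hasSum_shift_fst_iff (f := fun s : ℕ × ℕ =>
      if s.1 = 0 then 0 else w.u s.1 s.2 * (w.xr3 ^ s.1 * y ^ s.2))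
      (fun m => by simp)).1 (a := _) (by simpa using h1.hasSum)
  have col : Summable fun s : ℕ × ℕ =>
      if s.1 = 0 then w.u s.1 s.2 * (w.xr3 ^ s.1 * y ^ s.2) else 0 := by
    refine (Function.Injective.summable_iff (g := fun n : ℕ => (0, n))
      (fun _ _ h => by simpa using h) ?_).1 ?_
    · rintro ⟨m, n⟩ hx
      rcases m with _ | m
      · exact absurd ⟨n, rfl⟩ hx
      · simp
    · refine (summable_nat_add_iff 1).1 ?_
      simpa [Function.comp_def] using hcol
  refine (h2.summable.add col).congr fun s => ?_
  split_ifs <;> simp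

/-- The functional equation degenerates at most linearly at the branch point. -/
theorem boundary_le (hlp : w.l1 < w.p) (hP : Summable fun m => w.u (m + 1) 0 * w.xr3 ^ (m + 1)) :
    ∃ c, 0 < c ∧ ∀ y, 0 < y → y < w.ys →
      w.K1 w.xr3 y * w.P1 w.xr3 + w.N w.xr3 y ≤ -c * (w.ys - y) := by
  obtain ⟨c, hc, hA⟩ := w.rowA_lower hlp hP
  refine ⟨w.l2 * c, mul_pos w.l2_pos hc, fun y hy hys => ?_⟩
  have hs := w.summable_moment_xr3 hlp hP hy hys
  have hf := w.functional_eq_real w.xr3_pos hy hs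
  have h3 := w.xr3_pos
  have hys0 := w.ys_pos
  have hin : Summable fun s : ℕ × ℕ =>
      w.u (s.1 + 1) (s.2 + 1) * (w.xr3 ^ (s.1 + 1) * y ^ (s.2 + 1)) :=
    hs.comp_injective (i := fun s : ℕ × ℕ => (s.1 + 1, s.2 + 1)) fun a b h => by
      ext <;> simp at h <;> omega
  have hin' := hin.prod_symm
  -- Row k+1 contributes at least c·(y/ys)^(k+1). The geometric series behaves like 1/(ys - y) near
  -- ys and cancels one of the two factors ys - y in K(xr3, y).
  have hPin : c * (y / (w.ys - y)) ≤ w.Pin w.xr3 y := by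
    have e : w.Pin w.xr3 y = ∑' k, ∑' m,
        w.u (m + 1) (k + 1) * (w.xr3 ^ (m + 1) * y ^ (k + 1)) := by
      simp only [Pin, smul_eq_mul]
      rw [← (Equiv.prodComm ℕ ℕ).tsum_eq, Summable.tsum_prod]
      · rfl
      · exact hin'
    have hr1 : y / w.ys < 1 := by rw [div_lt_one hys0]; exact hys
    have hr0 : 0 < y / w.ys := div_pos hy hys0
    have g := (hasSum_geometric_of_lt_one hr0.le hr1).mul_left (c * (y / w.ys))
    have e2 : c * (y / (w.ys - y)) = c * (y / w.ys) * (1 - y / w.ys)⁻¹ := by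
      have : w.ys - y ≠ 0 := by linarith
      have : 1 - y / w.ys = (w.ys - y) / w.ys := by field_simp
      rw [this]
      field_simp
    rw [e2, ← g.tsum_eq, e]
    refine g.summable.tsum_le_tsum (fun k => ?_) hin'.prod
    have e3 : ∑' m, w.u (m + 1) (k + 1) * (w.xr3 ^ (m + 1) * y ^ (k + 1))
        = (∑' m, w.u (m + 1) (k + 1) * w.xr3 ^ (m + 1)) * y ^ (k + 1) := by
      rw [← tsum_mul_right]; congr 1; ext m; ring
    have e4 : w.rowA (k + 1) ≤ ∑' m, w.u (m + 1) (k + 1) * w.xr3 ^ (m + 1) :=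
      (w.summable_row_mul hP (k + 1) 1).tsum_le_tsum
        (fun m => mul_le_mul_of_nonneg_left (w.rowV_le _) (w.u_nonneg _ _))
        (w.summable_row h3 hP (k + 1))
    have e5 := hA (k + 1)
    rw [e3]
    calc c * (y / w.ys) * (y / w.ys) ^ k = c * (y / w.ys) ^ (k + 1) := by ring
      _ ≤ w.ys ^ (k + 1) * w.rowA (k + 1) * (y / w.ys) ^ (k + 1) := by gcongr
      _ = w.rowA (k + 1) * y ^ (k + 1) := by
          rw [div_pow]; field_simp
      _ ≤ _ := by gcongr
  rw [w.K_xr3 hy.ne'] at hf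
  have hl2 := w.l2_pos
  have h5 : 0 < w.l2 / y * (w.ys - y) ^ 2 := mul_pos (div_pos hl2 hy) (pow_pos (by linarith) 2)
  have h6 := mul_le_mul_of_nonneg_left hPin h5.le
  have h7 : w.l2 / y * (w.ys - y) ^ 2 * (c * (y / (w.ys - y))) = w.l2 * c * (w.ys - y) := by
    have : w.ys - y ≠ 0 := by linarith
    field_simp
  linarith

end QuarterWalk

/-! ### A sector estimate for the smaller root -/

theorem abs_im_le_re {c : ℂ} (h : 0 ≤ c.re) (h2 : 0 ≤ (c ^ 2).re) : |c.im| ≤ c.re := by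
  have : (c ^ 2).re = c.re ^ 2 - c.im ^ 2 := by rw [sq, Complex.mul_re]; ring
  exact abs_le_of_sq_le_sq (by linarith) h

theorem abs_im_csqrt_le {c : ℂ} (h : 0 ≤ c.re) : |(csqrt c).im| ≤ (csqrt c).re :=
  abs_im_le_re (csqrt_re_nonneg c) (by rwa [csqrt_sq])

/-- Two numbers with argument at most π/4 in modulus have Re(α·conj β) ≥ 0, so |α - β| ≤ |α + β|,
while the product of these moduli is 2. Applied to α = √(w+1), β = √(w-1), it bounds w - √(w²-1) =
(α - β)²/2 by 1 in modulus. -/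
theorem norm_sub_sq_le_of_sector {α β : ℂ} (hα : |α.im| ≤ α.re) (hβ : |β.im| ≤ β.re)
    (hαβ : (α - β) * (α + β) = 2) : ‖α - β‖ ^ 2 ≤ 2 := by
  have h1 : ‖α - β‖ ^ 2 ≤ ‖α + β‖ ^ 2 := by
    rw [← Complex.normSq_eq_norm_sq, ← Complex.normSq_eq_norm_sq, Complex.normSq_apply,
      Complex.normSq_apply]
    simp only [Complex.sub_re, Complex.sub_im, Complex.add_re, Complex.add_im]
    have : -(α.im * β.im) ≤ α.re * β.re := by
      calc -(α.im * β.im) ≤ |α.im * β.im| := neg_le_abs _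
        _ = |α.im| * |β.im| := abs_mul _ _
        _ ≤ _ := mul_le_mul hα hβ (abs_nonneg _) ((abs_nonneg _).trans hα)
    nlinarith
  have h2 : ‖α - β‖ ^ 2 * ‖α + β‖ ^ 2 = 4 := by
    rw [← mul_pow, ← norm_mul, hαβ]; norm_num
  have := sq_nonneg ‖α - β‖
  nlinarith

namespace QuarterWalk

variable (w : QuarterWalk)

/-! #### The complex kernel -/

def wvC (X : ℂ) : ℂ :=
  ((w.l1 : ℂ) + w.l2 + w.p + w.q - w.l1 * X - w.p / X) / (2 * w.l2 * w.ys)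

def kap (X : ℂ) : ℂ := (w.l1 : ℂ) * w.xr3 * (1 - w.xr2 / X) / (2 * w.l2 * w.ys)

/-- A root of (wvC² - 1)/(1 - X/xr3), that is, the discriminant freed from its zero at the branch
point. It is split into two principal roots because `kap` and `wvC + 1` each have positive real part
on the annulus, which makes `oC` analytic even at `xr3`. -/
def oC (X : ℂ) : ℂ := csqrt (w.kap X) * csqrt (w.wvC X + 1)

/-- The branch of the kernel curve, in terms of `X` and `S = √(1 - X / xr3)`. -/
def Yb (X S : ℂ) : ℂ := w.ys * (w.wvC X - S * w.oC X)

theorem wvC_ofReal (x : ℝ) : w.wvC x = (w.wv x : ℝ) := by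
  simp only [wvC, wv]; push_cast; rfl

theorem wvC_sub_one {X : ℂ} (hX : X ≠ 0) : w.wvC X - 1 = w.kap X * (1 - X / w.xr3) := by
  have h1 : (w.l1 : ℂ) * (w.xr2 * w.xr3) = w.p := by exact_mod_cast w.l1_mul_xr_mul
  have h2 : (w.l1 : ℂ) * (w.xr2 + w.xr3) = w.l1 + w.l2 + w.p + w.q - 2 * w.l2 * w.ys := by
    exact_mod_cast w.l1_mul_xr_add
  have h3 : (w.l2 : ℂ) ≠ 0 := by exact_mod_cast w.l2_pos.ne'
  have h4 : (w.ys : ℂ) ≠ 0 := by exact_mod_cast w.ys_pos.ne'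
  have h5 : (w.xr3 : ℂ) ≠ 0 := by exact_mod_cast w.xr3_pos.ne'
  rw [wvC, kap]
  field_simp
  linear_combination h1 - X * h2

section Annulus

variable {w}
variable {X : ℂ}

/-- Re X ≤ |X| and Re X⁻¹ ≤ |X|⁻¹ enter with negative coefficients, so Re wvC(X) ≥ wv(|X|) ≥ 1. -/
theorem one_le_wvC_re (h2 : w.xr2 < ‖X‖) (h3 : ‖X‖ ≤ w.xr3) : 1 ≤ (w.wvC X).re := by
  have h := w.one_le_wv h2.le h3
  have hr : 0 < ‖X‖ := w.xr2_pos.trans h2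
  have e1 : (w.wvC X).re = (w.l1 + w.l2 + w.p + w.q - w.l1 * X.re - w.p * X⁻¹.re)
      / (2 * w.l2 * w.ys) := by
    have : w.wvC X = (((2 * w.l2 * w.ys : ℝ)⁻¹ : ℝ) : ℂ) * (((w.l1 + w.l2 + w.p + w.q : ℝ) : ℂ)
        - (w.l1 : ℂ) * X - (w.p : ℂ) * X⁻¹) := by
      simp only [wvC]; push_cast; rw [div_eq_mul_inv, div_eq_mul_inv]; ring
    rw [this, Complex.re_ofReal_mul]
    simp only [Complex.sub_re, Complex.re_ofReal_mul, Complex.ofReal_re]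
    ring
  have hx : X.re ≤ ‖X‖ := Complex.re_le_norm X
  have hi : X⁻¹.re ≤ ‖X‖⁻¹ := by rw [← norm_inv]; exact Complex.re_le_norm _
  have hl := mul_le_mul_of_nonneg_left hx w.l1_pos.le
  have hp := mul_le_mul_of_nonneg_left hi w.p_pos.le
  refine h.trans ?_
  rw [e1, wv, div_eq_mul_inv w.p]
  have := w.l2ys_pos
  gcongr

theorem kap_re_pos (h2 : w.xr2 < ‖X‖) : 0 < (w.kap X).re := by
  have hr : 0 < ‖X‖ := w.xr2_pos.trans h2
  have e : w.kap X = ((w.l1 * w.xr3 / (2 * w.l2 * w.ys) : ℝ) : ℂ) * (1 - w.xr2 * X⁻¹) := by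
    simp only [kap]; push_cast; rw [div_eq_mul_inv _ X]; ring
  rw [e, Complex.re_ofReal_mul]
  refine mul_pos (div_pos (mul_pos w.l1_pos w.xr3_pos) w.l2ys_pos) ?_
  simp only [Complex.sub_re, Complex.one_re, Complex.re_ofReal_mul]
  have hi : X⁻¹.re ≤ ‖X‖⁻¹ := by rw [← norm_inv]; exact Complex.re_le_norm _
  have := mul_le_mul_of_nonneg_left hi w.xr2_pos.le
  have : w.xr2 * ‖X‖⁻¹ < 1 := by rw [← div_eq_mul_inv, div_lt_one hr]; exact h2
  linarith

theorem X_ne_zero (h2 : w.xr2 < ‖X‖) : X ≠ 0 := norm_pos_iff.1 (w.xr2_pos.trans h2)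

theorem oC_sq : w.oC X ^ 2 = w.kap X * (w.wvC X + 1) := by
  rw [oC, mul_pow, csqrt_sq, csqrt_sq]

theorem Yb_quad {S : ℂ} (hX : X ≠ 0) (hS : S ^ 2 = 1 - X / w.xr3) :
    w.Yb X S ^ 2 - 2 * w.ys * w.wvC X * w.Yb X S + w.ys ^ 2 = 0 := by
  have h1 := w.wvC_sub_one hX
  have h2 := oC_sq (w := w) (X := X)
  rw [Yb]
  rw [← hS] at h1
  linear_combination w.ys ^ 2 * S ^ 2 * h2 - w.ys ^ 2 * (w.wvC X + 1) * h1

theorem Yb_ne_zero {S : ℂ} (hX : X ≠ 0) (hS : S ^ 2 = 1 - X / w.xr3) : w.Yb X S ≠ 0 := by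
  intro h
  have := Yb_quad hX hS
  rw [h] at this
  have h4 : (w.ys : ℂ) ≠ 0 := by exact_mod_cast w.ys_pos.ne'
  rw [zero_pow two_ne_zero, mul_zero, sub_zero, zero_add] at this
  exact h4 (pow_eq_zero_iff two_ne_zero |>.1 this)

theorem K_Yb {S : ℂ} (hX : X ≠ 0) (hS : S ^ 2 = 1 - X / w.xr3) : w.K X (w.Yb X S) = 0 := by
  have h0 := Yb_ne_zero hX hS
  have h := Yb_quad hX hS
  have h3 : (w.l2 : ℂ) ≠ 0 := by exact_mod_cast w.l2_pos.ne'
  have h4 : (w.ys : ℂ) ≠ 0 := by exact_mod_cast w.ys_pos.ne'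
  have h5 : (w.l2 : ℂ) * w.ys ^ 2 = w.q := by exact_mod_cast w.l2_mul_ys_sq
  have e : 2 * (w.l2 : ℂ) * w.ys * w.wvC X = w.l1 + w.l2 + w.p + w.q - w.l1 * X - w.p / X := by
    rw [wvC]; field_simp
  have e2 : w.K X (w.Yb X S) = w.l2 * w.Yb X S + w.q / w.Yb X S
      - (w.l1 + w.l2 + w.p + w.q - w.l1 * X - w.p / X) := by
    simp only [K, Complex.real_smul]
    rw [div_eq_mul_inv, div_eq_mul_inv]; ring
  rw [e2, ← e]
  have : (w.Yb X S) * ((w.l2 : ℂ) * w.Yb X S + w.q / w.Yb X S - 2 * (w.l2 : ℂ) * w.ys * w.wvC X) = 0 := by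
    rw [mul_sub, mul_add, mul_div_cancel₀ _ h0]
    linear_combination (w.l2 : ℂ) * h - h5
  exact (mul_eq_zero.1 this).resolve_left h0

theorem sqrt_sq (X : ℂ) : csqrt (1 - X / w.xr3) ^ 2 = 1 - X / w.xr3 := csqrt_sq _

/-- Yb equals ys·(α - β)²/2 with α² = wvC + 1 and β² = wvC - 1, and α and β both lie in the sector
of `norm_sub_sq_le_of_sector`. Thus `Yb` with this root is the branch of smaller modulus on the
whole annulus. -/
theorem norm_Yb_le_ys (h2 : w.xr2 < ‖X‖) (h3 : ‖X‖ ≤ w.xr3) :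
    ‖w.Yb X (csqrt (1 - X / w.xr3))‖ ≤ w.ys := by
  set S := csqrt (1 - X / w.xr3) with hS
  set α := csqrt (w.wvC X + 1) with hα
  set β := S * csqrt (w.kap X) with hβ
  have hX := X_ne_zero h2
  have e1 : α ^ 2 = w.wvC X + 1 := csqrt_sq _
  have e2 : β ^ 2 = w.wvC X - 1 := by
    rw [hβ, mul_pow, hS, csqrt_sq, csqrt_sq, w.wvC_sub_one hX]; ring
  have hw := one_le_wvC_re h2 h3
  have hαs : |α.im| ≤ α.re := abs_im_csqrt_le (by simp; linarith)
  have hSs : |S.im| ≤ S.re := by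
    refine abs_im_csqrt_le ?_
    have : (X / w.xr3).re ≤ 1 := by
      refine (Complex.re_le_norm _).trans ?_
      rw [norm_div, Complex.norm_real, Real.norm_of_nonneg w.xr3_pos.le, div_le_one w.xr3_pos]
      exact h3
    simpa using this
  have hks : |(csqrt (w.kap X)).im| ≤ (csqrt (w.kap X)).re := abs_im_csqrt_le (kap_re_pos h2).le
  -- β is a product of two numbers of the sector, so Re β ≥ 0 only; that β itself lies in the sector
  -- follows from Re β² = Re wvC - 1 ≥ 0.
  have hβs : |β.im| ≤ β.re := by
    refine abs_im_le_re ?_ (by rw [e2]; simpa using hw)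
    rw [hβ, Complex.mul_re]
    have : S.im * (csqrt (w.kap X)).im ≤ S.re * (csqrt (w.kap X)).re := by
      calc _ ≤ |S.im * (csqrt (w.kap X)).im| := le_abs_self _
        _ = |S.im| * |(csqrt (w.kap X)).im| := abs_mul _ _
        _ ≤ _ := mul_le_mul hSs hks (abs_nonneg _) ((abs_nonneg _).trans hSs)
    linarith
  have h := norm_sub_sq_le_of_sector hαs hβs (by linear_combination e1 - e2)
  have e : w.Yb X S = w.ys * ((α - β) ^ 2 / 2) := by
    rw [Yb, oC]
    linear_combination (-(w.ys : ℂ) / 2) * (e1 + e2)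
  rw [e, norm_mul, norm_div, norm_pow, Complex.norm_real, Real.norm_of_nonneg w.ys_pos.le]
  have : ‖(2 : ℂ)‖ = 2 := by simp
  rw [this]
  have := w.ys_pos
  nlinarith

/-- K(X, Y) = 0 expresses the sum of the rates as l1·X + l2·Y + p/X + q/Y; taking moduli gives
K(|X|, |Y|) ≥ 0. Together with |Y| ≤ ys this forces |Y| below the smaller real root. -/
theorem norm_Yb_le_y0 (h2 : w.xr2 < ‖X‖) (h3 : ‖X‖ ≤ w.xr3) :
    ‖w.Yb X (csqrt (1 - X / w.xr3))‖ ≤ w.y0 ‖X‖ := by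
  have hX := X_ne_zero h2
  have h0 := Yb_ne_zero hX (sqrt_sq (w := w) X)
  have hK := K_Yb hX (sqrt_sq (w := w) X)
  have hys := norm_Yb_le_ys h2 h3
  set Y := w.Yb X (csqrt (1 - X / w.xr3))
  refine w.le_y0_of_K_nonneg h2.le h3 (norm_pos_iff.2 h0) hys ?_
  simp only [K, Complex.real_smul] at hK
  have e : ((w.l1 + w.l2 + w.p + w.q : ℝ) : ℂ)
      = (w.l1 : ℂ) * X + w.l2 * Y + w.p * X⁻¹ + w.q * Y⁻¹ := by
    push_cast; linear_combination -hK
  have e2 : w.l1 + w.l2 + w.p + w.q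
      ≤ w.l1 * ‖X‖ + w.l2 * ‖Y‖ + w.p * ‖X‖⁻¹ + w.q * ‖Y‖⁻¹ := by
    have hn := congrArg norm e
    have hl1 := w.l1_pos; have hl2 := w.l2_pos; have hp := w.p_pos; have hq := w.q_pos
    rw [Complex.norm_real, Real.norm_of_nonneg (by positivity)] at hn
    rw [hn]
    refine (norm_add₄_le).trans (le_of_eq ?_)
    simp only [norm_mul, norm_inv, Complex.norm_real, Real.norm_of_nonneg hl1.le,
      Real.norm_of_nonneg hl2.le, Real.norm_of_nonneg hp.le, Real.norm_of_nonneg hq.le]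
  simp only [K, smul_eq_mul]
  linarith

theorem analyticAt_wvC (hX : X ≠ 0) : AnalyticAt ℂ w.wvC X := by
  have h3 : (2 * w.l2 * w.ys : ℂ) ≠ 0 := by exact_mod_cast w.l2ys_pos.ne'
  unfold wvC
  fun_prop (disch := assumption)

theorem analyticAt_kap (hX : X ≠ 0) : AnalyticAt ℂ w.kap X := by
  have h3 : (2 * w.l2 * w.ys : ℂ) ≠ 0 := by exact_mod_cast w.l2ys_pos.ne'
  unfold kap
  fun_prop (disch := assumption)

theorem analyticAt_oC (h2 : w.xr2 < ‖X‖) (h3 : ‖X‖ ≤ w.xr3) : AnalyticAt ℂ w.oC X := by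
  have hX := X_ne_zero h2
  refine AnalyticAt.mul ?_ ?_
  · exact (analyticAt_csqrt (Or.inl (kap_re_pos h2))).comp (analyticAt_kap hX)
  · refine (analyticAt_csqrt (Or.inl ?_)).comp ((analyticAt_wvC hX).add analyticAt_const)
    have := one_le_wvC_re h2 h3
    simp; linarith

theorem analyticAt_Yb {S : ℂ} (h2 : w.xr2 < ‖X‖) (h3 : ‖X‖ ≤ w.xr3) :
    AnalyticAt ℂ (fun v : ℂ × ℂ => w.Yb v.1 v.2) (X, S) := by
  have hX := X_ne_zero h2
  have h4 := (analyticAt_wvC (w := w) hX).fun_comp (analyticAt_fst (𝕜 := ℂ) (p := (X, S)))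
  have h5 := (analyticAt_oC h2 h3).fun_comp (analyticAt_fst (𝕜 := ℂ) (p := (X, S)))
  exact analyticAt_const.mul (h4.sub (analyticAt_snd.mul h5))

end Annulus

theorem kap_ofReal (x : ℝ) : w.kap x = (w.l1 * w.xr3 * (1 - w.xr2 / x) / (2 * w.l2 * w.ys) : ℝ) := by
  simp only [kap]; push_cast; rfl

theorem oC_ofReal {x : ℝ} (h2 : w.xr2 < x) (h3 : x ≤ w.xr3) :
    w.oC x = (√(w.l1 * w.xr3 * (1 - w.xr2 / x) / (2 * w.l2 * w.ys)) * √(w.wv x + 1) : ℝ) := by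
  have hx := w.xr2_pos.trans h2
  have h := w.one_le_wv h2.le h3
  have hk : 0 ≤ w.l1 * w.xr3 * (1 - w.xr2 / x) / (2 * w.l2 * w.ys) := by
    refine div_nonneg (mul_nonneg (mul_pos w.l1_pos w.xr3_pos).le ?_) w.l2ys_pos.le
    rw [sub_nonneg, div_le_one hx]; exact h2.le
  rw [oC, kap_ofReal, wvC_ofReal, csqrt_ofReal hk,
    show ((w.wv x : ℝ) : ℂ) + 1 = ((w.wv x + 1 : ℝ) : ℂ) by push_cast; rfl,
    csqrt_ofReal (by linarith)]
  push_cast; rfl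

theorem Yb_ofReal {x : ℝ} (h2 : w.xr2 < x) (h3 : x ≤ w.xr3) :
    w.Yb x (csqrt (1 - x / w.xr3)) = (w.y0 x : ℝ) := by
  have hx := w.xr2_pos.trans h2
  have h := w.one_le_wv h2.le h3
  have hk : 0 ≤ w.l1 * w.xr3 * (1 - w.xr2 / x) / (2 * w.l2 * w.ys) := by
    refine div_nonneg (mul_nonneg (mul_pos w.l1_pos w.xr3_pos).le ?_) w.l2ys_pos.le
    rw [sub_nonneg, div_le_one hx]; exact h2.le
  have hs : 0 ≤ 1 - x / w.xr3 := by rw [sub_nonneg, div_le_one w.xr3_pos]; exact h3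
  have hw : w.wv x ^ 2 - 1 = (1 - x / w.xr3) *
      (w.l1 * w.xr3 * (1 - w.xr2 / x) / (2 * w.l2 * w.ys) * (w.wv x + 1)) := by
    have h1 := w.wv_sub_one hx.ne'
    have h4 := w.l2_pos.ne'
    have h5 := w.ys_pos.ne'
    have h6 := w.xr3_pos.ne'
    have : w.wv x ^ 2 - 1 = (w.wv x - 1) * (w.wv x + 1) := by ring
    rw [this, h1]
    field_simp
  rw [Yb, wvC_ofReal, w.oC_ofReal h2 h3,
    show (1 : ℂ) - x / w.xr3 = ((1 - x / w.xr3 : ℝ) : ℂ) by push_cast; rfl, csqrt_ofReal hs, y0, hw,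
    Real.sqrt_mul hs, Real.sqrt_mul hk]
  push_cast; rfl

theorem Yb_xr3 : w.Yb w.xr3 0 = w.ys := by
  rw [Yb, wvC_ofReal, wv_xr3]; simp

/-! #### Zeros of `K1` and the boundary term on the curve -/

/-- X, Y and X⁻¹ occur in K1 with positive coefficients, so K1 at moduli dominates the real part.
The defect in Re X is kept in order to treat the circle through a real zero. -/
theorem re_K1_le {X Y : ℂ} {y : ℝ} (hY : ‖Y‖ ≤ y) :
    (w.K1 X Y).re ≤ w.K1 ‖X‖ y + w.l1 * (X.re - ‖X‖) := by
  have hi : X⁻¹.re ≤ ‖X‖⁻¹ := by rw [← norm_inv]; exact Complex.re_le_norm _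
  have hy : Y.re ≤ y := (Complex.re_le_norm Y).trans hY
  have h1 := mul_le_mul_of_nonneg_left hi w.M1_pos.le
  have h2 := mul_le_mul_of_nonneg_left hy w.l2_pos.le
  simp only [K1, smul_eq_mul, Complex.add_re, Complex.smul_re, Complex.sub_re, Complex.one_re]
  linarith

theorem K1_ne_zero {X Y : ℂ} {y : ℝ} (hY : ‖Y‖ ≤ y) (h : w.K1 ‖X‖ y < 0) : w.K1 X Y ≠ 0 := by
  intro h0
  have := w.re_K1_le (X := X) hY
  rw [h0, Complex.zero_re] at this
  have := mul_le_mul_of_nonneg_left (Complex.re_le_norm X) w.l1_pos.le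
  linarith

/-- On the circle through a real zero the dominating value may be 0; off the positive axis Re X <
|X| restores strictness. -/
theorem K1_ne_zero_of_ne {X Y : ℂ} {y : ℝ} (hY : ‖Y‖ ≤ y) (h : w.K1 ‖X‖ y ≤ 0)
    (hX : X ≠ ‖X‖) : w.K1 X Y ≠ 0 := by
  intro h0
  have h1 := w.re_K1_le (X := X) hY
  rw [h0, Complex.zero_re] at h1
  have h2 : X.re < ‖X‖ := by
    refine lt_of_le_of_ne (Complex.re_le_norm X) fun he => hX ?_
    have hsq := Complex.sq_norm_sub_sq_re X
    rw [he, sub_self] at hsq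
    have him : X.im = 0 := by simpa using hsq.symm
    exact Complex.ext (by simpa using he) (by simpa using him)
  nlinarith [w.l1_pos]

theorem P2_ofReal (y : ℝ) : w.P2 (y : ℂ) = (w.P2 y : ℝ) := by
  simp only [P2, Complex.real_smul, smul_eq_mul, Complex.ofReal_tsum]
  push_cast; rfl

theorem K1_ofReal (x y : ℝ) : w.K1 (x : ℂ) (y : ℂ) = (w.K1 x y : ℝ) := by
  simp only [K1, Complex.real_smul, smul_eq_mul]; push_cast; rfl

theorem N_ofReal (x y : ℝ) : w.N (x : ℂ) (y : ℂ) = (w.N x y : ℝ) := by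
  simp only [N, P2_ofReal, K2, K0, Complex.real_smul, smul_eq_mul]; push_cast; rfl

theorem analyticAt_P2 {R : ℝ} (hs : Summable fun n => w.u 0 (n + 1) * R ^ (n + 1)) {Y : ℂ}
    (hY : ‖Y‖ < R) : AnalyticAt ℂ (fun Y : ℂ => w.P2 Y) Y := by
  have hR : 0 < R := (norm_nonneg Y).trans_lt hY
  have hs' : Summable fun n => w.u 0 (n + 1) * R ^ n := by
    refine (hs.div_const R).congr fun n => ?_
    rw [pow_succ]; field_simp
  have h := analyticOnNhd_tsum_pow (fun n => w.u_nonneg 0 (n + 1)) hs' Y (by simpa using hY)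
  have e : (fun Y : ℂ => w.P2 Y) = fun Y : ℂ => Y * ∑' n, (w.u 0 (n + 1) : ℂ) * Y ^ n := by
    ext Y
    rw [P2, ← tsum_mul_left]
    congr 1; ext n; rw [Complex.real_smul, pow_succ]; ring
  rw [e]
  exact analyticAt_id.mul h

theorem analyticAt_K1 {X Y : ℂ} (hX : X ≠ 0) :
    AnalyticAt ℂ (fun v : ℂ × ℂ => w.K1 v.1 v.2) (X, Y) := by
  have h1 : AnalyticAt ℂ (fun v : ℂ × ℂ => v.1) (X, Y) := analyticAt_fst
  have h2 : AnalyticAt ℂ (fun v : ℂ × ℂ => v.2) (X, Y) := analyticAt_snd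
  simp only [K1, Complex.real_smul]
  exact ((analyticAt_const.mul (h1.sub analyticAt_const)).add
    (analyticAt_const.mul (h2.sub analyticAt_const))).add
    (analyticAt_const.mul ((h1.fun_inv hX).sub analyticAt_const))

theorem analyticAt_N {R : ℝ} (hs : Summable fun n => w.u 0 (n + 1) * R ^ (n + 1)) {X Y : ℂ}
    (hY0 : Y ≠ 0) (hY : ‖Y‖ < R) : AnalyticAt ℂ (fun v : ℂ × ℂ => w.N v.1 v.2) (X, Y) := by
  have h := (w.analyticAt_P2 hs hY).fun_comp (analyticAt_snd (𝕜 := ℂ) (p := (X, Y)))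
  have h1 : AnalyticAt ℂ (fun v : ℂ × ℂ => v.1) (X, Y) := analyticAt_fst
  have h2 : AnalyticAt ℂ (fun v : ℂ × ℂ => v.2) (X, Y) := analyticAt_snd
  have h0 : AnalyticAt ℂ (fun v : ℂ × ℂ => (w.l1 : ℂ) * (v.1 - 1) + (w.l2 : ℂ) * (v.2 - 1)) (X, Y) :=
    (analyticAt_const.mul (h1.sub analyticAt_const)).add
      (analyticAt_const.mul (h2.sub analyticAt_const))
  simp only [N, K2, K0, Complex.real_smul]
  exact ((h0.add (analyticAt_const.mul ((h2.fun_inv hY0).sub analyticAt_const))).mul h).add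
    (analyticAt_const.mul h0)

/-- The boundary identity on the complex kernel curve, close to the unit circle. -/
theorem boundary_identity {X : ℂ} (h1 : 1 < ‖X‖) (h2 : ‖X‖ < w.p / w.l1) :
    w.K1 X (w.Yb X (csqrt (1 - X / w.xr3))) * w.P1 X + w.N X (w.Yb X (csqrt (1 - X / w.xr3))) = 0 := by
  have hx2 : w.xr2 < ‖X‖ := w.xr2_le_one.trans_lt h1
  have hx3 : ‖X‖ ≤ w.xr3 := h2.le.trans w.ratio_le_xr3
  have hX := X_ne_zero hx2
  have hK := K_Yb hX (sqrt_sq (w := w) X)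
  have h0 := Yb_ne_zero hX (sqrt_sq (w := w) X)
  have hle := norm_Yb_le_y0 hx2 hx3
  have hr : 0 < ‖X‖ := by linarith
  -- Here K(|X|, 1) < 0, so the branch lies inside the unit disc and the horizontal moments alone
  -- justify the functional equation.
  have hy : w.y0 ‖X‖ < 1 := by
    refine w.y0_lt_of_K_neg hx2.le hx3 one_pos ?_
    rw [w.K_eq _ _ hr.ne' one_ne_zero]
    have : w.l1 < w.p / ‖X‖ := by
      rw [lt_div_iff₀ hr]; rw [lt_div_iff₀ w.l1_pos] at h2; linarith
    nlinarith
  have := w.functional_eq hX h0 (w.summable_moment_mono hr.le (norm_nonneg _) le_rfl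
    (hle.trans hy.le) (w.summable_moment_one h1 h2))
  rw [hK] at this
  linear_combination this

end QuarterWalk

namespace QuarterWalk

variable (w : QuarterWalk)

/-! #### The coefficients on the horizontal axis -/

/-- The coefficients of `z ↦ P1 (xd * z)`. -/
def rowCoeff (xd : ℝ) (m : ℕ) : ℝ := if m = 0 then 0 else w.u m 0 * xd ^ m

/-- With X = xd·z, the circles |z| = ρ and |z| = ρ' fall into the annulus 1 < |X| < p/l1 where P1
converges and the boundary identity holds. The second radius is used for termwise differentiation.
-/
theorem exists_radii (hlp : w.l1 < w.p) {xd : ℝ} (hxd : 1 < xd) :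
    ∃ ρ ρ', 1 / xd < ρ ∧ ρ < ρ' ∧ ρ' < 1 ∧ xd * ρ' < w.p / w.l1 := by
  have h0 : 0 < xd := by linarith
  have h : 1 / xd < min 1 (w.p / w.l1 / xd) := by
    refine lt_min ((div_lt_one h0).2 hxd) ?_
    gcongr
    rw [lt_div_iff₀ w.l1_pos]; linarith
  obtain ⟨ρ, h1, h2⟩ := exists_between h
  obtain ⟨ρ', h3, h4⟩ := exists_between h2
  refine ⟨ρ, ρ', h1, h3, h4.trans_le (min_le_left _ _), ?_⟩
  have := h4.trans_le (min_le_right _ _)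
  rw [lt_div_iff₀ h0] at this
  linarith

section Coefficients

variable {w}
variable {xd ρ : ℝ}

theorem summable_rowCoeff (hxd : 0 < xd) (h1 : 1 < xd * ρ) (h2 : xd * ρ < w.p / w.l1) :
    Summable fun m => ‖(w.rowCoeff xd m : ℂ)‖ * ρ ^ m := by
  have h := w.summable_axis1 (w.summable_moment_one h1 h2)
  refine (summable_nat_add_iff 1).1 (h.congr fun m => ?_)
  have := w.u_nonneg (m + 1) 0
  rw [rowCoeff, if_neg (by omega), Complex.norm_real, Real.norm_of_nonneg (by positivity), mul_pow]
  ring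

theorem tsum_rowCoeff (hxd : 0 < xd) (h1 : 1 < xd * ρ) (h2 : xd * ρ < w.p / w.l1) {z : ℂ}
    (hz : ‖z‖ ≤ ρ) : ∑' m, (w.rowCoeff xd m : ℂ) * z ^ m = w.P1 (xd * z : ℂ) := by
  have hs : Summable fun m => (w.rowCoeff xd m : ℂ) * z ^ m := by
    refine Summable.of_norm_bounded (summable_rowCoeff hxd h1 h2) fun m => ?_
    rw [norm_mul, norm_pow]
    gcongr
  rw [hs.tsum_eq_zero_add, P1]
  have : (w.rowCoeff xd 0 : ℂ) = 0 := by simp [rowCoeff]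
  rw [this, zero_mul, zero_add]
  congr 1; ext m
  rw [rowCoeff, if_neg (by omega), Complex.real_smul, mul_pow]
  push_cast; ring

theorem norm_X (hxd : 0 < xd) (z : ℂ) : ‖(xd * z : ℂ)‖ = xd * ‖z‖ := by
  rw [norm_mul, Complex.norm_real, Real.norm_of_nonneg hxd.le]

end Coefficients

theorem tendsto_real_of_complex {f : ℕ → ℝ} {L : ℝ}
    (h : Tendsto (fun m => (f m : ℂ)) atTop (𝓝 (L : ℂ))) : Tendsto f atTop (𝓝 L) := by
  exact tendsto_ofReal_iff.1 h

namespace Regular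

variable {w}
variable {C xp xm : ℝ}

/-- Inside the circle |X| = xp the dominating real value is negative; on the circle it is exactly 0
and strictness comes from X ≠ |X|. -/
theorem K1_Yb_ne_zero (h : w.Regular C xp xm) (he : w.eta xp ≤ w.ys) {X : ℂ} (h1 : 1 < ‖X‖)
    (h2 : ‖X‖ ≤ xp) (hX : X ≠ xp) : w.K1 X (w.Yb X (csqrt (1 - X / w.xr3))) ≠ 0 := by
  have hle := norm_Yb_le_y0 (w := w) (w.xr2_le_one.trans_lt h1) (h2.trans h.le_xr3)
  rcases lt_or_eq_of_le h2 with hlt | heq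
  · exact w.K1_ne_zero hle (h.K1_y0_neg h1 hlt)
  · refine w.K1_ne_zero_of_ne hle ?_ (by rw [heq]; exact hX)
    rw [heq, w.K1_eq_eta _ (by linarith), h.eta_eq_y0 he]; simp

/-- The real value of `oC` at the branch point. -/
theorem oC_xr3_pos (h : w.Regular C xp xm) : ∃ o : ℝ, 0 < o ∧ w.oC w.xr3 = o ∧
    o = √(w.l1 * w.xr3 * (1 - w.xr2 / w.xr3) / (2 * w.l2 * w.ys)) * √2 := by
  have h2 := w.xr2_lt_xr3 h.l1_lt
  have hk : 0 < w.l1 * w.xr3 * (1 - w.xr2 / w.xr3) / (2 * w.l2 * w.ys) := by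
    refine div_pos (mul_pos (mul_pos w.l1_pos w.xr3_pos) ?_) w.l2ys_pos
    rw [sub_pos, div_lt_one w.xr3_pos]; exact h2
  refine ⟨_, ?_, w.oC_ofReal h2 le_rfl, ?_⟩
  · rw [wv_xr3]; positivity
  · rw [wv_xr3]; norm_num

/-- Coefficient asymptotics when the zero of `K1` is the branch point. -/
theorem tendsto_row_branch_pole (h : w.Regular C xp xm) (hx : xp = w.xr3) (he : w.eta xp = w.ys) :
    Tendsto (fun m : ℕ => √(m : ℝ) * (w.u m 0 * xp ^ m)) atTop
      (𝓝 (w.N xp w.ys / (w.l2 * w.ys * (√(w.l1 * xp * (1 - w.xr2 / xp) / (2 * w.l2 * w.ys)) * √2))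
        / √Real.pi)) := by
  obtain ⟨o, ho, hoC, hoe⟩ := h.oC_xr3_pos
  rw [← hx] at hoC hoe
  rw [← hoe]
  have hxp := h.one_lt
  have hxp0 : 0 < xp := by linarith
  have hxpC : (xp : ℂ) ≠ 0 := by exact_mod_cast hxp0.ne'
  have hl2 : (w.l2 : ℂ) ≠ 0 := by exact_mod_cast w.l2_pos.ne'
  have hysC : (w.ys : ℂ) ≠ 0 := by exact_mod_cast w.ys_pos.ne'
  obtain ⟨ρ, ρ', r1, r2, r3, r4⟩ := w.exists_radii h.l1_lt h.one_lt
  have hρ0 : 0 < ρ := lt_trans (by positivity) r1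
  rw [div_lt_iff₀ hxp0, mul_comm] at r1
  have r5 : xp * ρ < w.p / w.l1 := lt_trans (by gcongr) r4
  obtain ⟨R, hR, hs⟩ := w.exists_radius h.l1_lt
  -- Along the curve K1 = -S·d: the relations K1(xp, ys) = 0 and wv(xp) = 1 remove the constant
  -- term. Hence P1 = (N/d)/S, and d does not vanish, being l2·ys·o at S = 0 and a quotient of a
  -- nonzero K1 elsewhere.
  set d : ℂ × ℂ → ℂ := fun v => w.l2 * w.ys * w.oC (xp * v.1)
    + v.2 * (xp * w.l1 / 2 - (w.M1 - w.p / 2) / (xp * v.1)) with hd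
  have hK1 : ∀ X S : ℂ, X ≠ 0 → S ^ 2 = 1 - X / w.xr3 → w.K1 X (w.Yb X S)
      = -S * (w.l2 * w.ys * w.oC X + S * (xp * w.l1 / 2 - (w.M1 - w.p / 2) / X)) := by
    intro X S hX hS
    rw [← hx] at hS
    have e0 : w.K1 xp w.ys = 0 := by rw [w.K1_eq_eta _ hxp0.ne', he]; simp
    have e1 : w.wv xp = 1 := by rw [hx]; exact w.wv_xr3
    have e0' : (w.l1 : ℂ) * (xp - 1) + w.l2 * (w.ys - 1) + w.M1 * (1 / xp - 1) = 0 := by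
      simp only [K1, smul_eq_mul] at e0
      rw [one_div]; exact_mod_cast e0
    have e1' : (w.l1 : ℂ) + w.l2 + w.p + w.q - w.l1 * xp - w.p / xp = 2 * w.l2 * w.ys := by
      rw [wv, div_eq_one_iff_eq w.l2ys_pos.ne'] at e1
      exact_mod_cast e1
    simp only [K1, Complex.real_smul, Yb]
    have e2 : 2 * (w.l2 : ℂ) * w.ys * w.wvC X = w.l1 + w.l2 + w.p + w.q - w.l1 * X - w.p / X := by
      rw [wvC]; field_simp
    have e3 : (X : ℂ) = xp * (1 - S ^ 2) := by rw [hS]; field_simp; ring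
    have e4 : xp * S ^ 2 / X = xp / X - 1 := by rw [hS]; field_simp
    have e5 : (1 / xp : ℂ) = (1 - S ^ 2) / X := by rw [hS]; field_simp; ring
    have e6 : (w.p / xp : ℂ) = w.p * ((1 - S ^ 2) / X) := by rw [← e5]; ring
    rw [e5] at e0'
    rw [e6] at e1'
    have e7 : (w.l1 : ℂ) * X = w.l1 * (xp * (1 - S ^ 2)) := by rw [← e3]
    linear_combination e2 / 2 + e0' + e1' / 2 + e7 / 2
  have hloc : ∀ z : ℂ, 1 / xp < ‖z‖ → ‖z‖ ≤ 1 → 1 < ‖(xp * z : ℂ)‖ ∧ ‖(xp * z : ℂ)‖ ≤ xp := by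
    intro z h1 h2
    rw [div_lt_iff₀ hxp0] at h1
    rw [norm_X hxp0]
    exact ⟨by linarith, by nlinarith⟩
  have hS : ∀ z : ℂ, csqrt (1 - z) = csqrt (1 - (xp * z) / w.xr3) := by
    intro z; rw [← hx, mul_div_cancel_left₀ _ hxpC]
  have hd0 : ∀ z : ℂ, 1 / xp < ‖z‖ → ‖z‖ ≤ 1 → d (z, csqrt (1 - z)) ≠ 0 := by
    intro z h1 h2 h0
    by_cases hz : z = 1
    · rw [hd, hz] at h0
      simp only [sub_self, csqrt_zero, zero_mul, add_zero, mul_one] at h0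
      rw [hoC] at h0
      have hoC0 : (o : ℂ) ≠ 0 := by exact_mod_cast ho.ne'
      exact mul_ne_zero (mul_ne_zero hl2 hysC) hoC0 h0
    · obtain ⟨h3, h4⟩ := hloc z h1 h2
      refine h.K1_Yb_ne_zero he.le h3 h4 (fun e => hz ?_) ?_
      · apply mul_left_cancel₀ hxpC; rw [e, mul_one]
      · rw [hK1 _ _ (X_ne_zero (w.xr2_le_one.trans_lt h3)) (csqrt_sq _), ← hS]
        simp only [hd] at h0
        rw [h0, mul_zero]
  have key := tendsto_coeff_of_invSqrt_singularity (a := fun m => (w.rowCoeff xp m : ℂ))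
    (ρ := ρ) (r0 := 1 / xp) (by positivity) (by rw [div_lt_iff₀ hxp0]; linarith) (by linarith)
    (summable_rowCoeff hxp0 r1 r5)
    (Φ := fun v => w.N (xp * v.1) (w.Yb (xp * v.1) v.2) / d v) ?_ ?_
  · have e : w.N (xp * (1 : ℂ)) (w.Yb (xp * 1) 0) / d (1, 0) / (√Real.pi : ℝ)
        = ((w.N xp w.ys / (w.l2 * w.ys * o) / √Real.pi : ℝ) : ℂ) := by
      have e1 : w.Yb xp 0 = w.ys := by rw [hx]; exact w.Yb_xr3
      simp only [hd, mul_one, zero_mul, add_zero, e1, hoC, N_ofReal]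
      push_cast; rfl
    simp only at key
    rw [e] at key
    refine (tendsto_real_of_complex (f := fun m : ℕ => √(m : ℝ) * w.rowCoeff xp m)
      (by push_cast at key ⊢; exact key)).congr' ?_
    filter_upwards [eventually_ne_atTop 0] with m hm
    rw [rowCoeff, if_neg hm]
  · intro z h1 h2
    obtain ⟨h3, h4⟩ := hloc z h1 h2
    have hx2 := w.xr2_le_one.trans_lt h3
    have hx3 := h4.trans h.le_xr3
    have hX := X_ne_zero hx2
    have aX : AnalyticAt ℂ (fun v : ℂ × ℂ => (xp : ℂ) * v.1) (z, csqrt (1 - z)) :=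
      analyticAt_const.mul analyticAt_fst
    have aS : AnalyticAt ℂ (fun v : ℂ × ℂ => v.2) (z, csqrt (1 - z)) := analyticAt_snd
    have aY : AnalyticAt ℂ (fun v : ℂ × ℂ => w.Yb (xp * v.1) v.2) (z, csqrt (1 - z)) :=
      (analyticAt_Yb (w := w) hx2 hx3).comp₂ (x := (z, csqrt (1 - z))) aX aS
    have hle := norm_Yb_le_ys (w := w) hx2 hx3
    have hY0 := Yb_ne_zero (w := w) hX (csqrt_sq _)
    rw [← hS] at hle hY0
    refine AnalyticAt.fun_div ((w.analyticAt_N hs hY0 (hle.trans_lt hR)).comp₂ (x := (z, csqrt (1 - z))) aX aY) ?_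
      (hd0 z h1 h2)
    have ao : AnalyticAt ℂ (fun v : ℂ × ℂ => w.oC (xp * v.1)) (z, csqrt (1 - z)) :=
      (analyticAt_oC (w := w) hx2 hx3).comp_of_eq aX rfl
    exact (analyticAt_const.mul ao).add (aS.mul (analyticAt_const.sub
      (analyticAt_const.fun_div aX hX)))
  · intro z hz
    have h1 : 1 / xp < ‖z‖ := by rw [hz, div_lt_iff₀ hxp0]; linarith
    have h2 : ‖z‖ ≤ 1 := by linarith
    obtain ⟨h3, h4⟩ := hloc z h1 h2
    have hX := X_ne_zero (w.xr2_le_one.trans_lt h3)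
    rw [tsum_rowCoeff hxp0 r1 r5 hz.le]
    have hb := w.boundary_identity (X := xp * z) h3 (by rw [norm_X hxp0, hz]; exact r5)
    rw [hK1 _ _ hX (csqrt_sq _), ← hS] at hb
    have hd1 := hd0 z h1 h2
    have hz1 : csqrt (1 - z) ≠ 0 := csqrt_ne_zero fun e => by
      have : z = 1 := by linear_combination -e
      rw [this] at hz; simp at hz; linarith
    simp only
    rw [div_div, div_eq_iff (mul_ne_zero hd1 hz1)]
    simp only [hd]
    linear_combination hb

end Regular

end QuarterWalk

namespace QuarterWalk

namespace Regular

variable {w : QuarterWalk}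
variable {C xp xm : ℝ}

/-- The limit of the difference quotients of `K1` along the kernel curve at its zero. -/
theorem tendsto_K1_div (h : w.Regular C xp xm) (hx : xp < w.xr3) (he : w.eta xp ≤ w.ys) :
    Tendsto (fun x => w.K1 x (w.y0 x) / (x - xp)) (𝓝[≠] xp)
      (𝓝 ((xp - 1) * (C * (xp - xm)) / (xp ^ 2 * (w.l2 * (w.y1 xp - w.y0 xp))))) := by
  have hxp := h.one_lt
  have hxp0 : 0 < xp := by linarith
  have hl2 := w.l2_pos
  have hx2 : w.xr2 < xp := w.xr2_le_one.trans_lt hxp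
  have hy0 := w.y0_lt_ys hx2 hx
  have hy1 := w.ys_lt_y1 hx2 hx
  have heq := h.eta_eq_y0 he
  have c1 : ContinuousAt w.y1 xp := by
    have e : w.y1 = fun x => 2 * w.ys * w.wv x - w.y0 x := by
      ext x; linarith [w.y0_add_y1 x]
    have := w.continuousAt_y0 hxp0.ne'
    rw [e]
    unfold wv
    fun_prop (disch := exact hxp0.ne')
  have c2 : ContinuousAt (fun x => w.K1 x (w.y1 x)) xp := by
    simp only [K1]
    fun_prop (disch := exact hxp0.ne')
  have e2 : w.K1 xp (w.y1 xp) = w.l2 * (w.y1 xp - w.y0 xp) := by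
    rw [w.K1_eq_eta _ hxp0.ne', heq]
  have hne : w.K1 xp (w.y1 xp) ≠ 0 := by
    rw [e2]; exact (mul_pos hl2 (by linarith)).ne'
  -- The product of K1 over both roots of the kernel is the resultant, which has an explicit simple
  -- zero at xp; dividing by the factor K1(x, y1 x), nonzero at xp, leaves the slope on the lower
  -- branch.
  have c3 : ContinuousAt (fun x => (x - 1) * (C * (x - xm)) / (x ^ 2 * w.K1 x (w.y1 x))) xp := by
    refine ContinuousAt.div (by fun_prop) (by fun_prop) ?_
    exact mul_ne_zero (pow_ne_zero _ hxp0.ne') hne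
  have lim := c3.tendsto
  simp only [e2] at lim
  refine (lim.mono_left nhdsWithin_le_nhds).congr' ?_
  have ev : ∀ᶠ x in 𝓝[≠] xp, 1 < x ∧ w.l1 * x < w.M1 ∧ x < w.xr3 ∧ w.K1 x (w.y1 x) ≠ 0 := by
    refine eventually_nhdsWithin_of_eventually_nhds ?_
    refine (lt_mem_nhds hxp).and (((?_ : ∀ᶠ x in 𝓝 xp, w.l1 * x < w.M1)).and
      ((gt_mem_nhds hx).and (c2.eventually_ne hne)))
    exact (show ContinuousAt (fun x => w.l1 * x) xp by fun_prop).eventually (gt_mem_nhds h.lt_M1)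
  filter_upwards [ev, self_mem_nhdsWithin] with x ⟨h1, hM, h3, hK⟩ hxx
  have hx0 : x ≠ 0 := by linarith
  have hxx' : x - xp ≠ 0 := sub_ne_zero.2 hxx
  have heta := w.one_lt_eta h1 hM
  have hx2' : w.xr2 ≤ x := w.xr2_le_one.trans h1.le
  have hKe := w.K_eta hx0 (by linarith)
  rw [w.K_eq_roots hx2' h3.le (by linarith), h.res_eq, div_mul_eq_mul_div,
    div_eq_div_iff (by linarith) (mul_ne_zero (mul_ne_zero (pow_ne_zero _ hx0) hl2.ne')
      (by linarith))] at hKe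
  have hprod : w.K1 x (w.y0 x) * w.K1 x (w.y1 x) * x ^ 2 = (x - 1) * (C * ((x - xp) * (x - xm))) := by
    rw [w.K1_eq_eta _ hx0, w.K1_eq_eta _ hx0]
    apply mul_right_cancel₀ (show w.eta x ≠ 0 by linarith)
    linear_combination hKe
  rw [div_eq_div_iff (mul_ne_zero (pow_ne_zero _ hx0) hK) hxx']
  linear_combination -hprod

/-- Coefficient asymptotics when `K1` vanishes before the branch point. -/
theorem tendsto_row_pole (h : w.Regular C xp xm) (hx : xp < w.xr3) (he : w.eta xp ≤ w.ys) :
    Tendsto (fun m : ℕ => w.u m 0 * xp ^ m) atTop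
      (𝓝 (w.N xp (w.y0 xp) * (xp * (w.l2 * (w.y1 xp - w.y0 xp))) / (C * (xp - 1) * (xp - xm)))) := by
  have hxp := h.one_lt
  have hxp0 : 0 < xp := by linarith
  have hxpC : (xp : ℂ) ≠ 0 := by exact_mod_cast hxp0.ne'
  have hx2' : w.xr2 < xp := w.xr2_le_one.trans_lt hxp
  obtain ⟨ρ, ρ', r1, r2, r3, r4⟩ := w.exists_radii h.l1_lt h.one_lt
  have hρ0 : 0 < ρ := lt_trans (by positivity) r1
  rw [div_lt_iff₀ hxp0, mul_comm] at r1
  have r5 : xp * ρ < w.p / w.l1 := lt_trans (by gcongr) r4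
  obtain ⟨R, hR, hs⟩ := w.exists_radius h.l1_lt
  set Y : ℂ → ℂ := fun z => w.Yb (xp * z) (csqrt (1 - xp * z / w.xr3)) with hY
  set H : ℂ → ℂ := fun z => w.K1 (xp * z) (Y z) with hH
  have hloc : ∀ z : ℂ, 1 / xp < ‖z‖ → ‖z‖ ≤ 1 → 1 < ‖(xp * z : ℂ)‖ ∧ ‖(xp * z : ℂ)‖ ≤ xp := by
    intro z h1 h2
    rw [div_lt_iff₀ hxp0] at h1
    rw [norm_X hxp0]
    exact ⟨by linarith, by nlinarith⟩
  have hreal : ∀ x : ℝ, w.xr2 < x → x ≤ w.xr3 → H ((x / xp : ℝ) : ℂ) = (w.K1 x (w.y0 x) : ℝ) := by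
    intro x h2 h3
    have e : (xp : ℂ) * ((x / xp : ℝ) : ℂ) = x := by push_cast; field_simp
    simp only [hH, hY]
    rw [e, w.Yb_ofReal h2 h3, K1_ofReal]
  have hone : ((xp / xp : ℝ) : ℂ) = 1 := by rw [div_self hxp0.ne']; simp
  have hH1 : H 1 = 0 := by
    have := hreal xp hx2' hx.le
    rw [hone, ← h.eta_eq_y0 he, w.K1_eq_eta _ hxp0.ne'] at this
    rw [this]; simp
  have hYan : ∀ z : ℂ, 1 / xp < ‖z‖ → ‖z‖ ≤ 1 → AnalyticAt ℂ Y z := by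
    intro z h1 h2
    obtain ⟨h3, h4⟩ := hloc z h1 h2
    have hx2 := w.xr2_le_one.trans_lt h3
    have hx3 := h4.trans h.le_xr3
    have aX : AnalyticAt ℂ (fun z : ℂ => (xp : ℂ) * z) z := analyticAt_const.mul analyticAt_id
    have aS : AnalyticAt ℂ (fun z : ℂ => csqrt (1 - xp * z / w.xr3)) z := by
      refine (analyticAt_csqrt (w := 1 - xp * z / w.xr3) (Or.inl ?_)).comp_of_eq
        (g := csqrt) (f := fun z : ℂ => 1 - xp * z / w.xr3)
        (analyticAt_const.sub (aX.div_const)) rfl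
      have : (xp * z / w.xr3 : ℂ).re < 1 := by
        refine (Complex.re_le_norm _).trans_lt ?_
        rw [norm_div, Complex.norm_real, Real.norm_of_nonneg w.xr3_pos.le, div_lt_one w.xr3_pos]
        exact h4.trans_lt hx
      simpa using this
    exact (analyticAt_Yb (w := w) hx2 hx3).comp₂ aX aS
  have hHan : ∀ z : ℂ, 1 / xp < ‖z‖ → ‖z‖ ≤ 1 → AnalyticAt ℂ H z := by
    intro z h1 h2
    obtain ⟨h3, h4⟩ := hloc z h1 h2
    have hX := X_ne_zero (w.xr2_le_one.trans_lt h3)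
    exact (w.analyticAt_K1 hX).comp₂ (analyticAt_const.mul analyticAt_id) (hYan z h1 h2)
  have hDan : ∀ z : ℂ, 1 / xp < ‖z‖ → ‖z‖ ≤ 1 → AnalyticAt ℂ (dslope H 1) z := by
    intro z h1 h2
    have hopen := (hHan z h1 h2)
    by_cases hz : z = 1
    · subst hz
      obtain ⟨P, hP⟩ := hopen
      exact ⟨_, hP.has_fpower_series_dslope_fslope⟩
    · have : AnalyticAt ℂ (fun y => (H y - H 1) / (y - 1)) z :=
        (hopen.sub analyticAt_const).div (analyticAt_id.sub analyticAt_const) (sub_ne_zero.2 hz)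
      refine this.congr ?_
      filter_upwards [isOpen_ne.mem_nhds hz] with y hy
      rw [dslope_of_ne _ hy, slope_def_field]
  have hone1 : 1 / xp < ‖(1 : ℂ)‖ := by rw [norm_one, div_lt_one hxp0]; exact hxp
  have hy0 := w.y0_lt_ys hx2' hx
  have hy1 := w.ys_lt_y1 hx2' hx
  set q := (xp - 1) * (C * (xp - xm)) / (xp ^ 2 * (w.l2 * (w.y1 xp - w.y0 xp))) with hq
  have hq0 : 0 < q := by
    have hl2 := w.l2_pos
    refine div_pos (mul_pos (by linarith) (mul_pos h.C_pos (by linarith [h.xm_neg])))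
      (mul_pos (by positivity) (mul_pos hl2 (by linarith)))
  -- H is complex analytic at 1, so its derivative there may be computed along the real axis, where
  -- H is the real function K1(x, y0 x).
  have hD1 : dslope H 1 1 = ((q * xp : ℝ) : ℂ) := by
    have c := (hDan 1 hone1 (by simp)).continuousAt
    have g : Tendsto (fun x : ℝ => ((x / xp : ℝ) : ℂ)) (𝓝[≠] xp) (𝓝 1) := by
      have : ContinuousAt (fun x : ℝ => ((x / xp : ℝ) : ℂ)) xp := by fun_prop
      have := this.tendsto
      rw [hone] at this
      exact this.mono_left nhdsWithin_le_nhds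
    have lim1 := c.tendsto.comp g
    have lim2 := (tendsto_ofReal_iff.2 ((h.tendsto_K1_div hx he).mul_const xp))
    rw [← hq] at lim2
    refine tendsto_nhds_unique (lim1.congr' ?_) lim2
    have ev : ∀ᶠ x in 𝓝[≠] xp, w.xr2 < x ∧ x < w.xr3 :=
      eventually_nhdsWithin_of_eventually_nhds ((lt_mem_nhds hx2').and (gt_mem_nhds hx))
    filter_upwards [ev, self_mem_nhdsWithin] with x ⟨h2, h3⟩ hne
    have hne' : x - xp ≠ 0 := sub_ne_zero.2 hne
    have hne1 : ((x / xp : ℝ) : ℂ) ≠ 1 := by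
      rw [← hone]; exact_mod_cast fun e => hne (by field_simp at e; exact e)
    rw [Function.comp_apply, dslope_of_ne _ hne1, slope_def_field, hH1, sub_zero, hreal x h2 h3.le,
      ← hone, ← Complex.ofReal_sub, ← Complex.ofReal_div]
    congr 1
    have : x / xp - xp / xp = (x - xp) / xp := by ring
    rw [this]
    field_simp
  have hD0 : ∀ z : ℂ, 1 / xp < ‖z‖ → ‖z‖ ≤ 1 → dslope H 1 z ≠ 0 := by
    intro z h1 h2
    by_cases hz : z = 1
    · rw [hz, hD1]; exact_mod_cast (mul_pos hq0 hxp0).ne'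
    · obtain ⟨h3, h4⟩ := hloc z h1 h2
      rw [dslope_of_ne _ hz, slope_def_field, hH1, sub_zero]
      refine div_ne_zero (h.K1_Yb_ne_zero he h3 h4 fun e => hz ?_) (sub_ne_zero.2 hz)
      apply mul_left_cancel₀ hxpC; rw [e, mul_one]
  -- H has a simple zero at 1 and no other zero on the closed annulus, so P1 = -N/H is N divided by
  -- the zero-free function `dslope H 1`, over 1 - z.
  have key := tendsto_coeff_of_simple_pole (a := fun m => (w.rowCoeff xp m : ℂ))
    (ρ := ρ) (r0 := 1 / xp) (by positivity) (by rw [div_lt_iff₀ hxp0]; linarith) (by linarith)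
    (summable_rowCoeff hxp0 r1 r5) (Ψ := fun z => w.N (xp * z) (Y z) / dslope H 1 z) ?_ ?_
  · have hY1 : Y 1 = (w.y0 xp : ℝ) := by
      simp only [hY, mul_one]; exact w.Yb_ofReal hx2' hx.le
    have e : w.N (xp * (1 : ℂ)) (Y 1) / dslope H 1 1 = ((w.N xp (w.y0 xp) / (q * xp) : ℝ) : ℂ) := by
      rw [hD1, hY1, mul_one, N_ofReal]; push_cast; rfl
    rw [e] at key
    have e2 : w.N xp (w.y0 xp) / (q * xp) = w.N xp (w.y0 xp) * (xp * (w.l2 * (w.y1 xp - w.y0 xp)))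
        / (C * (xp - 1) * (xp - xm)) := by
      have h1 : xp - 1 ≠ 0 := by linarith
      have h2 : xp - xm ≠ 0 := by linarith [h.xm_neg]
      have h3 : w.y1 xp - w.y0 xp ≠ 0 := by linarith
      have h4 := h.C_pos.ne'
      have h5 := w.l2_pos.ne'
      rw [hq]
      field_simp
    rw [e2] at key
    refine (tendsto_real_of_complex key).congr' ?_
    filter_upwards [eventually_ne_atTop 0] with m hm
    rw [rowCoeff, if_neg hm]
  · intro z h1 h2
    obtain ⟨h3, h4⟩ := hloc z h1 h2
    have hx2 := w.xr2_le_one.trans_lt h3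
    have hx3 := h4.trans h.le_xr3
    have hX := X_ne_zero hx2
    have hle := norm_Yb_le_ys (w := w) hx2 hx3
    have hY0 := Yb_ne_zero (w := w) hX (csqrt_sq _)
    have aX : AnalyticAt ℂ (fun z : ℂ => (xp : ℂ) * z) z := analyticAt_const.mul analyticAt_id
    have aN : AnalyticAt ℂ (fun z : ℂ => w.N (xp * z) (Y z)) z :=
      AnalyticAt.comp₂ (h := fun v : ℂ × ℂ => w.N v.1 v.2) (g := Y)
        (w.analyticAt_N hs hY0 (hle.trans_lt hR)) aX (hYan z h1 h2)
    exact aN.fun_div (hDan z h1 h2) (hD0 z h1 h2)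
  · intro z hz
    have h1 : 1 / xp < ‖z‖ := by rw [hz, div_lt_iff₀ hxp0]; linarith
    have h2 : ‖z‖ ≤ 1 := by linarith
    obtain ⟨h3, h4⟩ := hloc z h1 h2
    rw [tsum_rowCoeff hxp0 r1 r5 hz.le]
    have hb := w.boundary_identity (X := xp * z) h3 (by rw [norm_X hxp0, hz]; exact r5)
    have hz1 : z ≠ 1 := by rintro rfl; simp at hz; linarith
    have hz1' : z - 1 ≠ 0 := sub_ne_zero.2 hz1
    have hz1'' : 1 - z ≠ 0 := sub_ne_zero.2 hz1.symm
    have hD := hD0 z h1 h2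
    have hDe : dslope H 1 z * (z - 1) = H z := by
      rw [dslope_of_ne _ hz1, slope_def_field, hH1, sub_zero, div_mul_cancel₀ _ hz1']
    rw [div_div, div_eq_iff (mul_ne_zero hD hz1'')]
    simp only [hH, hY] at hDe ⊢
    linear_combination hb + w.P1 (xp * z : ℂ) * hDe

end Regular

end QuarterWalk

namespace QuarterWalk

variable (w : QuarterWalk)

theorem exists_hasDerivAt_P2 {R : ℝ} (hs : Summable fun n => w.u 0 (n + 1) * R ^ (n + 1)) {y : ℝ}
    (hy : |y| < R) : ∃ d, HasDerivAt (fun y : ℝ => w.P2 y) d y := by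
  have h := (w.analyticAt_P2 hs (Y := (y : ℂ)) (by simpa using hy)).differentiableAt.hasDerivAt
  refine ⟨_, h.real_of_complex.congr_of_eventuallyEq (Eventually.of_forall fun y => ?_)⟩
  simp only [P2_ofReal, Complex.ofReal_re]

theorem exists_hasDerivAt_N {R : ℝ} (hs : Summable fun n => w.u 0 (n + 1) * R ^ (n + 1)) (x : ℝ)
    {y : ℝ} (hy0 : 0 < y) (hy : y < R) : ∃ d, HasDerivAt (fun y : ℝ => w.N x y) d y := by
  obtain ⟨d, hd⟩ := w.exists_hasDerivAt_P2 hs (y := y) (by rwa [abs_of_pos hy0])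
  have : DifferentiableAt ℝ (fun y : ℝ => w.P2 y) y := hd.differentiableAt
  have h : DifferentiableAt ℝ (fun y : ℝ => w.N x y) y := by
    simp only [N, K2, K0]
    fun_prop (disch := exact hy0.ne')
  exact ⟨_, h.hasDerivAt⟩

theorem hasDerivAt_K1 (x y : ℝ) : HasDerivAt (fun y : ℝ => w.K1 x y) w.l2 y := by
  have := (((hasDerivAt_id y).sub_const 1).const_mul w.l2).const_add (w.l1 * (x - 1))
    |>.add_const (w.M1 * (x⁻¹ - 1))
  simpa [K1] using this

/-- The real function whose derivative at `ys` governs the square root singularity. -/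
def ratio (y : ℝ) : ℝ := -w.N w.xr3 y / w.K1 w.xr3 y

/-- At the branch point the functional equation holds in the limit. -/
theorem boundary_eq_xr3 (hlp : w.l1 < w.p)
    (hP : Summable fun m => w.u (m + 1) 0 * w.xr3 ^ (m + 1)) :
    w.K1 w.xr3 w.ys * w.P1 w.xr3 + w.N w.xr3 w.ys = 0 := by
  obtain ⟨R, hR, hs⟩ := w.exists_radius hlp
  have h3 := w.xr3_pos
  -- Summability at `xr3` gives uniform convergence on [0, xr3]. Hence the identity on the curve
  -- passes to the limit, although both roots collide there.
  have cP : ContinuousWithinAt (fun x : ℝ => w.P1 x) (Set.Icc 0 w.xr3) w.xr3 := by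
    refine (continuousOn_tsum (fun m => ?_) hP fun m x hx => ?_) _ ⟨h3.le, le_rfl⟩
    · simp only [smul_eq_mul]; fun_prop
    · rw [smul_eq_mul, Real.norm_of_nonneg (mul_nonneg (w.u_nonneg _ _) (pow_nonneg hx.1 _))]
      exact mul_le_mul_of_nonneg_left (pow_le_pow_left₀ hx.1 hx.2 _) (w.u_nonneg _ _)
  have cy : ContinuousAt w.y0 w.xr3 := w.continuousAt_y0 h3.ne'
  obtain ⟨d, hd⟩ := w.exists_hasDerivAt_P2 hs (y := w.ys) (by rwa [abs_of_pos w.ys_pos])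
  have cP2 : ContinuousAt (fun x => w.P2 (w.y0 x)) w.xr3 :=
    ContinuousAt.comp_of_eq (g := fun y : ℝ => w.P2 y) hd.continuousAt cy w.y0_xr3
  have hy0 : w.y0 w.xr3 ≠ 0 := by rw [y0_xr3]; exact w.ys_pos.ne'
  have cN : ContinuousAt (fun x => w.N x (w.y0 x)) w.xr3 := by
    simp only [N, K2, K0]
    fun_prop (disch := assumption)
  have cK : ContinuousAt (fun x => w.K1 x (w.y0 x)) w.xr3 := by
    simp only [K1]
    fun_prop (disch := exact h3.ne')
  have lim := (cK.continuousWithinAt.mul cP).add cN.continuousWithinAt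
  have hmem : Set.Icc 0 w.xr3 ∈ 𝓝[<] w.xr3 :=
    mem_of_superset (Ioo_mem_nhdsLT h3) Set.Ioo_subset_Icc_self
  have lim2 : Tendsto (fun x => w.K1 x (w.y0 x) * w.P1 x + w.N x (w.y0 x)) (𝓝[<] w.xr3)
      (𝓝 (w.K1 w.xr3 w.ys * w.P1 w.xr3 + w.N w.xr3 w.ys)) := by
    have e : w.K1 w.xr3 w.ys * w.P1 w.xr3 + w.N w.xr3 w.ys
        = w.K1 w.xr3 (w.y0 w.xr3) * w.P1 w.xr3 + w.N w.xr3 (w.y0 w.xr3) := by rw [y0_xr3]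
    rw [e]
    exact lim.tendsto.mono_left (nhdsWithin_le_iff.2 hmem)
  refine tendsto_nhds_unique lim2 ((tendsto_const_nhds (x := (0 : ℝ))).congr' ?_)
  filter_upwards [Ioo_mem_nhdsLT (w.xr2_lt_xr3 hlp)] with x hx
  exact (w.curve_eq hlp hx.1 hx.2 (w.summable_axis1_mono (w.xr2_pos.trans hx.1).le hx.2.le hP)).symm

/-- Strict monotonicity of `ratio` at the branch point. -/
theorem ratio_deriv_pos (hlp : w.l1 < w.p)
    (hP : Summable fun m => w.u (m + 1) 0 * w.xr3 ^ (m + 1)) (hK : w.K1 w.xr3 w.ys < 0) :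
    0 < deriv w.ratio w.ys := by
  obtain ⟨R, hR, hs⟩ := w.exists_radius hlp
  obtain ⟨d, hd⟩ := w.exists_hasDerivAt_N hs w.xr3 w.ys_pos hR
  have hK1 := w.hasDerivAt_K1 w.xr3 w.ys
  have hT : HasDerivAt w.ratio _ w.ys := hd.neg.fun_div hK1 hK.ne
  have hF := (hK1.mul_const (w.P1 w.xr3)).add hd
  have hF0 := w.boundary_eq_xr3 hlp hP
  obtain ⟨c, hc, hle⟩ := w.boundary_le hlp hP
  -- F(y) = K1·P1 + N vanishes at ys and is at most -c·(ys - y) to the left of it, so its left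
  -- difference quotients are at least c.
  have hFc : c ≤ w.l2 * w.P1 w.xr3 + d := by
    have lim := hF.tendsto_slope.mono_left (nhdsWithin_mono w.ys
      (show Set.Iio w.ys ⊆ {w.ys}ᶜ from fun x hx => ne_of_lt hx))
    refine ge_of_tendsto lim ?_
    filter_upwards [Ioo_mem_nhdsLT w.ys_pos] with y hy
    rw [slope_def_field]
    simp only [Pi.add_apply]
    rw [hF0, sub_zero, le_div_iff_of_neg (by linarith [hy.2])]
    linarith [hle y hy.1 hy.2]
  rw [hT.deriv]
  refine div_pos ?_ (by have := hK.ne; positivity)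
  -- Substituting N = -K1·P1 at ys, the numerator of the quotient rule becomes -K1 times F'(ys).
  have : (-d * w.K1 w.xr3 w.ys - -w.N w.xr3 w.ys * w.l2)
      = (-w.K1 w.xr3 w.ys) * (w.l2 * w.P1 w.xr3 + d) := by linear_combination w.l2 * hF0
  simp only [Pi.neg_apply]
  rw [this]
  exact mul_pos (by linarith) (by linarith)

namespace Regular

variable {w}
variable {C xp xm : ℝ}

/-- Coefficient asymptotics when `K1` has no zero on the kernel curve up to the branch point. -/
theorem tendsto_row_branch (h : w.Regular C xp xm) (he : w.ys < w.eta xp) :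
    Tendsto (fun m : ℕ => (m : ℝ) ^ (3 / 2 : ℝ) * (w.u m 0 * w.xr3 ^ m)) atTop
      (𝓝 (w.ys * (√(w.l1 * w.xr3 * (1 - w.xr2 / w.xr3) / (2 * w.l2 * w.ys)) * √2)
        * deriv w.ratio w.ys / (2 * √Real.pi))) := by
  obtain ⟨o, ho, hoC, hoe⟩ := h.oC_xr3_pos
  rw [← hoe]
  set xp := w.xr3 with hxp3
  have hxp : 1 < xp := w.one_lt_xr3 h.l1_lt
  have hxp0 : 0 < xp := by linarith
  have hxpC : (xp : ℂ) ≠ 0 := by exact_mod_cast hxp0.ne'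
  obtain ⟨ρ, ρ', r1, r2, r3, r4⟩ := w.exists_radii h.l1_lt hxp
  have hρ0 : 0 < ρ := lt_trans (by positivity) r1
  rw [div_lt_iff₀ hxp0, mul_comm] at r1
  have r5 : 1 < xp * ρ' := r1.trans (by gcongr)
  obtain ⟨R, hR, hs⟩ := w.exists_radius h.l1_lt
  have hloc : ∀ z : ℂ, 1 / xp < ‖z‖ → ‖z‖ ≤ 1 → 1 < ‖(xp * z : ℂ)‖ ∧ ‖(xp * z : ℂ)‖ ≤ xp := by
    intro z h1 h2
    rw [div_lt_iff₀ hxp0] at h1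
    rw [norm_X hxp0]
    exact ⟨by linarith, by nlinarith⟩
  have hS : ∀ z : ℂ, csqrt (1 - z) = csqrt (1 - (xp * z) / xp) := by
    intro z; rw [mul_div_cancel_left₀ _ hxpC]
  have hK0 : ∀ z : ℂ, 1 / xp < ‖z‖ → ‖z‖ ≤ 1 →
      w.K1 (xp * z) (w.Yb (xp * z) (csqrt (1 - z))) ≠ 0 := by
    intro z h1 h2
    obtain ⟨h3, h4⟩ := hloc z h1 h2
    rw [hS]
    exact w.K1_ne_zero (norm_Yb_le_y0 (w.xr2_le_one.trans_lt h3) h4) (h.K1_y0_neg' he h3 h4)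
  have han : ∀ z : ℂ, 1 / xp < ‖z‖ → ‖z‖ ≤ 1 → AnalyticAt ℂ
      (fun v : ℂ × ℂ => -w.N (xp * v.1) (w.Yb (xp * v.1) v.2) / w.K1 (xp * v.1) (w.Yb (xp * v.1) v.2))
      (z, csqrt (1 - z)) := by
    intro z h1 h2
    obtain ⟨h3, h4⟩ := hloc z h1 h2
    have hx2 := w.xr2_le_one.trans_lt h3
    have hX := X_ne_zero hx2
    have aX : AnalyticAt ℂ (fun v : ℂ × ℂ => (xp : ℂ) * v.1) (z, csqrt (1 - z)) :=
      analyticAt_const.mul analyticAt_fst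
    have aS : AnalyticAt ℂ (fun v : ℂ × ℂ => v.2) (z, csqrt (1 - z)) := analyticAt_snd
    have aY : AnalyticAt ℂ (fun v : ℂ × ℂ => w.Yb (xp * v.1) v.2) (z, csqrt (1 - z)) :=
      (analyticAt_Yb (w := w) hx2 h4).comp₂ (x := (z, csqrt (1 - z))) aX aS
    have hle := norm_Yb_le_ys (w := w) hx2 h4
    have hY0 := Yb_ne_zero (w := w) hX (csqrt_sq _)
    rw [← hS] at hle hY0
    exact AnalyticAt.fun_div ((w.analyticAt_N hs hY0 (hle.trans_lt hR)).comp₂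
      (x := (z, csqrt (1 - z))) aX aY).fun_neg
      ((w.analyticAt_K1 hX).comp₂ (x := (z, csqrt (1 - z))) aX aY) (hK0 z h1 h2)
  have key := tendsto_coeff_of_sqrt_singularity (a := fun m => (w.rowCoeff xp m : ℂ))
    (ρ := ρ) (ρ' := ρ') (r0 := 1 / xp) (by positivity) (by rw [div_lt_iff₀ hxp0]; linarith)
    (by linarith) r2 (summable_rowCoeff hxp0 r5 r4) han ?_
  · have hone1 : 1 / xp < ‖(1 : ℂ)‖ := by rw [norm_one, div_lt_one hxp0]; exact hxp
    have a1 := han 1 hone1 (by simp)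
    rw [sub_self, csqrt_zero] at a1
    have hK : w.K1 xp w.ys ≠ 0 := by
      have := h.K1_y0_neg' he hxp le_rfl
      rw [y0_xr3] at this
      exact this.ne
    have hTc : HasDerivAt (fun y : ℂ => -w.N (xp : ℂ) y / w.K1 (xp : ℂ) y)
        ((deriv w.ratio w.ys : ℝ) : ℂ) (w.ys : ℂ) := by
      have hysC : (w.ys : ℂ) ≠ 0 := by exact_mod_cast w.ys_pos.ne'
      have hc : AnalyticAt ℂ (fun y : ℂ => (xp : ℂ)) (w.ys : ℂ) := analyticAt_const
      have hN : AnalyticAt ℂ (fun y : ℂ => w.N (xp : ℂ) y) (w.ys : ℂ) :=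
        (w.analyticAt_N hs hysC (by
          rw [Complex.norm_real, Real.norm_of_nonneg w.ys_pos.le]; exact hR)).comp₂ (x := (w.ys : ℂ)) hc analyticAt_id
      have hK1 : AnalyticAt ℂ (fun y : ℂ => w.K1 (xp : ℂ) y) (w.ys : ℂ) :=
        (w.analyticAt_K1 hxpC).comp₂ (x := (w.ys : ℂ)) hc analyticAt_id
      have hT := (hN.fun_neg.fun_div hK1 (by rw [K1_ofReal]; exact_mod_cast hK)).differentiableAt.hasDerivAt
      have e : ∀ y : ℝ, -w.N (xp : ℂ) (y : ℂ) / w.K1 (xp : ℂ) (y : ℂ) = (w.ratio y : ℝ) := by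
        intro y; rw [N_ofReal, K1_ofReal, ratio]; push_cast; rfl
      have hr := hT.real_of_complex
      simp only [e, Complex.ofReal_re] at hr
      have h1 := hT.comp_ofReal
      simp only [e] at h1
      have h2 : HasDerivAt (fun y : ℝ => (w.ratio y : ℂ)) ((deriv w.ratio w.ys : ℝ) : ℂ) w.ys :=
        hr.differentiableAt.hasDerivAt.ofReal_comp
      rw [h1.unique h2] at hT
      exact hT
    -- Only the partial derivative in S enters the transfer theorem, with X frozen at the branch
    -- point; the chain rule gives ratio'(ys)·(-ys·o).
    have hYd : HasDerivAt (fun S : ℂ => w.Yb (xp : ℂ) S) (-(w.ys * o : ℝ) : ℂ) 0 := by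
      have := (((hasDerivAt_id (0 : ℂ)).mul_const (w.oC xp)).const_sub (w.wvC xp)).const_mul
        (w.ys : ℂ)
      simp only [hoC, one_mul] at this
      refine HasDerivAt.congr_deriv (this.congr_of_eventuallyEq (Eventually.of_forall fun S => ?_)) ?_
      · simp only [Yb, hoC, id]
      · push_cast; ring
    have hcomp : HasDerivAt (fun S : ℂ => -w.N (xp : ℂ) (w.Yb xp S) / w.K1 (xp : ℂ) (w.Yb xp S))
        (((deriv w.ratio w.ys : ℝ) : ℂ) * (-(w.ys * o : ℝ) : ℂ)) 0 := by
      refine HasDerivAt.comp (h₂ := fun y : ℂ => -w.N (xp : ℂ) y / w.K1 (xp : ℂ) y) 0 ?_ hYd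
      rw [hxp3, Yb_xr3, ← hxp3]
      exact hTc
    have hfd := a1.differentiableAt.hasFDerivAt.comp_hasDerivAt (0 : ℂ)
      ((hasDerivAt_const (0 : ℂ) (1 : ℂ)).prodMk (hasDerivAt_id (0 : ℂ)))
    have hun := hfd.unique (f₁' := ((deriv w.ratio w.ys : ℝ) : ℂ) * (-(w.ys * o : ℝ) : ℂ)) (by
      simpa only [Function.comp_def, mul_one] using hcomp)
    rw [hun] at key
    have e2 : -(((deriv w.ratio w.ys : ℝ) : ℂ) * (-(w.ys * o : ℝ) : ℂ)) / (2 * (√Real.pi : ℝ))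
        = ((w.ys * o * deriv w.ratio w.ys / (2 * √Real.pi) : ℝ) : ℂ) := by
      push_cast; ring
    rw [e2] at key
    refine (tendsto_real_of_complex (f := fun m : ℕ => (m : ℝ) ^ (3 / 2 : ℝ) * w.rowCoeff xp m)
      (by simpa only [Complex.ofReal_mul] using key)).congr' ?_
    filter_upwards [eventually_ne_atTop 0] with m hm
    rw [rowCoeff, if_neg hm]
  · intro z h1 hzρ hz1
    obtain ⟨h3, h4⟩ := hloc z h1 hz1.le
    rw [tsum_rowCoeff hxp0 r5 r4 hzρ.le]
    have hb := w.boundary_identity (X := xp * z) h3 (by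
      rw [norm_X hxp0]; exact lt_trans (by gcongr) r4)
    rw [← hxp3, ← hS] at hb
    rw [div_eq_iff (hK0 z h1 hz1.le)]
    linear_combination -hb

end Regular

end QuarterWalk

/-! ### Shifts of weighted sequences -/

theorem tendsto_succ_rpow_div (k : ℝ) :
    Tendsto (fun m : ℕ => ((m + 1 : ℕ) : ℝ) ^ k / (m : ℝ) ^ k) atTop (𝓝 1) := by
  have h1 : Tendsto (fun m : ℕ => 1 + 1 / (m : ℝ)) atTop (𝓝 1) := by
    simpa using tendsto_one_div_atTop_nhds_zero_nat.const_add (1 : ℝ)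
  have h2 := ((Real.continuousAt_rpow_const 1 k (Or.inl one_ne_zero)).tendsto).comp h1
  rw [Real.one_rpow] at h2
  refine h2.congr' ?_
  filter_upwards [eventually_gt_atTop 0] with m hm
  have hm' : (0 : ℝ) < m := by exact_mod_cast hm
  rw [Function.comp_apply, ← Real.div_rpow (by positivity) hm'.le]
  congr 1
  push_cast; field_simp

section Shift

variable {v : ℕ → ℝ} {k x L : ℝ}

theorem tendsto_weight_succ (h : Tendsto (fun m : ℕ => (m : ℝ) ^ k * (v m * x ^ m)) atTop (𝓝 L)) :
    Tendsto (fun m : ℕ => ((m + 1 : ℕ) : ℝ) ^ k * (v (m + 1) * x ^ (m + 1))) atTop (𝓝 L) :=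
  h.comp (tendsto_add_atTop_nat 1)

theorem tendsto_weight_left (hx : x ≠ 0)
    (h : Tendsto (fun m : ℕ => (m : ℝ) ^ k * (v m * x ^ m)) atTop (𝓝 L)) :
    Tendsto (fun m : ℕ => ((m + 1 : ℕ) : ℝ) ^ k * (v m * x ^ (m + 1))) atTop (𝓝 (L * x)) := by
  have := ((tendsto_succ_rpow_div k).mul h).mul_const x
  rw [one_mul] at this
  refine this.congr' ?_
  filter_upwards [eventually_gt_atTop 0] with m hm
  have : ((m : ℝ) ^ k) ≠ 0 := (Real.rpow_pos_of_pos (by exact_mod_cast hm) k).ne'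
  rw [pow_succ]
  field_simp

theorem tendsto_weight_right (hx : x ≠ 0)
    (h : Tendsto (fun m : ℕ => (m : ℝ) ^ k * (v m * x ^ m)) atTop (𝓝 L)) :
    Tendsto (fun m : ℕ => ((m + 1 : ℕ) : ℝ) ^ k * (v (m + 2) * x ^ (m + 1))) atTop (𝓝 (L / x)) := by
  have h1 := (tendsto_succ_rpow_div k).comp (tendsto_add_atTop_nat 1)
  have := ((h.comp (tendsto_add_atTop_nat 2)).div h1 one_ne_zero).div_const x
  rw [div_one] at this
  refine this.congr fun m => ?_
  have e1 : (((m + 1 : ℕ) : ℝ) ^ k) ≠ 0 := (Real.rpow_pos_of_pos (by positivity) k).ne'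
  have e2 : (((m + 2 : ℕ) : ℝ) ^ k) ≠ 0 := (Real.rpow_pos_of_pos (by positivity) k).ne'
  simp only [Pi.div_apply, Function.comp_apply]
  rw [show m + 1 + 1 = m + 2 from rfl, show x ^ (m + 2) = x ^ (m + 1) * x from pow_succ _ _]
  field_simp

theorem tendsto_of_weight_unshift
    (h : Tendsto (fun m : ℕ => ((m + 1 : ℕ) : ℝ) ^ k * (v (m + 1) * x ^ (m + 1))) atTop (𝓝 L)) :
    Tendsto (fun m : ℕ => (m : ℝ) ^ k * (v m * x ^ m)) atTop (𝓝 L) :=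
  (tendsto_add_atTop_iff_nat 1).1 h

end Shift

/-- The radius of convergence read off from the asymptotics of the coefficients. -/
theorem sSup_radius_of_tendsto {v : ℕ → ℝ} {k x L : ℝ} (hv : ∀ m, 0 ≤ v m) (hk0 : 0 ≤ k)
    (hk : k ≤ 2) (hx : 0 < x) (hL : 0 < L)
    (h : Tendsto (fun m : ℕ => (m : ℝ) ^ k * (v m * x ^ m)) atTop (𝓝 L)) :
    sSup {r : ℝ | 0 ≤ r ∧ Summable fun m : ℕ => v (m + 1) * r ^ m} = x := by
  have hlow : ∀ r, 0 ≤ r → r < x → Summable fun m : ℕ => v (m + 1) * r ^ m := by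
    intro r hr hrx
    have hgeo : Summable fun m : ℕ => (L + 1) * (r / x) ^ m :=
      (summable_geometric_of_lt_one (by positivity) ((div_lt_one hx).2 hrx)).mul_left _
    rcases hr.eq_or_lt with rfl | hr0
    · refine summable_of_ne_finset_zero (s := {0}) fun m hm => ?_
      rw [zero_pow (by simpa using hm), mul_zero]
    have hb : Summable fun m => v m * r ^ m := by
      refine Summable.of_norm_bounded_eventually_nat hgeo ?_
      filter_upwards [h.eventually (gt_mem_nhds (show L < L + 1 by linarith)),
        eventually_ge_atTop 1] with m hm hm1
      have h1 : (1 : ℝ) ≤ (m : ℝ) ^ k := Real.one_le_rpow (by exact_mod_cast hm1) hk0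
      have h2 : 0 ≤ v m * x ^ m := mul_nonneg (hv m) (by positivity)
      have h3 : v m * x ^ m ≤ L + 1 := by nlinarith
      rw [Real.norm_of_nonneg (mul_nonneg (hv m) (by positivity))]
      calc v m * r ^ m = v m * x ^ m * (r / x) ^ m := by rw [div_pow]; field_simp
        _ ≤ _ := by gcongr
    have := ((summable_nat_add_iff 1).2 hb).div_const r
    refine this.congr fun m => ?_
    rw [pow_succ]; field_simp
  have hup : ∀ r, 0 ≤ r → (Summable fun m : ℕ => v (m + 1) * r ^ m) → r ≤ x := by
    intro r hr hs
    by_contra hrx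
    push Not at hrx
    have hr0 : 0 < r := hx.trans hrx
    have h1 : Tendsto (fun m : ℕ => v m * r ^ m) atTop (𝓝 0) := by
      refine (tendsto_add_atTop_iff_nat 1).1 ?_
      have := hs.tendsto_atTop_zero.mul_const r
      rw [zero_mul] at this
      exact this.congr fun m => by rw [pow_succ]; ring
    have hq : |x / r| < 1 := by rw [abs_of_pos (by positivity), div_lt_one hr0]; exact hrx
    -- The bound k ≤ 2 replaces m^k by m², which the geometric factor (x/r)^m absorbs.
    have h2 := tendsto_pow_const_mul_const_pow_of_abs_lt_one 2 hq
    have h3 := h2.mul h1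
    rw [mul_zero] at h3
    have h4 : Tendsto (fun m : ℕ => (m : ℝ) ^ k * (v m * x ^ m)) atTop (𝓝 0) := by
      refine squeeze_zero' (Eventually.of_forall fun m => ?_) ?_ h3
      · exact mul_nonneg (Real.rpow_nonneg (Nat.cast_nonneg m) k)
          (mul_nonneg (hv m) (by positivity))
      · filter_upwards [eventually_ge_atTop 1] with m hm
        have h5 : (m : ℝ) ^ k ≤ (m : ℝ) ^ 2 := by
          rw [← Real.rpow_two]
          exact Real.rpow_le_rpow_of_exponent_le (by exact_mod_cast hm) hk
        calc (m : ℝ) ^ k * (v m * x ^ m) ≤ (m : ℝ) ^ 2 * (v m * x ^ m) :=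
              mul_le_mul_of_nonneg_right h5 (mul_nonneg (hv m) (by positivity))
          _ = _ := by rw [div_pow]; field_simp
    exact hL.ne (tendsto_nhds_unique h4 h)
  refine le_antisymm (csSup_le ⟨0, le_rfl, hlow 0 le_rfl hx⟩ fun r hr => hup r hr.1 hr.2) ?_
  refine le_of_forall_lt_imp_le_of_dense fun r hr => ?_
  rcases lt_or_ge r 0 with h0 | h0
  · exact Real.sSup_nonneg (fun y hy => hy.1) |>.trans' h0.le
  · exact le_csSup ⟨x, fun y hy => hup y hy.1 hy.2⟩ ⟨h0, hlow r h0 hr⟩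

/-- Asymptotic equivalence from the limit of the normalized sequence. -/
theorem asympEq_of_tendsto {f : ℕ → ℝ} {k x A D : ℝ} {j : ℤ} (hx : 0 < x) (hD : D ≠ 0)
    (hA : A * x ^ j = D) (h : Tendsto (fun m : ℕ => (m : ℝ) ^ k * (f m * x ^ m)) atTop (𝓝 D)) :
    RetrialRates.AsympEq f fun m => A * (m : ℝ) ^ (-k) * (1 / x) ^ ((m : ℤ) - j) := by
  have := h.div_const D
  rw [div_self hD] at this
  refine this.congr' ?_
  filter_upwards [eventually_gt_atTop 0] with m hm
  have hm' : (0 : ℝ) < m := by exact_mod_cast hm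
  have h1 : (m : ℝ) ^ k ≠ 0 := (Real.rpow_pos_of_pos hm' k).ne'
  have h2 : x ^ j ≠ 0 := zpow_ne_zero _ hx.ne'
  have h3 : A ≠ 0 := by rintro rfl; rw [zero_mul] at hA; exact hD hA.symm
  rw [Real.rpow_neg hm'.le, one_div, inv_zpow, zpow_sub₀ hx.ne', zpow_natCast, ← hA]
  field_simp

namespace QuarterWalk

variable (w : QuarterWalk)

/-- The asymptotics of the rows follow from that of the row zero. -/
theorem tendsto_rows {k x : ℝ} (hx : 0 < x) {D : ℕ → ℝ}
    (h0 : Tendsto (fun m : ℕ => (m : ℝ) ^ k * (w.u m 0 * x ^ m)) atTop (𝓝 (D 0)))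
    (h1 : w.q * D 1 = w.l2 * w.eta x * D 0)
    (h2 : ∀ n, w.q * D (n + 2) = 2 * w.l2 * w.ys * w.wv x * D (n + 1) - w.l2 * D n) (n : ℕ) :
    Tendsto (fun m : ℕ => (m : ℝ) ^ k * (w.u m n * x ^ m)) atTop (𝓝 (D n)) := by
  have hq := w.q_pos.ne'
  have hl2 := w.l2_pos.ne'
  have hys := w.ys_pos.ne'
  have hx0 := hx.ne'
  -- The recurrence in n has order two, so two consecutive rows are carried along. The balance
  -- equation is used at (m+1, n) and solved for the term in row n+1; starting from m+1 avoids the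
  -- vertical axis.
  suffices H : ∀ n, Tendsto (fun m : ℕ => (m : ℝ) ^ k * (w.u m n * x ^ m)) atTop (𝓝 (D n)) ∧
      Tendsto (fun m : ℕ => (m : ℝ) ^ k * (w.u m (n + 1) * x ^ m)) atTop (𝓝 (D (n + 1))) from
    (H n).1
  intro n
  induction n with
  | zero =>
    refine ⟨h0, tendsto_of_weight_unshift ?_⟩
    have t := (((tendsto_weight_succ h0).const_mul (w.l1 + w.l2 + w.M1)).sub
      ((tendsto_weight_right hx0 h0).const_mul w.M1)).sub
      ((tendsto_weight_left hx0 h0).const_mul w.l1) |>.div_const w.q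
    have e : ((w.l1 + w.l2 + w.M1) * D 0 - w.M1 * (D 0 / x) - w.l1 * (D 0 * x)) / w.q = D (0 + 1) := by
      have : w.l2 * w.eta x = w.l1 + w.l2 + w.M1 - w.M1 / x - w.l1 * x := by
        rw [eta]; field_simp; ring
      rw [div_eq_iff hq, mul_comm (D (0 + 1)), zero_add, h1, this]; ring
    rw [e] at t
    refine t.congr fun m => ?_
    have hb := w.balance (m + 1) 0
    simp only [Nat.add_eq_zero_iff, one_ne_zero, and_false, if_false, if_true,
      Nat.add_sub_cancel] at hb
    rw [div_eq_iff hq, show m + 1 + 1 = m + 2 from rfl] at *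
    linear_combination ((m + 1 : ℕ) : ℝ) ^ k * x ^ (m + 1) * hb
  | succ n ih =>
    obtain ⟨ih0, ih1⟩ := ih
    refine ⟨ih1, tendsto_of_weight_unshift ?_⟩
    have t := ((((tendsto_weight_succ ih1).const_mul (w.l1 + w.l2 + w.p + w.q)).sub
      ((tendsto_weight_right hx0 ih1).const_mul w.p)).sub
      ((tendsto_weight_left hx0 ih1).const_mul w.l1)).sub
      ((tendsto_weight_succ ih0).const_mul w.l2) |>.div_const w.q
    have e : ((w.l1 + w.l2 + w.p + w.q) * D (n + 1) - w.p * (D (n + 1) / x) - w.l1 * (D (n + 1) * x)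
        - w.l2 * D n) / w.q = D (n + 1 + 1) := by
      have : 2 * w.l2 * w.ys * w.wv x = w.l1 + w.l2 + w.p + w.q - w.p / x - w.l1 * x := by
        rw [wv]; field_simp; ring
      rw [div_eq_iff hq, mul_comm (D (n + 1 + 1)), h2, this]; ring
    rw [e] at t
    refine t.congr fun m => ?_
    have hb := w.balance (m + 1) (n + 1)
    simp only [Nat.add_eq_zero_iff, one_ne_zero, and_false, if_false, Nat.add_sub_cancel] at hb
    rw [div_eq_iff hq, show m + 1 + 1 = m + 2 from rfl] at *
    linear_combination ((m + 1 : ℕ) : ℝ) ^ k * x ^ (m + 1) * hb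

/-- Rows when `K1` vanishes on the lower branch of the kernel curve. -/
theorem tendsto_rows_of_eta_eq {k x L : ℝ} (hx2 : w.xr2 ≤ x) (hx3 : x ≤ w.xr3)
    (he : w.eta x = w.y0 x)
    (h0 : Tendsto (fun m : ℕ => (m : ℝ) ^ k * (w.u m 0 * x ^ m)) atTop (𝓝 L)) (n : ℕ) :
    Tendsto (fun m : ℕ => (m : ℝ) ^ k * (w.u m n * x ^ m)) atTop (𝓝 (L * (1 / w.y1 x) ^ n)) := by
  have hx := w.xr2_pos.trans_le hx2
  have hy := (w.y1_pos hx2 hx3).ne'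
  have e1 := w.y0_add_y1 x
  have e2 := w.y0_mul_y1 hx2 hx3
  have e3 := w.l2_mul_ys_sq
  refine w.tendsto_rows (D := fun n => L * (1 / w.y1 x) ^ n) hx (by simpa using h0) ?_
    (fun n => ?_) n
  · rw [he, ← e3, ← e2]; field_simp
  · have e4 : 2 * w.l2 * w.ys * w.wv x = w.l2 * (w.y0 x + w.y1 x) := by rw [e1]; ring
    rw [e4, ← e3, ← e2, pow_succ, pow_succ]
    field_simp
    ring

/-- Rows at the branch point. -/
theorem tendsto_rows_xr3 {k L : ℝ}
    (h0 : Tendsto (fun m : ℕ => (m : ℝ) ^ k * (w.u m 0 * w.xr3 ^ m)) atTop (𝓝 L)) (n : ℕ) :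
    Tendsto (fun m : ℕ => (m : ℝ) ^ k * (w.u m n * w.xr3 ^ m)) atTop
      (𝓝 (L * (1 + n * (w.eta w.xr3 / w.ys - 1)) * (1 / w.ys) ^ n)) := by
  have hy := w.ys_pos.ne'
  have e3 := w.l2_mul_ys_sq
  -- At the double root the recurrence has the solutions (A + Bn)·ys^(-n); the balance on the
  -- horizontal axis fixes B/A = eta/ys - 1.
  refine w.tendsto_rows (D := fun n : ℕ => L * (1 + n * (w.eta w.xr3 / w.ys - 1)) * (1 / w.ys) ^ n)
    w.xr3_pos (by simpa using h0) ?_ (fun n => ?_) n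
  · rw [← e3]; push_cast; field_simp; ring
  · rw [wv_xr3, ← e3, pow_succ (1 / w.ys) (n + 1), pow_succ (1 / w.ys) n]
    generalize (1 / w.ys) ^ n = Z
    push_cast; field_simp; ring

end QuarterWalk

/-! ### Balance equations of the queue and the censored walk -/

namespace RetrialRates

variable {p : RetrialRates}

/-- For m = 0 the truncated m - 1 points back to (0, n, 1), where another term already sits; the
attached rate is then 0, so nothing is counted twice. -/
theorem hasSum_jumpRate_idle (m n : ℕ) :
    HasSum (fun t : State => p.jumpRate (m, n, 0) t)
      (p.lam + (if m = 0 then 0 else p.mu1) + (if n = 0 then 0 else p.mu2)) := by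
  refine (((hasSum_ite_eq ((m, n, 1) : State) p.lam).add
    (hasSum_ite_eq ((m - 1, n, 1) : State) (if m = 0 then 0 else p.mu1))).add
    (hasSum_ite_eq ((m, n - 1, 1) : State) (if n = 0 then 0 else p.mu2))).congr_fun ?_
  rintro ⟨a, b, k⟩
  fin_cases k <;> simp [jumpRate, Prod.ext_iff] <;> grind

theorem hasSum_into_idle (π : State → ℝ) (m n : ℕ) :
    HasSum (fun t : State => π t * p.jumpRate t (m, n, 0)) (π (m, n, 1) * p.mu) := by
  refine (hasSum_ite_eq ((m, n, 1) : State) (π (m, n, 1) * p.mu)).congr_fun ?_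
  rintro ⟨a, b, k⟩
  fin_cases k <;> simp [jumpRate, Prod.ext_iff] <;> grind

theorem hasSum_jumpRate_busy (m n : ℕ) :
    HasSum (fun t : State => p.jumpRate (m, n, 1) t) (p.mu + p.lam1 + p.lam2) := by
  refine (((hasSum_ite_eq ((m, n, 0) : State) p.mu).add
    (hasSum_ite_eq ((m + 1, n, 1) : State) p.lam1)).add
    (hasSum_ite_eq ((m, n + 1, 1) : State) p.lam2)).congr_fun ?_
  rintro ⟨a, b, k⟩
  fin_cases k <;> simp [jumpRate, Prod.ext_iff] <;> grind

theorem hasSum_into_busy (π : State → ℝ) (m n : ℕ) :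
    HasSum (fun t : State => π t * p.jumpRate t (m, n, 1))
      (π (m, n, 0) * p.lam + π (m + 1, n, 0) * p.mu1 + π (m, n + 1, 0) * p.mu2
        + (if m = 0 then 0 else π (m - 1, n, 1) * p.lam1)
        + (if n = 0 then 0 else π (m, n - 1, 1) * p.lam2)) := by
  refine (((((hasSum_ite_eq ((m, n, 0) : State) (π (m, n, 0) * p.lam)).add
    (hasSum_ite_eq ((m + 1, n, 0) : State) (π (m + 1, n, 0) * p.mu1))).add
    (hasSum_ite_eq ((m, n + 1, 0) : State) (π (m, n + 1, 0) * p.mu2))).add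
    (hasSum_ite_eq ((m - 1, n, 1) : State) (if m = 0 then 0 else π (m - 1, n, 1) * p.lam1))).add
    (hasSum_ite_eq ((m, n - 1, 1) : State)
      (if n = 0 then 0 else π (m, n - 1, 1) * p.lam2))).congr_fun ?_
  rintro ⟨a, b, k⟩
  fin_cases k <;> simp [jumpRate, Prod.ext_iff] <;> grind

theorem IsStationary.idle_eq {π : State → ℝ} (hπ : p.IsStationary π) (m n : ℕ) :
    (p.lam + (if m = 0 then 0 else p.mu1) + (if n = 0 then 0 else p.mu2)) * π (m, n, 0)
      = p.mu * π (m, n, 1) := by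
  have h := hπ.2.2 (m, n, 0)
  rw [(hasSum_jumpRate_idle m n).tsum_eq, (hasSum_into_idle π m n).tsum_eq] at h
  linarith

theorem IsStationary.busy_eq {π : State → ℝ} (hπ : p.IsStationary π) (m n : ℕ) :
    (p.mu + p.lam1 + p.lam2) * π (m, n, 1)
      = π (m, n, 0) * p.lam + π (m + 1, n, 0) * p.mu1 + π (m, n + 1, 0) * p.mu2
        + (if m = 0 then 0 else π (m - 1, n, 1) * p.lam1)
        + (if n = 0 then 0 else π (m, n - 1, 1) * p.lam2) := by
  have h := hπ.2.2 (m, n, 1)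
  rw [(hasSum_jumpRate_busy m n).tsum_eq, (hasSum_into_busy π m n).tsum_eq] at h
  linarith

theorem Positive.lam_pos (h : p.Positive) : 0 < p.lam := add_pos h.1 h.2.1

theorem Positive.alpha_pos (h : p.Positive) : 0 < p.alpha :=
  add_pos (add_pos h.lam_pos h.2.2.2.1) h.2.2.2.2

/-- The censored walk of the busy states, as a walk in the quarter plane. -/
def walk (p : RetrialRates) (hp : p.Positive) (π : State → ℝ) (hπ : p.IsStationary π) :
    QuarterWalk where
  l1 := p.lam1
  l2 := p.lam2
  p := p.hatMu1 / p.alpha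
  q := p.hatMu2 / p.alpha
  M1 := p.hatMu1 / (p.lam + p.mu1)
  M2 := p.hatMu2 / (p.lam + p.mu2)
  l1_pos := hp.1
  l2_pos := hp.2.1
  p_pos := div_pos (mul_pos hp.2.2.1 hp.2.2.2.1) hp.alpha_pos
  q_pos := div_pos (mul_pos hp.2.2.1 hp.2.2.2.2) hp.alpha_pos
  p_lt := by
    have := hp.lam_pos
    obtain ⟨h1, h2, h3, h4, h5⟩ := hp
    exact div_lt_div_of_pos_left (mul_pos h3 h4) (by linarith) (by rw [alpha]; linarith)
  q_lt := by
    have := hp.lam_pos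
    obtain ⟨h1, h2, h3, h4, h5⟩ := hp
    exact div_lt_div_of_pos_left (mul_pos h3 h5) (by linarith) (by rw [alpha]; linarith)
  u m n := π (m, n, 1)
  u_nonneg m n := hπ.1 _
  u_summable := hπ.2.1.summable.comp_injective (i := fun s : ℕ × ℕ => (s.1, s.2, 1))
    fun a b h => by ext <;> simp at h <;> omega
  u_ne := by
    by_contra hn
    push Not at hn
    have hl := hp.lam_pos
    obtain ⟨h1, h2, h3, h4, h5⟩ := hp
    have hz : π = fun _ => 0 := by
      ext ⟨m, n, k⟩
      have h0 := hπ.idle_eq m n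
      rw [hn m n, mul_zero] at h0
      have hd : 0 < p.lam + (if m = 0 then 0 else p.mu1) + (if n = 0 then 0 else p.mu2) := by
        split_ifs <;> linarith
      have h0' := (mul_eq_zero.1 h0).resolve_left hd.ne'
      fin_cases k
      · exact h0'
      · exact hn m n
    have := hπ.2.1
    rw [hz] at this
    exact zero_ne_one (hasSum_zero.unique this)
  balance m n := by
    have hl := hp.lam_pos
    have ha := hp.alpha_pos
    obtain ⟨h1, h2, h3, h4, h5⟩ := hp
    have hb := hπ.busy_eq m n
    -- Each idle probability is a multiple of the busy one, with a factor depending on which orbits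
    -- are empty. This is why the downward and leftward rates differ on the axes; the return of an
    -- idle excursion to its starting state cancels.
    have idle : ∀ m n, π (m, n, 0) = p.mu * π (m, n, 1) /
        (p.lam + (if m = 0 then 0 else p.mu1) + (if n = 0 then 0 else p.mu2)) := by
      intro m n
      rw [eq_div_iff, ← hπ.idle_eq m n, mul_comm]
      split_ifs <;> positivity
    rw [idle m n, idle (m + 1) n, idle m (n + 1)] at hb
    have e1 : p.lam + p.mu1 ≠ 0 := by positivity
    have e2 : p.lam + p.mu2 ≠ 0 := by positivity
    have e3 : p.lam + p.mu1 + p.mu2 ≠ 0 := by positivity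
    simp only [alpha, hatMu1, hatMu2, Nat.add_eq_zero_iff, one_ne_zero, and_false, if_false] at hb ⊢
    rcases m with _ | m <;> rcases n with _ | n <;>
      simp only [Nat.add_eq_zero_iff, one_ne_zero, and_false, if_false, if_true, add_zero,
        Nat.add_sub_cancel] at hb ⊢ <;>
      field_simp at hb ⊢ <;> linear_combination hb

/-! ### The data of the theorem in terms of the walk -/

section Walk

variable (hp : p.Positive) {π : State → ℝ} (hπ : p.IsStationary π)

theorem walk_ys : (p.walk hp π hπ).ys = √(p.hatMu2 / p.hatLam2) := by
  have := hp.alpha_pos.ne'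
  have := hp.2.1.ne'
  simp only [QuarterWalk.ys, walk, hatLam2]
  congr 1
  field_simp

theorem alpha_mul_tt : p.alpha * (p.walk hp π hπ).tt = p.sPlus := by
  have ha := hp.alpha_pos
  have hL : 0 < p.hatLam2 := mul_pos ha hp.2.1
  have hM : 0 < p.hatMu2 := mul_pos hp.2.2.1 hp.2.2.2.2
  have h1 := Real.sq_sqrt hL.le
  have h2 := Real.sq_sqrt hM.le
  have h3 : p.hatLam2 * (p.walk hp π hπ).ys = √p.hatLam2 * √p.hatMu2 := by
    rw [walk_ys, Real.sqrt_div hM.le]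
    have := (Real.sqrt_pos.2 hL).ne'
    field_simp
    rw [h1]
  rw [QuarterWalk.tt, sPlus, sub_sq, h1, h2]
  have e : p.alpha * (p.walk hp π hπ).l2 = p.hatLam2 := rfl
  have e1 : p.alpha * (p.walk hp π hπ).l1 = p.hatLam1 := rfl
  have e2 : p.alpha * (p.walk hp π hπ).p = p.hatMu1 := mul_div_cancel₀ _ ha.ne'
  have e3 : p.alpha * (p.walk hp π hπ).q = p.hatMu2 := mul_div_cancel₀ _ ha.ne'
  linear_combination e1 + e2 + e3 + e * (1 - 2 * (p.walk hp π hπ).ys) - 2 * h3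

theorem sqrt_disc : √(p.sPlus ^ 2 - 4 * p.hatLam1 * p.hatMu1) = p.alpha *
    √((p.walk hp π hπ).tt ^ 2 - 4 * (p.walk hp π hπ).l1 * (p.walk hp π hπ).p) := by
  have ha := hp.alpha_pos
  have e2 : p.alpha * (p.walk hp π hπ).p = p.hatMu1 := mul_div_cancel₀ _ ha.ne'
  have e1 : p.alpha * (p.walk hp π hπ).l1 = p.hatLam1 := rfl
  rw [← alpha_mul_tt hp hπ, ← e1, ← e2]
  conv_rhs => rw [← Real.sqrt_sq ha.le]
  rw [← Real.sqrt_mul (sq_nonneg _)]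
  congr 1; ring

theorem x3_eq : p.x3 = (p.walk hp π hπ).xr3 := by
  have ha := hp.alpha_pos.ne'
  have hl := hp.1.ne'
  have e1 : p.hatLam1 = p.alpha * (p.walk hp π hπ).l1 := rfl
  have hl' : (p.walk hp π hπ).l1 ≠ 0 := hl
  rw [x3, QuarterWalk.xr3, sqrt_disc hp hπ, ← alpha_mul_tt hp hπ, e1]
  field_simp

theorem x2_eq : p.x2 = (p.walk hp π hπ).xr2 := by
  have ha := hp.alpha_pos.ne'
  have hl := hp.1.ne'
  have e1 : p.hatLam1 = p.alpha * (p.walk hp π hπ).l1 := rfl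
  have hl' : (p.walk hp π hπ).l1 ≠ 0 := hl
  rw [x2, QuarterWalk.xr2, sqrt_disc hp hπ, ← alpha_mul_tt hp hπ, e1]
  field_simp

theorem hatB_eq {x : ℝ} (hx : x ≠ 0) :
    p.hatB x = -(2 * p.hatLam2 * x * ((p.walk hp π hπ).ys * (p.walk hp π hπ).wv x)) := by
  have ha := hp.alpha_pos.ne'
  have hl := hp.2.1.ne'
  have hy := (p.walk hp π hπ).ys_pos.ne'
  have e : (p.walk hp π hπ).ys * (p.walk hp π hπ).wv x = (p.lam1 + p.lam2 + p.hatMu1 / p.alpha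
      + p.hatMu2 / p.alpha - p.lam1 * x - p.hatMu1 / p.alpha / x) / (2 * p.lam2) := by
    have e0 : (p.walk hp π hπ).wv x = (p.lam1 + p.lam2 + p.hatMu1 / p.alpha
      + p.hatMu2 / p.alpha - p.lam1 * x - p.hatMu1 / p.alpha / x)
        / (2 * p.lam2 * (p.walk hp π hπ).ys) := rfl
    rw [e0]; field_simp
  rw [e, hatB, hatLam1, hatLam2]
  field_simp
  ring

theorem sqrt_Delta {x : ℝ} (hx2 : p.x2 ≤ x) (hx3 : x ≤ p.x3) :
    √(p.Delta x) = p.hatLam2 * x * ((p.walk hp π hπ).y1 x - (p.walk hp π hπ).y0 x) := by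
  rw [x2_eq hp hπ] at hx2
  rw [x3_eq hp hπ] at hx3
  have hx : 0 < x := (p.walk hp π hπ).xr2_pos.trans_le hx2
  have hL : 0 < p.hatLam2 := mul_pos hp.alpha_pos hp.2.1
  have hM : 0 < p.hatMu2 := mul_pos hp.2.2.1 hp.2.2.2.2
  have hle := ((p.walk hp π hπ).y0_le_ys hx2 hx3).trans ((p.walk hp π hπ).ys_le_y1 hx2 hx3)
  have hs := Real.sq_sqrt (mul_pos hL hM).le
  have e1 := (p.walk hp π hπ).y0_add_y1 x
  have e2 := (p.walk hp π hπ).y0_mul_y1 hx2 hx3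
  have e3 : (p.walk hp π hπ).ys ^ 2 * p.hatLam2 = p.hatMu2 := by
    rw [walk_ys, Real.sq_sqrt (div_pos hM hL).le, div_mul_cancel₀ _ hL.ne']
  have e4 := hatB_eq hp hπ hx.ne'
  have : p.Delta x = (p.hatLam2 * x * ((p.walk hp π hπ).y1 x - (p.walk hp π hπ).y0 x)) ^ 2 := by
    have e5 : p.hatB x = -(p.hatLam2 * x * ((p.walk hp π hπ).y0 x + (p.walk hp π hπ).y1 x)) := by
      rw [e4, e1]; ring
    have e6 : p.Delta x = p.hatB x ^ 2 - 4 * x ^ 2 * (p.hatLam2 * p.hatMu2) := by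
      rw [Delta]; linear_combination -4 * x ^ 2 * hs
    rw [e6, e5, ← e3, ← e2]; ring
  rw [this, Real.sqrt_sq]
  exact mul_nonneg (mul_pos hL hx).le (by linarith)

theorem YMinus_eq {x : ℝ} (hx2 : p.x2 ≤ x) (hx3 : x ≤ p.x3) :
    p.YMinus x = (p.walk hp π hπ).y0 x := by
  have hx : 0 < x := (p.walk hp π hπ).xr2_pos.trans_le (by rwa [← x2_eq hp hπ])
  have hL : 0 < p.hatLam2 := mul_pos hp.alpha_pos hp.2.1
  have e1 := (p.walk hp π hπ).y0_add_y1 x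
  rw [YMinus, sqrt_Delta hp hπ hx2 hx3, hatB_eq hp hπ hx.ne', div_eq_iff (by positivity)]
  linear_combination -p.hatLam2 * x * e1

theorem YPlus_eq {x : ℝ} (hx2 : p.x2 ≤ x) (hx3 : x ≤ p.x3) :
    p.YPlus x = (p.walk hp π hπ).y1 x := by
  have hx : 0 < x := (p.walk hp π hπ).xr2_pos.trans_le (by rwa [← x2_eq hp hπ])
  have hL : 0 < p.hatLam2 := mul_pos hp.alpha_pos hp.2.1
  have e1 := (p.walk hp π hπ).y0_add_y1 x
  rw [YPlus, sqrt_Delta hp hπ hx2 hx3, hatB_eq hp hπ hx.ne', div_eq_iff (by positivity)]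
  linear_combination -p.hatLam2 * x * e1

theorem abs_YMinus_le (hp : p.Positive) {π : State → ℝ} (hπ : p.IsStationary π) {x : ℝ} (hx2 : p.x2 ≤ x) (hx3 : x ≤ p.x3) : |p.YMinus x| ≤ |p.YPlus x| := by
  rw [YMinus_eq (π := π) hp hπ hx2 hx3, YPlus_eq hp hπ hx2 hx3]
  rw [x2_eq hp hπ] at hx2
  rw [x3_eq hp hπ] at hx3
  rw [abs_of_pos ((p.walk hp π hπ).y0_pos hx2 hx3), abs_of_pos ((p.walk hp π hπ).y1_pos hx2 hx3)]
  exact ((p.walk hp π hπ).y0_le_ys hx2 hx3).trans ((p.walk hp π hπ).ys_le_y1 hx2 hx3)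

theorem Y0_eq {x : ℝ} (hx2 : p.x2 ≤ x) (hx3 : x ≤ p.x3) : p.Y0 x = (p.walk hp π hπ).y0 x := by
  rw [Y0, if_pos (abs_YMinus_le hp hπ hx2 hx3), YMinus_eq hp hπ hx2 hx3]

theorem Y1_eq {x : ℝ} (hx2 : p.x2 ≤ x) (hx3 : x ≤ p.x3) : p.Y1 x = (p.walk hp π hπ).y1 x := by
  rw [Y1, if_pos (abs_YMinus_le hp hπ hx2 hx3), YPlus_eq hp hπ hx2 hx3]

/-- The product of the distances to the zeros of `b₋` at the branch point. -/
theorem branch_product : p.lam1 * ((p.x3 - p.x1) * (p.x4 - p.x3))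
    = 4 * p.lam2 * (p.walk hp π hπ).ys * p.x3 := by
  have ha := hp.alpha_pos
  have hL1 : 0 < p.hatLam1 := mul_pos ha hp.1
  have hL : 0 < p.hatLam2 := mul_pos ha hp.2.1
  have hM1 : 0 < p.hatMu1 := mul_pos hp.2.2.1 hp.2.2.2.1
  have hM : 0 < p.hatMu2 := mul_pos hp.2.2.1 hp.2.2.2.2
  have h1 := Real.sq_sqrt hL.le
  have h2 := Real.sq_sqrt hM.le
  have h3 : p.hatLam2 * (p.walk hp π hπ).ys = √p.hatLam2 * √p.hatMu2 := by
    rw [walk_ys, Real.sqrt_div hM.le]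
    have := (Real.sqrt_pos.2 hL).ne'
    field_simp
    rw [h1]
  have hs : p.hatLam1 + p.hatMu1 ≤ p.sMinus := by
    unfold sMinus; nlinarith [sq_nonneg (√p.hatLam2 + √p.hatMu2)]
  have hr := Real.sq_sqrt (show 0 ≤ p.sMinus ^ 2 - 4 * p.hatLam1 * p.hatMu1 by
    nlinarith [sq_nonneg (p.hatLam1 - p.hatMu1)])
  have hm : p.hatLam1 * ((p.x3 - p.x1) * (p.x3 - p.x4))
      = p.hatLam1 * p.x3 ^ 2 - p.sMinus * p.x3 + p.hatMu1 := by
    rw [x1, x4]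
    generalize √(p.sMinus ^ 2 - 4 * p.hatLam1 * p.hatMu1) = r at hr
    field_simp
    linear_combination -hr
  have hw : p.hatLam1 * p.x3 ^ 2 - p.sPlus * p.x3 + p.hatMu1 = 0 := by
    have a1 := (p.walk hp π hπ).l1_mul_xr_add
    have a2 := (p.walk hp π hπ).l1_mul_xr_mul
    have e2 : p.alpha * (p.walk hp π hπ).p = p.hatMu1 := mul_div_cancel₀ _ ha.ne'
    have e1 : p.alpha * (p.walk hp π hπ).l1 = p.hatLam1 := rfl
    rw [x3_eq hp hπ, ← alpha_mul_tt hp hπ, ← e1, ← e2, ← a1, ← a2]; ring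
  -- b₊ and b₋ differ only in the linear term; as b₊ vanishes at x₃, the value of b₋ there is this
  -- difference times -x₃.
  have hd : p.sMinus - p.sPlus = 4 * (p.hatLam2 * (p.walk hp π hπ).ys) := by
    rw [sMinus, sPlus, h3]; ring
  have hd' : p.sMinus - p.sPlus = 4 * (p.alpha * p.lam2 * (p.walk hp π hπ).ys) := hd
  apply mul_left_cancel₀ ha.ne'
  have e1 : p.hatLam1 = p.alpha * p.lam1 := rfl
  rw [e1] at hm hw
  linear_combination -hm - hw + p.x3 * hd'

/-- `piTwo` has exponents lower by one than `P2`, which the identity h₂ = y·K2 compensates; the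
normalization rewrites the constants of h₂ and h₀ as rates. -/
theorem boundaryTerm_eq (hn : p.Normalized) (x : ℝ) {y : ℝ} (hy : y ≠ 0) :
    p.boundaryTerm π x y = (p.walk hp π hπ).N x y := by
  have hl := hp.lam_pos
  obtain ⟨h1, h2, h3, h4, h5⟩ := hp
  have e1 : (p.walk ⟨h1, h2, h3, h4, h5⟩ π hπ).P2 y = y * piTwo π y := by
    simp only [QuarterWalk.P2, piTwo, walk, smul_eq_mul]
    rw [← tsum_mul_left]
    congr 1; ext n; rw [pow_succ]; ring
  have e2 : p.h2 x y = y * (p.walk ⟨h1, h2, h3, h4, h5⟩ π hπ).K2 x y := by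
    have : p.lam + p.mu2 ≠ 0 := by positivity
    simp only [QuarterWalk.K2, walk, smul_eq_mul, hatMu2]
    rw [Normalized] at hn
    have e4 : p.mu1 + p.mu2 + p.lam * p.mu / (p.lam + p.mu2) - 1
        = -p.lam - p.mu + p.lam * p.mu / (p.lam + p.mu2) := by linarith
    rw [RetrialRates.h2, e4]
    simp only [lam, hatMu2] at this ⊢
    field_simp
    ring
  have e3 : p.h0 x y = (p.walk ⟨h1, h2, h3, h4, h5⟩ π hπ).K0 x y := by
    simp only [QuarterWalk.K0, walk, smul_eq_mul, h0]
    rw [Normalized, lam] at hn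
    linarith
  rw [boundaryTerm, QuarterWalk.N, e1, e2, e3, smul_eq_mul]
  have : (p.walk ⟨h1, h2, h3, h4, h5⟩ π hπ).u 0 0 = π (0, 0, 1) := rfl
  rw [this]; ring

theorem h1_eq (hn : p.Normalized) {x : ℝ} (hx : x ≠ 0) (y : ℝ) :
    p.h1 x y = x * (p.walk hp π hπ).K1 x y := by
  have hl := hp.lam_pos
  obtain ⟨h1, h2, h3, h4, h5⟩ := hp
  have : p.lam + p.mu1 ≠ 0 := by positivity
  have e4 : 1 - (p.mu1 + p.mu2 + p.lam * p.mu / (p.lam + p.mu1))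
      = p.lam + p.mu - p.lam * p.mu / (p.lam + p.mu1) := by rw [Normalized] at hn; linarith
  simp only [QuarterWalk.K1, walk, smul_eq_mul, RetrialRates.h1, a1, b1, e4, hatMu1]
  simp only [lam] at this ⊢
  field_simp
  ring

end Walk

end RetrialRates

/-! ### The stable queue satisfies the standing assumptions -/

namespace RetrialRates

variable {p : RetrialRates}

/-- The outer coefficients of g have opposite signs, so the root of the discriminant exceeds the
linear coefficient in modulus; hence one negative and one positive zero. -/
theorem discG_gt (hp : p.Positive) :
    |p.lam * p.mu1 * (p.lam + p.mu1 - p.mu)| < √p.discG := by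
  have hl := hp.lam_pos
  obtain ⟨h1, h2, h3, h4, h5⟩ := hp
  rw [← Real.sqrt_sq_eq_abs]
  refine Real.sqrt_lt_sqrt (sq_nonneg _) ?_
  rw [discG]
  have : 0 < 4 * p.lam * p.lam1 * (p.lam + p.mu1) * p.mu * p.mu1 ^ 2 := by positivity
  linarith

theorem xMinus_neg (hp : p.Positive) : p.xMinus < 0 := by
  have h := abs_lt.1 (discG_gt hp)
  have hl := hp.lam_pos
  obtain ⟨h1, h2, h3, h4, h5⟩ := hp
  exact div_neg_of_neg_of_pos (by linarith) (by positivity)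

theorem g_eq (hp : p.Positive) (x : ℝ) :
    p.lam * p.lam1 * (p.lam + p.mu1) * x ^ 2 + p.lam * p.mu1 * (p.lam + p.mu1 - p.mu) * x
      - p.mu * p.mu1 ^ 2
      = p.lam * p.lam1 * (p.lam + p.mu1) * ((x - p.xPlus) * (x - p.xMinus)) := by
  have hl := hp.lam_pos
  have hpos : 0 ≤ p.discG := by
    by_contra hn
    have := discG_gt hp
    rw [Real.sqrt_eq_zero_of_nonpos (by linarith)] at this
    exact absurd this (not_lt.2 (abs_nonneg _))
  obtain ⟨h1, h2, h3, h4, h5⟩ := hp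
  have hs := Real.sq_sqrt hpos
  have h6 : p.lam + p.mu1 ≠ 0 := by positivity
  rw [xPlus, xMinus]
  generalize √p.discG = r at hs
  rw [discG] at hs
  field_simp
  linear_combination hs

/-- The resultant of the walk is a positive multiple of g, once λ₂ is written as λ - λ₁. -/
theorem walk_res_eq (hp : p.Positive) {π : State → ℝ} (hπ : p.IsStationary π) (x : ℝ) :
    (p.walk hp π hπ).res x = p.hatMu2 * p.lam * p.lam1 / (p.alpha * (p.lam + p.mu1))
      * ((x - p.xPlus) * (x - p.xMinus)) := by
  have hg := g_eq hp x
  have hl := hp.lam_pos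
  have ha := hp.alpha_pos
  obtain ⟨h1, h2, h3, h4, h5⟩ := hp
  have h6 : p.lam + p.mu1 ≠ 0 := by positivity
  have e : p.hatMu2 * p.lam * p.lam1 / (p.alpha * (p.lam + p.mu1)) * ((x - p.xPlus) * (x - p.xMinus))
      = p.hatMu2 / (p.alpha * (p.lam + p.mu1) ^ 2) *
        (p.lam * p.lam1 * (p.lam + p.mu1) * ((x - p.xPlus) * (x - p.xMinus))) := by
    field_simp
  rw [e, ← hg]
  have h7 : p.lam2 = p.lam - p.lam1 := by rw [lam]; ring
  have h8 : p.lam + p.mu1 + p.mu2 ≠ 0 := by positivity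
  simp only [QuarterWalk.res, walk, hatMu1, hatMu2, h7, alpha]
  field_simp
  ring

/-- g(1) = (λ+μ₁)(λ(λ₁+μ₁) - μμ₁) is negative by the first stability inequality, so x₊ > 1. At M1/l1
the value of g is μμ₁²λ₂/λ₁ > 0, so l1·x₊ < M1. The leftward drift is the assumption λ̂₁ < μ̂₁, and
`mixed` reduces to the positivity of an explicit fraction. -/
theorem regular (hp : p.Positive) (hstab : p.Stable) (hwlog : p.hatLam1 < p.hatMu1)
    {π : State → ℝ} (hπ : p.IsStationary π) :
    (p.walk hp π hπ).Regular (p.hatMu2 * p.lam * p.lam1 / (p.alpha * (p.lam + p.mu1)))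
      p.xPlus p.xMinus := by
  have hxm := xMinus_neg hp
  have hres := walk_res_eq hp hπ
  have hl := hp.lam_pos
  have ha := hp.alpha_pos
  have hp' := hp
  obtain ⟨h1, h2, h3, h4, h5⟩ := hp
  have hlm : 0 < p.lam + p.mu1 := by linarith
  have hlm2 : 0 < p.lam + p.mu2 := by linarith
  have hM2 : 0 < p.hatMu2 := mul_pos h3 h5
  have hM1 : 0 < p.hatMu1 := mul_pos h3 h4
  have hC : 0 < p.hatMu2 * p.lam * p.lam1 / (p.alpha * (p.lam + p.mu1)) := by positivity
  have hg : ∀ x, 0 ≤ x → (x < p.xPlus ↔ (p.lam * p.lam1 * (p.lam + p.mu1) * x ^ 2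
      + p.lam * p.mu1 * (p.lam + p.mu1 - p.mu) * x - p.mu * p.mu1 ^ 2) < 0) := by
    intro x hx
    have hc : 0 < p.lam * p.lam1 * (p.lam + p.mu1) := by positivity
    have hx' : 0 < x - p.xMinus := by linarith
    rw [g_eq hp']
    constructor
    · intro h
      exact mul_neg_of_pos_of_neg hc (mul_neg_of_neg_of_pos (by linarith) hx')
    · intro h
      by_contra hn
      push Not at hn
      have := mul_nonneg hc.le (mul_nonneg (show 0 ≤ x - p.xPlus by linarith) hx'.le)
      linarith
  have hg' : ∀ x, 0 ≤ x → 0 < (p.lam * p.lam1 * (p.lam + p.mu1) * x ^ 2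
      + p.lam * p.mu1 * (p.lam + p.mu1 - p.mu) * x - p.mu * p.mu1 ^ 2) → p.xPlus < x := by
    intro x hx h
    have hc : 0 < p.lam * p.lam1 * (p.lam + p.mu1) := by positivity
    have hx' : 0 < x - p.xMinus := by linarith
    rw [g_eq hp'] at h
    by_contra hn
    push Not at hn
    have := mul_nonneg hc.le (mul_nonneg (show 0 ≤ p.xPlus - x by linarith) hx'.le)
    linarith
  refine ⟨?_, hC, hxm, ?_, ?_, hres, ?_⟩
  · change p.lam1 < p.hatMu1 / p.alpha
    rw [lt_div_iff₀ ha]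
    rw [hatLam1] at hwlog
    linarith
  · rw [hg 1 zero_le_one]
    have := mul_lt_mul_of_pos_right hstab.1 hlm
    nlinarith [hstab.1]
  · change p.lam1 * p.xPlus < p.hatMu1 / (p.lam + p.mu1)
    rw [mul_comm, ← lt_div_iff₀ h1]
    refine hg' _ (by positivity) ?_
    have e : p.lam * p.lam1 * (p.lam + p.mu1) * (p.hatMu1 / (p.lam + p.mu1) / p.lam1) ^ 2
        + p.lam * p.mu1 * (p.lam + p.mu1 - p.mu) * (p.hatMu1 / (p.lam + p.mu1) / p.lam1)
        - p.mu * p.mu1 ^ 2 = p.mu * p.mu1 ^ 2 * p.lam2 / p.lam1 := by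
      have h7 : p.lam2 = p.lam - p.lam1 := by rw [lam]; ring
      rw [h7, hatMu1]
      field_simp
      ring
    rw [e]
    positivity
  · change p.hatMu2 / (p.lam + p.mu2) * (p.hatMu1 / (p.lam + p.mu1) - p.hatMu1 / p.alpha)
      < p.hatMu2 / p.alpha * (p.hatMu1 / (p.lam + p.mu1))
    have e : p.hatMu2 / p.alpha * (p.hatMu1 / (p.lam + p.mu1))
        - p.hatMu2 / (p.lam + p.mu2) * (p.hatMu1 / (p.lam + p.mu1) - p.hatMu1 / p.alpha)
        = p.hatMu2 * p.hatMu1 * p.lam / (p.alpha * (p.lam + p.mu1) * (p.lam + p.mu2)) := by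
      have h8 : p.lam + p.mu1 + p.mu2 ≠ 0 := by positivity
      simp only [alpha]
      field_simp
      ring
    have : 0 < p.hatMu2 * p.hatMu1 * p.lam / (p.alpha * (p.lam + p.mu1) * (p.lam + p.mu2)) := by
      positivity
    linarith

section Walk

variable (hp : p.Positive) {π : State → ℝ} (hπ : p.IsStationary π)

theorem YAtXPlus_eq (hx : p.xPlus ≠ 0) : p.YAtXPlus = (p.walk hp π hπ).eta p.xPlus := by
  have hl := hp.lam_pos
  obtain ⟨h1, h2, h3, h4, h5⟩ := hp
  have hlm : 0 < p.lam + p.mu1 := by linarith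
  simp only [YAtXPlus, QuarterWalk.eta, walk, hatMu1]
  field_simp
  ring

theorem ratio_eq : p.hatMu1 / p.hatLam1 = (p.walk hp π hπ).p / (p.walk hp π hπ).l1 := by
  have ha := hp.alpha_pos
  have h1 := hp.1
  change p.hatMu1 / (p.alpha * p.lam1) = p.hatMu1 / p.alpha / p.lam1
  field_simp

theorem b1_eq (hn : p.Normalized) {x : ℝ} (hx : x ≠ 0) :
    p.b1 x = -(x * (p.walk hp π hπ).l2 * (p.walk hp π hπ).eta x) := by
  have h := h1_eq hp hπ hn hx 0
  rw [(p.walk hp π hπ).K1_eq_eta _ hx, RetrialRates.h1] at h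
  linarith

theorem c_eq (x : ℝ) : p.c x = (p.walk hp π hπ).l2 * (p.walk hp π hπ).ys ^ 2 * x := by
  rw [(p.walk hp π hπ).l2_mul_ys_sq]; rfl

theorem b1_div_c (hn : p.Normalized) {x : ℝ} (hx : x ≠ 0) :
    -(p.b1 x / p.c x) = (p.walk hp π hπ).eta x / (p.walk hp π hπ).ys ^ 2 := by
  have h1 := (p.walk hp π hπ).l2_pos.ne'
  have h2 := (p.walk hp π hπ).ys_pos.ne'
  rw [b1_eq hp hπ hn hx, c_eq hp hπ]
  field_simp

theorem p1_div_c (hn : p.Normalized) :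
    -(p.p1 p.x3 / p.c p.x3) = ((p.walk hp π hπ).eta p.x3 - (p.walk hp π hπ).ys)
      / (p.walk hp π hπ).ys ^ 2 := by
  have h1 := (p.walk hp π hπ).l2_pos.ne'
  have h2 := (p.walk hp π hπ).ys_pos.ne'
  have hx : p.x3 ≠ 0 := by rw [x3_eq hp hπ]; exact (p.walk hp π hπ).xr3_pos.ne'
  have hL : p.hatLam2 ≠ 0 := (mul_pos hp.alpha_pos hp.2.1).ne'
  have hw : (p.walk hp π hπ).wv p.x3 = 1 := by rw [x3_eq hp hπ, QuarterWalk.wv_xr3]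
  have e : p.p1 p.x3 = p.x3 * (p.walk hp π hπ).l2 * ((p.walk hp π hπ).ys
      - (p.walk hp π hπ).eta p.x3) := by
    rw [p1, b1_eq hp hπ hn hx, hatB_eq hp hπ hx, hw, a1]
    change _ = p.x3 * p.lam2 * _
    change -(_ * (p.lam2 * p.x3) / _) + -(p.x3 * p.lam2 * _) = _
    field_simp
    ring
  rw [e, c_eq hp hπ]
  field_simp
  ring

/-- The constant of the square root singularity at the branch point. -/
theorem sqrt_branch_eq : √(p.x3 * (p.x3 - p.x1) * (p.x3 - p.x2) * (p.x4 - p.x3)) * p.lam1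
    = 2 * p.x3 * (p.lam2 * (p.walk hp π hπ).ys *
      (√((p.walk hp π hπ).l1 * (p.walk hp π hπ).xr3 * (1 - (p.walk hp π hπ).xr2
        / (p.walk hp π hπ).xr3) / (2 * (p.walk hp π hπ).l2 * (p.walk hp π hπ).ys)) * √2)) := by
  have hb := branch_product hp hπ
  have hx3 := (p.walk hp π hπ).xr3_pos
  have hx23 := (p.walk hp π hπ).xr2_le_xr3
  have hys := (p.walk hp π hπ).ys_pos
  rw [← x3_eq hp hπ] at hx3
  rw [← x3_eq hp hπ, ← x2_eq hp hπ] at hx23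
  rw [← x3_eq hp hπ, ← x2_eq hp hπ]
  change _ = 2 * p.x3 * (p.lam2 * _ * (√(p.lam1 * p.x3 * (1 - p.x2 / p.x3) / (2 * p.lam2 * _)) * _))
  have h1 := hp.1
  have h2 := hp.2.1
  generalize (p.walk hp π hπ).ys = s at *
  have e1 : p.lam1 * p.x3 * (1 - p.x2 / p.x3) / (2 * p.lam2 * s)
      = p.lam1 * (p.x3 - p.x2) / (2 * p.lam2 * s) := by field_simp
  have hd : 0 ≤ p.x3 - p.x2 := by linarith
  rw [e1, ← Real.sqrt_mul (by positivity)]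
  have e2 : p.x3 * (p.x3 - p.x1) * (p.x3 - p.x2) * (p.x4 - p.x3)
      = (2 * p.x3 * (p.lam2 * s) / p.lam1) ^ 2 * (p.lam1 * (p.x3 - p.x2) / (2 * p.lam2 * s) * 2) := by
    have : (p.x3 - p.x1) * (p.x4 - p.x3) = 4 * p.lam2 * s * p.x3 / p.lam1 := by
      rw [eq_div_iff h1.ne']; linarith
    calc _ = p.x3 * (p.x3 - p.x2) * ((p.x3 - p.x1) * (p.x4 - p.x3)) := by ring
      _ = _ := by rw [this]; field_simp; ring
  rw [e2, Real.sqrt_mul (sq_nonneg _), Real.sqrt_sq (by positivity)]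
  field_simp

end Walk

end RetrialRates

/-! ### Comparison of `eta xp` with `ys` -/

namespace QuarterWalk.Regular

variable {w : QuarterWalk} {C xp xm : ℝ}

/-- If `eta xp` ≤ ys, then `eta xp` is the smaller root and exceeds 1, so both roots do and K(xp, 1)
> 0. But K(xp, 1) = (xp - 1)(l1 - p/xp) ≤ 0 for xp ≤ p/l1. -/
theorem ys_lt_eta_of_le (h : w.Regular C xp xm) (hx : xp ≤ w.p / w.l1) : w.ys < w.eta xp := by
  by_contra hn
  push Not at hn
  have he := h.one_lt_eta h.one_lt le_rfl
  have hy := h.eta_eq_y0 hn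
  have hxp := h.one_lt
  have hxp0 : 0 < xp := by linarith
  have hK := w.K_eq_roots h.xr2_le_xp h.le_xr3 one_ne_zero
  rw [w.K_eq xp 1 hxp0.ne' one_ne_zero] at hK
  have h1 : w.l1 ≤ w.p / xp := by
    rw [le_div_iff₀ hxp0]; rw [le_div_iff₀ w.l1_pos] at hx; linarith
  have h2 := (w.y0_le_ys h.xr2_le_xp h.le_xr3).trans (w.ys_le_y1 h.xr2_le_xp h.le_xr3)
  have h3 : 0 < w.l2 / 1 * ((1 - w.y0 xp) * (1 - w.y1 xp)) :=
    mul_pos (by simpa using w.l2_pos) (mul_pos_of_neg_of_neg (by linarith) (by linarith))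
  nlinarith

theorem ys_lt_eta_of_lt (h : w.Regular C xp xm) (hx : xp < w.xr3) (he : w.ys ≤ w.eta xp) :
    w.ys < w.eta xp := by
  refine lt_of_le_of_ne he fun e => ?_
  have h1 := h.eta_eq_y0 e.ge
  have h2 := w.y0_lt_ys (w.xr2_le_one.trans_lt h.one_lt) hx
  linarith

theorem eta_eq_ys (h : w.Regular C xp xm) (hx : xp = w.xr3) : w.eta xp = w.ys := by
  rcases h.eta_xp_eq with e | e
  · rw [e, hx, y0_xr3]
  · rw [e, hx, y1_xr3]

end QuarterWalk.Regular

/-! ### The three types of asymptotics -/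

namespace RetrialRates

variable {p : RetrialRates} {π : State → ℝ} (hp : p.Positive) (hπ : p.IsStationary π)

theorem convergesBeyond (hlp : (p.walk hp π hπ).l1 < (p.walk hp π hπ).p) {y : ℝ} (hy : 0 < y)
    (hys : y ≤ (p.walk hp π hπ).ys) : ConvergesBeyond π y := by
  obtain ⟨R, hR, hs⟩ := (p.walk hp π hπ).exists_radius hlp
  have hR0 : 0 < R := (p.walk hp π hπ).ys_pos.trans hR
  refine ⟨R, by rw [abs_of_pos hy]; linarith, (hs.div_const R).congr fun n => ?_⟩
  change π (0, n + 1, 1) * R ^ (n + 1) / R = _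
  rw [pow_succ]; field_simp

theorem xDom_eq {k x L : ℝ} (hk0 : 0 ≤ k) (hk : k ≤ 2) (hx : 0 < x) (hL : 0 < L)
    (hπ : p.IsStationary π)
    (h : Tendsto (fun m : ℕ => (m : ℝ) ^ k * (π (m, 0, 1) * x ^ m)) atTop (𝓝 L)) : xDom π = x :=
  sSup_radius_of_tendsto (v := fun m => π (m, 0, 1)) (fun _ => hπ.1 _) hk0 hk hx hL h

theorem type_one (hp : p.Positive) (hπ : p.IsStationary π) (hn : p.Normalized)
    (hstab : p.Stable) (hwlog : p.hatLam1 < p.hatMu1)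
    (hc : p.Condition1) :
    xDom π = p.xPlus ∧ ConvergesBeyond π (p.Y0 p.xPlus) ∧
      ∀ n : ℕ, 1 ≤ n → AsympEq (fun m => π (m, n, 1)) (fun m =>
        p.A1 π * (1 / p.Y1 p.xPlus) ^ (n - 1) * (1 / p.xPlus) ^ ((m : ℤ) - 1)) := by
  have hr := regular hp hstab hwlog hπ
  obtain ⟨-, hJ, hY⟩ := hc
  have hxp := hr.one_lt
  have hxp0 : 0 < p.xPlus := by linarith
  have hx3 : p.xPlus < p.x3 := hJ.2.trans_le (min_le_left _ _)
  have hx2 : p.x2 ≤ p.xPlus := by rw [x2_eq hp hπ]; exact hr.xr2_le_xp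
  rw [YAtXPlus_eq hp hπ hxp0.ne', ← walk_ys hp hπ] at hY
  have hy0 := Y0_eq hp hπ hx2 hx3.le
  have hy1 := Y1_eq hp hπ hx2 hx3.le
  have hΔ := sqrt_Delta hp hπ hx2 hx3.le
  have hx3' := hx3
  rw [x3_eq hp hπ] at hx3'
  have hx2' : (p.walk hp π hπ).xr2 < p.xPlus := (p.walk hp π hπ).xr2_le_one.trans_lt hxp
  have heta := hr.eta_eq_y0 hY.le
  have hT := hr.tendsto_row_pole hx3' hY.le
  have hN := hr.N_pos
  rw [heta] at hN
  have e1 := (p.walk hp π hπ).y0_lt_ys hx2' hx3'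
  have e2 := (p.walk hp π hπ).ys_lt_y1 hx2' hx3'
  have e3 := (p.walk hp π hπ).y0_pos hx2'.le hx3'.le
  have e4 := (p.walk hp π hπ).y0_mul_y1 hx2'.le hx3'.le
  have hxm := hr.xm_neg
  set L := (p.walk hp π hπ).N p.xPlus ((p.walk hp π hπ).y0 p.xPlus) * (p.xPlus *
    ((p.walk hp π hπ).l2 * ((p.walk hp π hπ).y1 p.xPlus - (p.walk hp π hπ).y0 p.xPlus))) /
    (p.hatMu2 * p.lam * p.lam1 / (p.alpha * (p.lam + p.mu1)) * (p.xPlus - 1) *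
      (p.xPlus - p.xMinus)) with hLdef
  have hL : 0 < L := by
    refine div_pos (mul_pos hN (mul_pos hxp0 (mul_pos (p.walk hp π hπ).l2_pos (by linarith)))) ?_
    exact mul_pos (mul_pos hr.C_pos (by linarith)) (by linarith)
  have hT0 : Tendsto (fun m : ℕ => (m : ℝ) ^ (0 : ℝ) * ((p.walk hp π hπ).u m 0 * p.xPlus ^ m))
      atTop (𝓝 L) := by simpa using hT
  refine ⟨xDom_eq le_rfl zero_le_two hxp0 hL hπ hT0, ?_, fun n hn1 => ?_⟩
  · rw [hy0]
    exact convergesBeyond hp hπ hr.l1_lt e3 e1.le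
  have hTn := (p.walk hp π hπ).tendsto_rows_of_eta_eq hx2'.le hx3'.le heta hT0 n
  have hC1 : p.C1 π * p.xPlus = L := by
    have hl := hp.lam_pos
    have ha := hp.alpha_pos
    rw [C1, hΔ, hy0, boundaryTerm_eq hp hπ hn _ e3.ne', hLdef]
    have h6 : p.xPlus - 1 ≠ 0 := by linarith
    have h7 : p.xPlus - p.xMinus ≠ 0 := by linarith
    have h8 : p.hatMu2 ≠ 0 := (mul_pos hp.2.2.1 hp.2.2.2.2).ne'
    have h9 : p.lam + p.mu1 ≠ 0 := (add_pos hl hp.2.2.2.1).ne'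
    have h10 := hp.1.ne'
    change _ = _ * (_ * (p.lam2 * _)) / _
    rw [hatLam2]
    field_simp
  -- The prefactor -b₁/c equals eta/ys² = y₀/(y₀·y₁) = 1/y₁ at the pole, which supplies the missing
  -- power of 1/Y₁.
  have hA : p.A1 π * (1 / p.Y1 p.xPlus) ^ (n - 1) * p.xPlus ^ (1 : ℤ)
      = L * (1 / (p.walk hp π hπ).y1 p.xPlus) ^ n := by
    obtain ⟨j, rfl⟩ : ∃ j, n = j + 1 := ⟨n - 1, by omega⟩
    rw [hy1, A1, b1_div_c hp hπ hn hxp0.ne', heta, ← hC1, zpow_one, Nat.add_sub_cancel,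
      pow_succ (1 / _) j, ← e4]
    have h1 : (p.walk hp π hπ).y1 p.xPlus ≠ 0 := by linarith
    field_simp
  have hD : L * (1 / (p.walk hp π hπ).y1 p.xPlus) ^ n ≠ 0 :=
    mul_ne_zero hL.ne' (pow_ne_zero _ (one_div_ne_zero (by linarith)))
  have hE := asympEq_of_tendsto hxp0 hD hA hTn
  simp only [neg_zero, Real.rpow_zero, mul_one] at hE
  exact hE

theorem type_two (hp : p.Positive) (hπ : p.IsStationary π) (hn : p.Normalized)
    (hstab : p.Stable) (hwlog : p.hatLam1 < p.hatMu1)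
    (hc : p.Condition2) :
    xDom π = p.x3 ∧ ConvergesBeyond π (p.Y0 (xDom π)) ∧
      ∀ n : ℕ, 1 ≤ n → AsympEq (fun m => π (m, n, 1)) (fun m =>
        p.A2 π / √Real.pi * (1 / p.Y1 (xDom π)) ^ (n - 1) *
          (m : ℝ) ^ (-(1 / 2) : ℝ) * (1 / xDom π) ^ ((m : ℤ) - 1)) := by
  have hr := regular hp hstab hwlog hπ
  obtain ⟨-, hx, -⟩ := hc
  have hx3 := x3_eq hp hπ
  have hx2 := x2_eq hp hπ
  rw [hx, hx3] at hr
  have h23 : p.x2 ≤ p.x3 := by rw [hx3, hx2]; exact (p.walk hp π hπ).xr2_le_xr3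
  have hy0 := Y0_eq hp hπ h23 le_rfl
  have hy1 := Y1_eq hp hπ h23 le_rfl
  rw [hx3, QuarterWalk.y0_xr3, ← hx3] at hy0
  rw [hx3, QuarterWalk.y1_xr3, ← hx3] at hy1
  have heta := hr.eta_eq_ys rfl
  have heta' : (p.walk hp π hπ).eta (p.walk hp π hπ).xr3
      = (p.walk hp π hπ).y0 (p.walk hp π hπ).xr3 := by rw [heta, QuarterWalk.y0_xr3]
  have hT := hr.tendsto_row_branch_pole rfl heta
  have hN := hr.N_pos
  rw [heta] at hN
  obtain ⟨o, ho, -, hoe⟩ := hr.oC_xr3_pos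
  have hsq := sqrt_branch_eq hp hπ
  rw [← hoe] at hT hsq
  rw [← hx3] at hT hN heta heta'
  have hl2 := (p.walk hp π hπ).l2_pos
  have hys := (p.walk hp π hπ).ys_pos
  have hx30 : 0 < p.x3 := by rw [hx3]; exact (p.walk hp π hπ).xr3_pos
  set L := (p.walk hp π hπ).N p.x3 (p.walk hp π hπ).ys /
    ((p.walk hp π hπ).l2 * (p.walk hp π hπ).ys * o) / √Real.pi with hLdef
  have hL : 0 < L := by positivity
  have hT0 : Tendsto (fun m : ℕ => (m : ℝ) ^ (1 / 2 : ℝ) * ((p.walk hp π hπ).u m 0 * p.x3 ^ m))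
      atTop (𝓝 L) := by simpa only [Real.sqrt_eq_rpow] using hT
  have hdom : xDom π = p.x3 := xDom_eq (by norm_num) (by norm_num) hx30 hL hπ hT0
  refine ⟨hdom, ?_, fun n hn1 => ?_⟩
  · rw [hdom, hy0]
    exact convergesBeyond hp hπ hr.l1_lt hys le_rfl
  have hTn := (p.walk hp π hπ).tendsto_rows_of_eta_eq (by rw [← hx2]; exact h23) hx3.le heta' hT0 n
  rw [show (p.walk hp π hπ).y1 p.x3 = p.Y1 p.x3 by rw [hy1, hx3, QuarterWalk.y1_xr3]] at hTn
  have hC2 : p.C2 π / √Real.pi * p.x3 = L := by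
    have h1 := hp.1
    have h2 := hp.2.1
    have hq : √(p.x3 * (p.x3 - p.x1) * (p.x3 - p.x2) * (p.x4 - p.x3))
        = 2 * p.x3 * (p.lam2 * (p.walk hp π hπ).ys * o) / p.lam1 := by
      rw [eq_div_iff h1.ne', hsq]
    rw [C2, hdom, hy0, boundaryTerm_eq hp hπ hn _ hys.ne', hLdef, hq]
    change _ = _ / (p.lam2 * _ * _) / _
    field_simp
  have hA : p.A2 π / √Real.pi * (1 / p.Y1 (xDom π)) ^ (n - 1) * p.x3 ^ (1 : ℤ)
      = L * (1 / p.Y1 p.x3) ^ n := by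
    obtain ⟨j, rfl⟩ : ∃ j, n = j + 1 := ⟨n - 1, by omega⟩
    rw [A2, hdom, hy1, b1_div_c hp hπ hn hx30.ne', heta, ← hC2, zpow_one, Nat.add_sub_cancel,
      pow_succ (1 / _) j]
    field_simp
  have hD : L * (1 / p.Y1 p.x3) ^ n ≠ 0 :=
    mul_ne_zero hL.ne' (pow_ne_zero _ (one_div_ne_zero (by rw [hy1]; exact hys.ne')))
  have := asympEq_of_tendsto hx30 hD hA hTn
  rw [hdom] at this ⊢
  exact this

/-- Summability at the branch point from the coefficient asymptotics. -/
theorem summable_of_tendsto {v : ℕ → ℝ} {x L : ℝ} (hv : ∀ m, 0 ≤ v m) (hx : 0 < x)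
    (h : Tendsto (fun m : ℕ => (m : ℝ) ^ (3 / 2 : ℝ) * (v m * x ^ m)) atTop (𝓝 L)) :
    Summable fun m => v (m + 1) * x ^ (m + 1) := by
  refine (summable_nat_add_iff 1 (f := fun m => v m * x ^ m)).2 ?_
  have hz : Summable fun m : ℕ => (L + 1) * (1 / (m : ℝ) ^ (3 / 2 : ℝ)) :=
    (Real.summable_one_div_nat_rpow.2 (by norm_num)).mul_left _
  refine Summable.of_norm_bounded_eventually_nat hz ?_
  filter_upwards [h.eventually (gt_mem_nhds (show L < L + 1 by linarith)),
    eventually_ge_atTop 1] with m hm hm1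
  have h1 : 0 < (m : ℝ) ^ (3 / 2 : ℝ) := Real.rpow_pos_of_pos (by exact_mod_cast hm1) _
  rw [Real.norm_of_nonneg (mul_nonneg (hv m) (by positivity)), mul_one_div, le_div_iff₀ h1]
  linarith

/-- All alternatives mean that the zero is not on the lower branch: if μ̂₂ ≤ λ̂₂ then ys ≤ 1 < eta;
if x₊ ≤ μ̂₁/λ̂₁ the kernel at (x₊, 1) decides; in the last case equality is excluded by y₀ < ys
before the branch point. -/
theorem ys_lt_eta_of_condition3 (hstab : p.Stable) (hwlog : p.hatLam1 < p.hatMu1)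
    (hc : p.Condition3) : (p.walk hp π hπ).ys < (p.walk hp π hπ).eta p.xPlus := by
  have hr := regular hp hstab hwlog hπ
  have hL : 0 < p.hatLam2 := mul_pos hp.alpha_pos hp.2.1
  rcases hc with h | ⟨-, h⟩ | ⟨-, h, hY⟩
  · refine lt_of_le_of_lt ?_ (hr.one_lt_eta hr.one_lt le_rfl)
    rw [walk_ys]
    exact (Real.sqrt_le_sqrt (div_le_one_of_le₀ h hL.le)).trans Real.sqrt_one.le
  · exact hr.ys_lt_eta_of_le (by rw [← ratio_eq]; exact h.2)
  · rw [YAtXPlus_eq hp hπ (by linarith [hr.one_lt]), ← walk_ys hp hπ] at hY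
    refine hr.ys_lt_eta_of_lt ?_ hY
    rw [← x3_eq hp hπ]
    exact h.2.trans_le (min_le_left _ _)

theorem type_three (hp : p.Positive) (hπ : p.IsStationary π) (hn : p.Normalized)
    (hstab : p.Stable) (hwlog : p.hatLam1 < p.hatMu1)
    (hc : p.Condition3) :
    xDom π = p.x3 ∧ ConvergesBeyond π (p.Y0 p.x3) ∧
      ∀ n : ℕ, 1 ≤ n → AsympEq (fun m => π (m, n, 1)) (fun m =>
        (p.A3 π + ((n : ℝ) - 1) * p.B3 π) / √Real.pi * (1 / p.Y1 p.x3) ^ (n - 1) *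
          (m : ℝ) ^ (-(3 / 2) : ℝ) * (1 / p.x3) ^ ((m : ℤ) - 2)) := by
  have hr := regular hp hstab hwlog hπ
  have heta := ys_lt_eta_of_condition3 hp hπ hstab hwlog hc
  have hx3 := x3_eq hp hπ
  have hx2 := x2_eq hp hπ
  have h23 : p.x2 ≤ p.x3 := by rw [hx3, hx2]; exact (p.walk hp π hπ).xr2_le_xr3
  have hy0 := Y0_eq hp hπ h23 le_rfl
  have hy1 := Y1_eq hp hπ h23 le_rfl
  rw [hx3, QuarterWalk.y0_xr3, ← hx3] at hy0
  rw [hx3, QuarterWalk.y1_xr3, ← hx3] at hy1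
  have hT0 := hr.tendsto_row_branch heta
  obtain ⟨o, ho, -, hoe⟩ := hr.oC_xr3_pos
  have hsq := sqrt_branch_eq hp hπ
  rw [← hoe] at hT0 hsq
  have hys := (p.walk hp π hπ).ys_pos
  have hx30 : 0 < p.x3 := by rw [hx3]; exact (p.walk hp π hπ).xr3_pos
  -- There is no circularity: the m^(-3/2) limit was obtained without knowing its sign. It yields
  -- convergence of P1 at x₃, which in turn is what the positivity of the constant requires.
  have hP : Summable fun m => (p.walk hp π hπ).u (m + 1) 0 * (p.walk hp π hπ).xr3 ^ (m + 1) :=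
    summable_of_tendsto (v := fun m => (p.walk hp π hπ).u m 0)
      (fun m => (p.walk hp π hπ).u_nonneg _ _) (p.walk hp π hπ).xr3_pos hT0
  have h13 := (p.walk hp π hπ).one_lt_xr3 hr.l1_lt
  have hK := hr.K1_y0_neg' heta h13 le_rfl
  have heta3 : (p.walk hp π hπ).ys < (p.walk hp π hπ).eta (p.walk hp π hπ).xr3 := by
    rw [QuarterWalk.y0_xr3, (p.walk hp π hπ).K1_eq_eta _ (by linarith)] at hK
    have := (p.walk hp π hπ).l2_pos
    by_contra hneg
    nlinarith
  rw [QuarterWalk.y0_xr3] at hK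
  have hd := (p.walk hp π hπ).ratio_deriv_pos hr.l1_lt hP hK
  set L := (p.walk hp π hπ).ys * o * deriv (p.walk hp π hπ).ratio (p.walk hp π hπ).ys /
    (2 * √Real.pi) with hLdef
  have hL : 0 < L := by positivity
  have hdom : xDom π = p.x3 := xDom_eq (k := 3 / 2) (by norm_num) (by norm_num) hx30 hL hπ (by
    rw [hx3]; exact hT0)
  refine ⟨hdom, ?_, fun n hn1 => ?_⟩
  · rw [hy0]
    exact convergesBeyond hp hπ hr.l1_lt hys le_rfl
  have hTn := (p.walk hp π hπ).tendsto_rows_xr3 hT0 n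
  rw [← hx3] at hTn heta3
  have hC3 : p.C3 π / √Real.pi * p.x3 ^ 2 = L := by
    have h1 := hp.1
    have h2 := hp.2.1
    have ha := hp.alpha_pos
    have hq : p.qCoeff p.x3 = -((p.walk hp π hπ).ys * o) := by
      have e : p.hatLam1 ^ 2 * p.x3 * (p.x3 - p.x1) * (p.x3 - p.x2) * (p.x4 - p.x3)
          = p.hatLam1 ^ 2 * (p.x3 * (p.x3 - p.x1) * (p.x3 - p.x2) * (p.x4 - p.x3)) := by ring
      have hL1 : 0 < p.hatLam1 := mul_pos ha h1
      have hq' : √(p.x3 * (p.x3 - p.x1) * (p.x3 - p.x2) * (p.x4 - p.x3))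
          = 2 * p.x3 * (p.lam2 * (p.walk hp π hπ).ys * o) / p.lam1 := by
        rw [eq_div_iff h1.ne', hsq]
      rw [qCoeff, e, Real.sqrt_mul (sq_nonneg _), Real.sqrt_sq hL1.le, hq', hatLam1, hatLam2]
      field_simp
    have hder : deriv (fun y : ℝ => -(p.boundaryTerm π p.x3 y) / p.h1 p.x3 y) (p.Y0 p.x3)
        = deriv (p.walk hp π hπ).ratio (p.walk hp π hπ).ys / p.x3 := by
      rw [hy0, ← deriv_div_const]
      refine Filter.EventuallyEq.deriv_eq ?_
      filter_upwards [lt_mem_nhds hys] with y hy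
      rw [boundaryTerm_eq hp hπ hn _ hy.ne', h1_eq hp hπ hn hx30.ne', QuarterWalk.ratio, ← hx3,
        div_div, mul_comm p.x3]
    rw [C3, hq, hder, hLdef]
    field_simp
  -- The prefactors of A₃ and B₃ are eta/ys² and (eta - ys)/ys², and eta + (n-1)(eta - ys) = ys·(1 +
  -- n(eta/ys - 1)); this is the linear factor of the double root.
  have hA : (p.A3 π + ((n : ℝ) - 1) * p.B3 π) / √Real.pi * (1 / p.Y1 p.x3) ^ (n - 1)
        * p.x3 ^ (2 : ℤ)
      = L * (1 + n * ((p.walk hp π hπ).eta p.x3 / (p.walk hp π hπ).ys - 1))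
        * (1 / (p.walk hp π hπ).ys) ^ n := by
    obtain ⟨j, rfl⟩ : ∃ j, n = j + 1 := ⟨n - 1, by omega⟩
    rw [A3, B3, b1_div_c hp hπ hn hx30.ne', p1_div_c hp hπ hn, hy1, ← hC3, Nat.add_sub_cancel,
      pow_succ (1 / _) j, show p.x3 ^ (2 : ℤ) = p.x3 ^ 2 from zpow_ofNat _ 2]
    generalize (1 / (p.walk hp π hπ).ys) ^ j = Z
    push_cast
    field_simp
    ring
  have hD : L * (1 + n * ((p.walk hp π hπ).eta p.x3 / (p.walk hp π hπ).ys - 1))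
      * (1 / (p.walk hp π hπ).ys) ^ n ≠ 0 := by
    have : 0 < (p.walk hp π hπ).eta p.x3 / (p.walk hp π hπ).ys - 1 := by
      rw [sub_pos, one_lt_div hys]; exact heta3
    positivity
  exact asympEq_of_tendsto hx30 hD hA hTn

end RetrialRates

end

theorem mainTheorem2 (p : RetrialRates) (hpos : p.Positive) (hnorm : p.Normalized)
    (hstab : p.Stable) (hwlog : p.hatLam1 < p.hatMu1)
    (π : RetrialRates.State → ℝ) (hπ : p.IsStationary π) :
    (p.Condition1 →
      RetrialRates.xDom π = p.xPlus ∧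
      RetrialRates.ConvergesBeyond π (p.Y0 p.xPlus) ∧
      ∀ n : ℕ, 1 ≤ n → RetrialRates.AsympEq (fun m => π (m, n, 1)) (fun m =>
        p.A1 π * (1 / p.Y1 p.xPlus) ^ (n - 1) * (1 / p.xPlus) ^ ((m : ℤ) - 1))) ∧
    (p.Condition2 →
      RetrialRates.xDom π = p.x3 ∧
      RetrialRates.ConvergesBeyond π (p.Y0 (RetrialRates.xDom π)) ∧
      ∀ n : ℕ, 1 ≤ n → RetrialRates.AsympEq (fun m => π (m, n, 1)) (fun m =>
        p.A2 π / √Real.pi * (1 / p.Y1 (RetrialRates.xDom π)) ^ (n - 1) *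
          (m : ℝ) ^ (-(1 / 2) : ℝ) * (1 / RetrialRates.xDom π) ^ ((m : ℤ) - 1))) ∧
    (p.Condition3 →
      RetrialRates.xDom π = p.x3 ∧
      RetrialRates.ConvergesBeyond π (p.Y0 p.x3) ∧
      ∀ n : ℕ, 1 ≤ n → RetrialRates.AsympEq (fun m => π (m, n, 1)) (fun m =>
        (p.A3 π + ((n : ℝ) - 1) * p.B3 π) / √Real.pi * (1 / p.Y1 p.x3) ^ (n - 1) *
          (m : ℝ) ^ (-(3 / 2) : ℝ) * (1 / p.x3) ^ ((m : ℤ) - 2))) :=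
  ⟨RetrialRates.type_one hpos hπ hnorm hstab hwlog, RetrialRates.type_two hpos hπ hnorm hstab hwlog,
    RetrialRates.type_three hpos hπ hnorm hstab hwlog⟩
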